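/- Work over $\mathbb{C}$. Let $\rho : X \to Y$ be a finite flat morphism of degree $n$ between smooth connected projective curves, and let $\kappa : \widetilde X \to X$ be any finite étale morphism of degree $2$ ($\widetilde X$ need not be connected). Sending a point $y \in Y$ to the divisor $\rho^{*}y$, the sum of its preimages with multiplicity, defines a morphism $Y \to X^{(n)}$ to the $n$-th symmetric power. Let $\widetilde C$ be the scheme-theoretic fibre product $$\widetilde C = Y \times_{X^{(n)}} \widetilde X^{(n)}$$ of this morphism with $\kappa^{(n)} : \widetilde X^{(n)} \to X^{(n)}$, so that a closed point of $\widetilde C$ is a pair $(y, D)$ with $y \in Y$, $D \in \widetilde X^{(n)}$ and $\kappa_* D = \rho^{*}y$. Suppose that there is a point $y \in Y$ such that $\rho^{-1}(y)$ contains exactly two ramification points $\bar x_1 \ne \bar x_2$ of $\rho$, both of ramification index $1$ (that is, of multiplicity $2$ in the fibre), and that every other fibre of $\rho$ contains at most one ramification point, which then has index $1$. Let $\bar x_3, \dots, \bar x_{n-2}$ be the other (distinct) points of $\rho^{-1}(y)$. Then $\widetilde C$ has exactly $2^{n-4}$ singular points (points whose local ring is not regular), and they are the points $$(y,\; x_1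 + x_1' + x_2 + x_2' + x_3 + \cdots + x_{n-2}),$$ where $\kappa^{-1}(\bar x_1) = \{x_1, x_1'\}$, $\kappa^{-1}(\bar x_2) = \{x_2, x_2'\}$ and, for $i \ge 3$, $x_i$ is a point of $\widetilde X$ lying above $\bar x_i$; each such divisor gives exactly one point of $\widetilde C$. -/

import Mathlib

open scoped TensorProduct
open CategoryTheory AlgebraicGeometry

noncomputable section

namespace SymTensor

variable {n : ℕ} {B B' B'' : Type} [CommRing B] [Algebra ℂ B] [CommRing B'] [Algebra ℂ B']
  [CommRing B''] [Algebra ℂ B'']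

/-- The `n`-fold tensor power `B ⊗ ⋯ ⊗ B` over `ℂ`. -/
abbrev TPow (n : ℕ) (B : Type) [CommRing B] [Algebra ℂ B] : Type :=
  PiTensorProduct ℂ (fun _ : Fin n => B)

/-- The algebra map on tensor powers, into any algebra, given by `n` algebra maps
`b₁ ⊗ ⋯ ⊗ bₙ ↦ φ₁ b₁ ⋯ φₙ bₙ`. -/
def prodLift {S : Type} [CommRing S] [Algebra ℂ S] (φ : Fin n → (B →ₐ[ℂ] S)) : TPow n B →ₐ[ℂ] S :=
  PiTensorProduct.liftAlgHom
    ((MultilinearMap.mkPiAlgebra ℂ (Fin n) S).compLinearMap fun i => (φ i).toLinearMap)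
    (by simp) (fun x y => by simp [Finset.prod_mul_distrib])

@[simp] lemma prodLift_tprod {S : Type} [CommRing S] [Algebra ℂ S] (φ : Fin n → (B →ₐ[ℂ] S))
    (b : Fin n → B) : prodLift φ (PiTensorProduct.tprod ℂ b) = ∏ i, φ i (b i) := by
  refine (PiTensorProduct.lift.tprod b).trans ?_
  simp

/-- The permutation action: `b₁ ⊗ ⋯ ⊗ bₙ ↦ b_{σ 1} ⊗ ⋯ ⊗ b_{σ n}`. -/
def perm (σ : Equiv.Perm (Fin n)) : TPow n B →ₐ[ℂ] TPow n B :=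
  prodLift fun i => PiTensorProduct.singleAlgHom (R := ℂ) (A := fun _ : Fin n => B) (σ.symm i)

/-- Functoriality of tensor powers. -/
def tmap (φ : B →ₐ[ℂ] B') : TPow n B →ₐ[ℂ] TPow n B' :=
  prodLift fun i => (PiTensorProduct.singleAlgHom (R := ℂ) (A := fun _ : Fin n => B') i).comp φ

lemma prod_single (b : Fin n → B) (τ : Equiv.Perm (Fin n)) :
    ∏ i, PiTensorProduct.singleAlgHom (R := ℂ) (A := fun _ : Fin n => B) (τ i) (b i) =
      PiTensorProduct.tprod ℂ (fun i => b (τ.symm i)) := by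
  simp only [PiTensorProduct.singleAlgHom_apply]
  rw [← PiTensorProduct.tprod_prod]
  congr 1
  ext j
  rw [Finset.prod_apply, Finset.prod_eq_single (τ.symm j)]
  · simp
  · intro i _ hi
    have : τ i ≠ j := fun h => hi (by simp [← h])
    simp [this.symm]
  · simp

@[simp] lemma perm_tprod (σ : Equiv.Perm (Fin n)) (b : Fin n → B) :
    perm σ (PiTensorProduct.tprod ℂ b) = PiTensorProduct.tprod ℂ (fun i => b (σ i)) := by
  rw [perm, prodLift_tprod]
  exact prod_single b σ.symm

@[simp] lemma tmap_tprod (φ : B →ₐ[ℂ] B') (b : Fin n → B) :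
    tmap φ (PiTensorProduct.tprod ℂ b) = PiTensorProduct.tprod ℂ (fun i => φ (b i)) := by
  rw [tmap, prodLift_tprod]
  exact prod_single (fun i => φ (b i)) 1

lemma algHom_ext_tprod {S : Type} [CommRing S] [Algebra ℂ S] {f g : TPow n B →ₐ[ℂ] S}
    (h : ∀ b, f (PiTensorProduct.tprod ℂ b) = g (PiTensorProduct.tprod ℂ b)) : f = g := by
  apply AlgHom.toLinearMap_injective
  exact PiTensorProduct.ext (MultilinearMap.ext h)

/-- The algebra of symmetric tensors `(B^{⊗ n})^{𝔖ₙ}`, the coordinate ring of the `n`-th symmetric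
power of `Spec B`. -/
def TS (n : ℕ) (B : Type) [CommRing B] [Algebra ℂ B] : Subalgebra ℂ (TPow n B) :=
  ⨅ σ : Equiv.Perm (Fin n), AlgHom.equalizer (perm σ) (AlgHom.id ℂ _)

lemma mem_TS {t : TPow n B} : t ∈ TS n B ↔ ∀ σ, perm σ t = t := by
  simp [TS, Algebra.mem_iInf, AlgHom.mem_equalizer]

lemma perm_tmap (φ : B →ₐ[ℂ] B') (σ : Equiv.Perm (Fin n)) (t : TPow n B) :
    perm σ (tmap φ t) = tmap φ (perm σ t) := by
  have : (perm σ).comp (tmap φ) = (tmap φ).comp (perm (B := B) σ) :=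
    algHom_ext_tprod fun b => by simp
  exact DFunLike.congr_fun this t

/-- Functoriality of symmetric tensors: the map of symmetric powers induced by `φ`. -/
def tsMap (φ : B →ₐ[ℂ] B') : TS n B →ₐ[ℂ] TS n B' :=
  ((tmap φ).comp (TS n B).val).codRestrict _ fun t => by
    refine mem_TS.2 fun σ => ?_
    simp [perm_tmap, mem_TS.1 t.2 σ]

@[simp] lemma coe_tsMap (φ : B →ₐ[ℂ] B') (t : TS n B) : (tsMap φ t : TPow n B') = tmap φ t := rfl

lemma tmap_comp (φ : B →ₐ[ℂ] B') (ψ : B' →ₐ[ℂ] B'') (t : TPow n B) :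
    tmap (ψ.comp φ) t = tmap ψ (tmap φ t) := by
  have : tmap (ψ.comp φ) = (tmap ψ).comp (tmap (n := n) φ) :=
    algHom_ext_tprod fun b => by simp
  exact DFunLike.congr_fun this t

lemma tmap_id (t : TPow n B) : tmap (AlgHom.id ℂ B) t = t := by
  have : tmap (AlgHom.id ℂ B) = AlgHom.id ℂ (TPow n B) := algHom_ext_tprod fun b => by simp
  exact DFunLike.congr_fun this t

lemma prodLift_tmap {S : Type} [CommRing S] [Algebra ℂ S] (φ : B →ₐ[ℂ] B')
    (ψ : Fin n → (B' →ₐ[ℂ] S)) (t : TPow n B) :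
    prodLift ψ (tmap φ t) = prodLift (fun i => (ψ i).comp φ) t := by
  have : (prodLift ψ).comp (tmap φ) = prodLift (fun i => (ψ i).comp φ) :=
    algHom_ext_tprod fun b => by simp
  exact DFunLike.congr_fun this t

/-- The symmetric tensor `b ⊗ ⋯ ⊗ b`. -/
def diagTensor (n : ℕ) (b : B) : TS n B :=
  ⟨PiTensorProduct.tprod ℂ fun _ => b, mem_TS.2 fun σ => by simp⟩

lemma tsMap_diagTensor (φ : B →ₐ[ℂ] B') (b : B) :
    tsMap φ (diagTensor n b) = diagTensor n (φ b) := Subtype.ext (by simp [diagTensor])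

section Localization

variable (g : B) (φ : B →ₐ[ℂ] B')

lemma coe_diagTensor_eq_prod (b : B) : (diagTensor n b : TPow n B) =
    ∏ i, PiTensorProduct.singleAlgHom (R := ℂ) (A := fun _ : Fin n => B) i b :=
  (prod_single (fun _ => b) 1).symm

/-- Elements of the tensor power of a localization, up to a power of the denominator. -/
lemma exists_tmap_eq (hφ : letI := φ.toRingHom.toAlgebra; IsLocalization.Away g B')
    (t : TPow n B') : ∃ (N : ℕ) (u : TPow n B),
      tmap φ u = (diagTensor n (φ g) : TPow n B') ^ N * t := by
  let := φ.toRingHom.toAlgebra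
  induction t using PiTensorProduct.induction_on with
  | smul_tprod r b =>
    choose m a ha using fun i => IsLocalization.Away.surj g (b i)
    refine ⟨∑ i, m i, r • PiTensorProduct.tprod ℂ
      (fun i => g ^ ((∑ j, m j) - m i) * a i), ?_⟩
    rw [map_smul, tmap_tprod, mul_smul_comm]
    congr 1
    have : (diagTensor n (φ g) : TPow n B') ^ (∑ i, m i) =
        PiTensorProduct.tprod ℂ (fun _ => (φ g) ^ (∑ i, m i)) := by
      change (PiTensorProduct.tprodMonoidHom ℂ (fun _ : Fin n => φ g)) ^ _ = _
      rw [← map_pow]; rfl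
    rw [this, PiTensorProduct.tprod_mul_tprod]
    congr 1
    ext i
    have h1 : b i * φ g ^ m i = φ (a i) := ha i
    have h2 : m i ≤ ∑ j, m j := Finset.single_le_sum (f := m) (by simp) (Finset.mem_univ i)
    simp only [map_mul, map_pow, Pi.mul_apply]
    rw [← h1, mul_comm (b i), ← mul_assoc, ← pow_add, Nat.sub_add_cancel h2]
  | add x y hx hy =>
    obtain ⟨N, u, hu⟩ := hx
    obtain ⟨M, v, hv⟩ := hy
    refine ⟨N + M, (diagTensor n g : TPow n B) ^ M * u + (diagTensor n g : TPow n B) ^ N * v, ?_⟩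
    have : tmap φ (diagTensor n g : TPow n B) = (diagTensor n (φ g) : TPow n B') := by
      simp [diagTensor]
    rw [map_add, map_mul, map_mul, map_pow, map_pow, hu, hv, this]
    ring

lemma exists_mul_eq_zero (hφ : letI := φ.toRingHom.toAlgebra; IsLocalization.Away g B')
    (t : TPow n B) (ht : tmap φ t = 0) :
    ∃ N : ℕ, (diagTensor n g : TPow n B) ^ N * t = 0 := by
  let := φ.toRingHom.toAlgebra
  have : IsScalarTower ℂ B B' := IsScalarTower.of_algebraMap_eq fun x => (φ.commutes x).symm
  let L := Localization.Away (diagTensor n g : TPow n B)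
  let e : Fin n → (B →ₐ[ℂ] L) := fun i => (IsScalarTower.toAlgHom ℂ (TPow n B) L).comp
    (PiTensorProduct.singleAlgHom (R := ℂ) (A := fun _ : Fin n => B) i)
  have hprod : ∏ i, e i g = algebraMap (TPow n B) L (diagTensor n g) := by
    exact (map_prod (algebraMap (TPow n B) L) _ _).symm.trans
      (congrArg (algebraMap (TPow n B) L) (coe_diagTensor_eq_prod g).symm)
  have hu : ∀ i, IsUnit (e i g) := by
    have : IsUnit (∏ i, e i g) := by
      rw [hprod]; exact IsLocalization.Away.algebraMap_isUnit _
    intro i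
    exact isUnit_of_dvd_unit (Finset.dvd_prod_of_mem (fun i => e i g) (Finset.mem_univ i)) this
  let l : Fin n → (B' →ₐ[ℂ] L) := fun i =>
    { IsLocalization.Away.lift g (hu i) with
      commutes' := fun r => by
        have : algebraMap ℂ B' r = algebraMap B B' (algebraMap ℂ B r) :=
          IsScalarTower.algebraMap_apply ℂ B B' r
        simp only [this]
        exact (IsLocalization.Away.lift_eq g (hu i) _).trans ((e i).commutes r) }
  have hl : ∀ i b, l i (φ b) = e i b := fun i b => IsLocalization.Away.lift_eq g (hu i) b
  have key : (prodLift l).comp (tmap φ) = IsScalarTower.toAlgHom ℂ (TPow n B) L :=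
    algHom_ext_tprod fun b => by
      have := prod_single (n := n) b 1
      simp only [AlgHom.comp_apply, tmap_tprod, prodLift_tprod, hl, e]
      rw [← map_prod]
      exact congrArg _ this
  have h0 : algebraMap (TPow n B) L t = 0 := by
    have := DFunLike.congr_fun key t
    simp only [AlgHom.comp_apply, ht, map_zero] at this
    exact this.symm
  rw [IsLocalization.map_eq_zero_iff (Submonoid.powers (diagTensor n g : TPow n B))] at h0
  obtain ⟨⟨_, N, rfl⟩, h⟩ := h0
  exact ⟨N, h⟩

/-- Symmetric tensors commute with localization. -/
lemma isLocalization_tsMap (hφ : letI := φ.toRingHom.toAlgebra; IsLocalization.Away g B') :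
    letI := (tsMap (n := n) φ).toRingHom.toAlgebra
    IsLocalization.Away (diagTensor n g) (TS n B') := by
  let := (tsMap (n := n) φ).toRingHom.toAlgebra
  let := φ.toRingHom.toAlgebra
  have hg : IsUnit (φ g) := IsLocalization.Away.algebraMap_isUnit g
  have h0 : ∀ t : TS n B, tsMap φ t = 0 → ∃ N : ℕ, diagTensor n g ^ N * t = 0 := by
    intro t ht
    obtain ⟨N, hN⟩ := exists_mul_eq_zero g φ hφ (t : TPow n B) (congrArg Subtype.val ht)
    exact ⟨N, Subtype.ext hN⟩
  refine ⟨?_, ?_, ?_⟩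
  · rintro ⟨_, N, rfl⟩
    change IsUnit (tsMap φ (diagTensor n g ^ N))
    rw [map_pow, tsMap_diagTensor]
    refine IsUnit.pow _ ?_
    obtain ⟨v, hv⟩ := hg.exists_right_inv
    refine IsUnit.of_mul_eq_one (diagTensor n v) (Subtype.ext ?_)
    change PiTensorProduct.tprod ℂ _ * PiTensorProduct.tprod ℂ _ = _
    rw [PiTensorProduct.tprod_mul_tprod]
    simp only [Pi.mul_def, hv]
    rfl
  · intro t
    obtain ⟨N, u, hu⟩ := exists_tmap_eq g φ hφ (t : TPow n B')
    have hinv : ∀ σ : Equiv.Perm (Fin n), ∃ M : ℕ,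
        (diagTensor n g : TPow n B) ^ M * (perm σ u - u) = 0 := by
      intro σ
      apply exists_mul_eq_zero g φ hφ
      rw [map_sub, ← perm_tmap, hu, map_mul, map_pow, mem_TS.1 t.2 σ,
        mem_TS.1 (diagTensor n (φ g)).2 σ, sub_self]
    choose M hM using hinv
    let K := ∑ σ, M σ
    have hK : (diagTensor n g : TPow n B) ^ K * u ∈ TS n B := by
      refine mem_TS.2 fun σ => ?_
      rw [map_mul, map_pow, mem_TS.1 (diagTensor n g).2 σ, ← sub_eq_zero, ← mul_sub]
      have : M σ ≤ K := Finset.single_le_sum (f := M) (by simp) (Finset.mem_univ σ)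
      rw [← Nat.sub_add_cancel this, pow_add, mul_assoc, hM, mul_zero]
    refine ⟨⟨⟨_, hK⟩, ⟨diagTensor n g ^ (K + N), K + N, rfl⟩⟩, ?_⟩
    change t * tsMap φ (diagTensor n g ^ (K + N)) = tsMap φ _
    apply Subtype.ext
    rw [map_pow, tsMap_diagTensor]
    change (t : TPow n B') * (diagTensor n (φ g) : TPow n B') ^ (K + N) =
      tmap φ ((diagTensor n g : TPow n B) ^ K * u)
    have : tmap φ (diagTensor n g : TPow n B) = (diagTensor n (φ g) : TPow n B') := by
      simp [diagTensor]
    rw [map_mul, map_pow, this, hu]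
    ring
  · intro x y hxy
    obtain ⟨N, hN⟩ := h0 (x - y) (by rw [map_sub]; exact sub_eq_zero.2 hxy)
    exact ⟨⟨_, N, rfl⟩, by rwa [mul_sub, sub_eq_zero] at hN⟩

end Localization

end SymTensor

namespace SymTensor

variable {n : ℕ} {A A' A'' B B' C C' C'' : Type}
  [CommRing A] [Algebra ℂ A] [CommRing A'] [Algebra ℂ A'] [CommRing A''] [Algebra ℂ A'']
  [CommRing B] [Algebra ℂ B] [CommRing B'] [Algebra ℂ B']
  [CommRing C] [Algebra ℂ C] [CommRing C'] [Algebra ℂ C'] [CommRing C''] [Algebra ℂ C'']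

/-- Let `κ : B → C` be an algebra map and let `Rel a f` be the graph of (the comorphism of) a
morphism from `Spec A` to the `n`-th symmetric power `Spec (TS n B)`: it says that `a` is the
pullback of the function `f`. The ideal of `A ⊗ TS n C` defining the fibre product of `Spec A`
and `Spec (TS n C)` over `Spec (TS n B)` inside `Spec A × Spec (TS n C)`. -/
def fibreIdeal (κ : B →ₐ[ℂ] C) (Rel : A → TS n B → Prop) : Ideal (A ⊗[ℂ] TS n C) :=
  Ideal.span {z | ∃ a f, Rel a f ∧ z = a ⊗ₜ 1 - 1 ⊗ₜ tsMap κ f}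

/-- The coordinate ring `A ⊗ TS n C / (a ⊗ 1 - 1 ⊗ κ f)` of the fibre product of `Spec A` and
`Spec (TS n C)` over `Spec (TS n B)`. -/
def FibreRing (κ : B →ₐ[ℂ] C) (Rel : A → TS n B → Prop) : Type :=
  (A ⊗[ℂ] TS n C) ⧸ fibreIdeal κ Rel

instance (κ : B →ₐ[ℂ] C) (Rel : A → TS n B → Prop) : CommRing (FibreRing κ Rel) :=
  inferInstanceAs (CommRing ((A ⊗[ℂ] TS n C) ⧸ fibreIdeal κ Rel))

instance (κ : B →ₐ[ℂ] C) (Rel : A → TS n B → Prop) : Algebra ℂ (FibreRing κ Rel) :=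
  inferInstanceAs (Algebra ℂ ((A ⊗[ℂ] TS n C) ⧸ fibreIdeal κ Rel))

/-- The quotient map from `A ⊗ TS n C`. -/
def fibreMk (κ : B →ₐ[ℂ] C) (Rel : A → TS n B → Prop) : A ⊗[ℂ] TS n C →ₐ[ℂ] FibreRing κ Rel :=
  Ideal.Quotient.mkₐ ℂ (fibreIdeal κ Rel)

lemma fibreMk_surjective (κ : B →ₐ[ℂ] C) (Rel : A → TS n B → Prop) :
    Function.Surjective (fibreMk κ Rel) := Ideal.Quotient.mk_surjective

/-- The functions on `Spec A`, as functions on the fibre product. -/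
def fibreLeft (κ : B →ₐ[ℂ] C) (Rel : A → TS n B → Prop) : A →ₐ[ℂ] FibreRing κ Rel :=
  (fibreMk κ Rel).comp Algebra.TensorProduct.includeLeft

/-- The functions on the symmetric power `Spec (TS n C)`, as functions on the fibre product. -/
def fibreRight (κ : B →ₐ[ℂ] C) (Rel : A → TS n B → Prop) : TS n C →ₐ[ℂ] FibreRing κ Rel :=
  (fibreMk κ Rel).comp Algebra.TensorProduct.includeRight

lemma fibreLeft_eq {κ : B →ₐ[ℂ] C} {Rel : A → TS n B → Prop} {a : A} {f : TS n B} (h : Rel a f) :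
    fibreLeft κ Rel a = fibreRight κ Rel (tsMap κ f) := by
  refine (Ideal.Quotient.mk_eq_mk_iff_sub_mem _ _).2 (Ideal.subset_span ⟨a, f, h, rfl⟩)

/-- The universal property of the coordinate ring of the fibre product. -/
def fibreLift {S : Type} [CommRing S] [Algebra ℂ S] (κ : B →ₐ[ℂ] C) (Rel : A → TS n B → Prop)
    (α : A →ₐ[ℂ] S) (τ : TS n C →ₐ[ℂ] S) (h : ∀ a f, Rel a f → α a = τ (tsMap κ f)) :
    FibreRing κ Rel →ₐ[ℂ] S :=
  Ideal.Quotient.liftₐ _ (Algebra.TensorProduct.productMap α τ) (by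
    intro z hz
    have : fibreIdeal κ Rel ≤ RingHom.ker (Algebra.TensorProduct.productMap α τ) := by
      refine Ideal.span_le.2 ?_
      rintro _ ⟨a, f, hf, rfl⟩
      simp [RingHom.mem_ker, h a f hf]
    exact this hz)

section lift
variable {S : Type} [CommRing S] [Algebra ℂ S] {κ : B →ₐ[ℂ] C} {Rel : A → TS n B → Prop}

@[simp] lemma fibreLift_left (α : A →ₐ[ℂ] S) (τ : TS n C →ₐ[ℂ] S)
    (h : ∀ a f, Rel a f → α a = τ (tsMap κ f)) (a : A) :
    fibreLift κ Rel α τ h (fibreLeft κ Rel a) = α a := by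
  refine (Ideal.Quotient.lift_mk (fibreIdeal κ Rel) _ _).trans ?_
  simp

@[simp] lemma fibreLift_right (α : A →ₐ[ℂ] S) (τ : TS n C →ₐ[ℂ] S)
    (h : ∀ a f, Rel a f → α a = τ (tsMap κ f)) (t : TS n C) :
    fibreLift κ Rel α τ h (fibreRight κ Rel t) = τ t := by
  refine (Ideal.Quotient.lift_mk (fibreIdeal κ Rel) _ _).trans ?_
  simp

lemma fibreHom_ext {S : Type} [CommRing S] {f g : FibreRing κ Rel →+* S}
    (h₁ : ∀ a, f (fibreLeft κ Rel a) = g (fibreLeft κ Rel a))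
    (h₂ : ∀ t, f (fibreRight κ Rel t) = g (fibreRight κ Rel t)) : f = g := by
  refine RingHom.ext fun z => ?_
  obtain ⟨z, rfl⟩ := fibreMk_surjective κ Rel z
  induction z using TensorProduct.induction_on with
  | zero => simp
  | tmul a t =>
    have : fibreMk κ Rel (a ⊗ₜ[ℂ] t) = fibreLeft κ Rel a * fibreRight κ Rel t := by
      change _ = fibreMk κ Rel (a ⊗ₜ[ℂ] 1) * fibreMk κ Rel (1 ⊗ₜ[ℂ] t)
      rw [← map_mul]
      simp
    rw [this, map_mul, map_mul, h₁, h₂]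
  | add x y hx hy => rw [map_add, map_add, map_add, hx, hy]

end lift

/-- Functoriality of the coordinate ring of the fibre product. -/
def fibreMap {κ : B →ₐ[ℂ] C} {Rel : A → TS n B → Prop} {κ' : B' →ₐ[ℂ] C'}
    {Rel' : A' → TS n B' → Prop} (α : A →ₐ[ℂ] A') (β : B →ₐ[ℂ] B') (γ : C →ₐ[ℂ] C')
    (hκ : γ.comp κ = κ'.comp β) (h : ∀ a f, Rel a f → Rel' (α a) (tsMap β f)) :
    FibreRing κ Rel →ₐ[ℂ] FibreRing κ' Rel' :=
  fibreLift κ Rel ((fibreLeft κ' Rel').comp α) ((fibreRight κ' Rel').comp (tsMap γ)) (by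
    intro a f hf
    have : tsMap γ (tsMap κ f) = tsMap κ' (tsMap β f) := Subtype.ext (by
      simp only [coe_tsMap, ← tmap_comp, hκ])
    simp only [AlgHom.comp_apply, this]
    exact fibreLeft_eq (h a f hf))

section map
variable {κ : B →ₐ[ℂ] C} {Rel : A → TS n B → Prop} {κ' : B' →ₐ[ℂ] C'}
    {Rel' : A' → TS n B' → Prop} (α : A →ₐ[ℂ] A') (β : B →ₐ[ℂ] B') (γ : C →ₐ[ℂ] C')
    (hκ : γ.comp κ = κ'.comp β) (h : ∀ a f, Rel a f → Rel' (α a) (tsMap β f))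

@[simp] lemma fibreMap_left (a : A) : fibreMap α β γ hκ h (fibreLeft κ Rel a) =
    fibreLeft κ' Rel' (α a) := by simp [fibreMap]

@[simp] lemma fibreMap_right (t : TS n C) : fibreMap α β γ hκ h (fibreRight κ Rel t) =
    fibreRight κ' Rel' (tsMap γ t) := by simp [fibreMap]

/-- The formation of the fibre product commutes with localization on `Spec A`. -/
lemma isLocalization_fibreMap (g : A) (b : B)
    (hA : letI := α.toRingHom.toAlgebra; IsLocalization.Away g A')
    (hC : letI := γ.toRingHom.toAlgebra; IsLocalization.Away (κ b) C')
    (hrel : Rel (g ^ n) (diagTensor n b))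
    (hrel' : ∀ a' f', Rel' a' f' → ∃ (N : ℕ) (a : A) (f : TS n B), Rel a f ∧
      α a = α g ^ (n * N) * a' ∧ tsMap β f = diagTensor n (β b) ^ N * f') :
    letI := (fibreMap α β γ hκ h).toRingHom.toAlgebra
    IsLocalization.Away (fibreLeft κ Rel g) (FibreRing κ' Rel') := by
  let algR : Algebra (FibreRing κ Rel) (FibreRing κ' Rel') :=
    (fibreMap α β γ hκ h).toRingHom.toAlgebra
  let L := Localization.Away (fibreLeft κ Rel g)
  let ι : FibreRing κ Rel →ₐ[ℂ] L := IsScalarTower.toAlgHom ℂ (FibreRing κ Rel) L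
  have hug : IsUnit (ι (fibreLeft κ Rel g)) :=
    IsLocalization.Away.algebraMap_isUnit (fibreLeft κ Rel g)
  have hgn : fibreLeft κ Rel g ^ n = fibreRight κ Rel (diagTensor n (κ b)) := by
    rw [← map_pow, fibreLeft_eq hrel, tsMap_diagTensor]
  have huc : IsUnit (ι (fibreRight κ Rel (diagTensor n (κ b)))) := by
    rw [← hgn, map_pow]
    exact hug.pow n
  let algA : Algebra A A' := α.toRingHom.toAlgebra
  let algT : Algebra (TS n C) (TS n C') := (tsMap (n := n) γ).toRingHom.toAlgebra
  have hT : IsLocalization.Away (diagTensor n (κ b)) (TS n C') := isLocalization_tsMap (κ b) γ hC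
  let ψA : A' →ₐ[ℂ] L :=
    { IsLocalization.Away.lift (S := A') g (g := (ι.comp (fibreLeft κ Rel)).toRingHom) hug with
      commutes' := fun r => by
        have hr : algebraMap ℂ A' r = algebraMap A A' (algebraMap ℂ A r) := (α.commutes r).symm
        simp only [hr]
        exact (IsLocalization.Away.lift_eq g (g := (ι.comp (fibreLeft κ Rel)).toRingHom) hug
          _).trans ((ι.comp (fibreLeft κ Rel)).commutes r) }
  have hψA : ∀ a, ψA (α a) = ι (fibreLeft κ Rel a) := fun a =>
    IsLocalization.Away.lift_eq g (g := (ι.comp (fibreLeft κ Rel)).toRingHom) hug a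
  let ψT : TS n C' →ₐ[ℂ] L :=
    { IsLocalization.Away.lift (S := TS n C') (diagTensor n (κ b))
        (g := (ι.comp (fibreRight κ Rel)).toRingHom) huc with
      commutes' := fun r => by
        have hr : algebraMap ℂ (TS n C') r =
          algebraMap (TS n C) (TS n C') (algebraMap ℂ (TS n C) r) :=
            ((tsMap (n := n) γ).commutes r).symm
        simp only [hr]
        exact (IsLocalization.Away.lift_eq (diagTensor n (κ b))
          (g := (ι.comp (fibreRight κ Rel)).toRingHom) huc _).trans
          ((ι.comp (fibreRight κ Rel)).commutes r) }
  have hψT : ∀ t, ψT (tsMap γ t) = ι (fibreRight κ Rel t) := fun t =>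
    IsLocalization.Away.lift_eq (diagTensor n (κ b))
      (g := (ι.comp (fibreRight κ Rel)).toRingHom) huc t
  have hκ' : ∀ x, κ' (β x) = γ (κ x) := fun x => (DFunLike.congr_fun hκ x).symm
  have hts : ∀ f, tsMap κ' (tsMap β f) = tsMap (n := n) γ (tsMap κ f) := fun f => Subtype.ext (by
    simp only [coe_tsMap, ← tmap_comp, hκ])
  let ψ : FibreRing κ' Rel' →ₐ[ℂ] L := fibreLift κ' Rel' ψA ψT (by
    intro a' f' hf'
    obtain ⟨N, a, f, haf, ha, hf⟩ := hrel' a' f' hf'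
    have e1 : ψA (α a) = ψT (tsMap γ (tsMap κ f)) := by
      rw [hψA, hψT, fibreLeft_eq haf]
    have e2 : diagTensor n (κ' (β b)) = tsMap (n := n) γ (diagTensor n (κ b)) := by
      rw [tsMap_diagTensor, hκ']
    rw [← hts, hf, ha, map_mul, map_mul, map_pow, map_pow, tsMap_diagTensor, e2, map_mul,
      map_pow, hψA, hψT, ← hgn, map_pow, ← pow_mul] at e1
    exact (hug.pow _).mul_left_cancel e1)
  have h1 : ∀ z, ψ (fibreMap α β γ hκ h z) = ι z := by
    have : (ψ.comp (fibreMap α β γ hκ h)).toRingHom = ι.toRingHom :=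
      fibreHom_ext (fun a => by simp [ψ, hψA]) (fun t => by simp [ψ, hψT])
    exact fun z => RingHom.congr_fun this z
  have hug' : IsUnit (fibreMap α β γ hκ h (fibreLeft κ Rel g)) := by
    rw [fibreMap_left]
    have : IsUnit (α g) := IsLocalization.Away.algebraMap_isUnit g
    exact this.map (fibreLeft κ' Rel')
  let φ : L →+* FibreRing κ' Rel' :=
    IsLocalization.Away.lift (fibreLeft κ Rel g) (g := (fibreMap α β γ hκ h).toRingHom) hug'
  have hφ : ∀ z, φ (ι z) = fibreMap α β γ hκ h z := fun z =>
    IsLocalization.Away.lift_eq (fibreLeft κ Rel g) (g := (fibreMap α β γ hκ h).toRingHom) hug' z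
  have h2 : φ.comp ψ.toRingHom = RingHom.id _ := by
    refine fibreHom_ext (fun a' => ?_) (fun t' => ?_)
    · have : (φ.comp ψ.toRingHom).comp (fibreLeft κ' Rel').toRingHom =
          (fibreLeft κ' Rel').toRingHom := by
        refine IsLocalization.ringHom_ext (R := A) (S := A') (Submonoid.powers g)
          (RingHom.ext fun a => ?_)
        change φ (ψ (fibreLeft κ' Rel' (α a))) = fibreLeft κ' Rel' (α a)
        rw [← fibreMap_left (κ := κ) (Rel := Rel) α β γ hκ h, h1, hφ]
      exact RingHom.congr_fun this a'
    · have : (φ.comp ψ.toRingHom).comp (fibreRight κ' Rel').toRingHom =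
          (fibreRight κ' Rel').toRingHom := by
        refine IsLocalization.ringHom_ext (R := TS n C) (S := TS n C')
          (Submonoid.powers (diagTensor n (κ b))) (RingHom.ext fun t => ?_)
        change φ (ψ (fibreRight κ' Rel' (tsMap γ t))) = fibreRight κ' Rel' (tsMap γ t)
        rw [← fibreMap_right (κ := κ) (Rel := Rel) α β γ hκ h, h1, hφ]
      exact RingHom.congr_fun this t'
  have h3 : ψ.toRingHom.comp φ = RingHom.id _ := by
    refine IsLocalization.ringHom_ext (R := FibreRing κ Rel) (S := L)
      (Submonoid.powers (fibreLeft κ Rel g)) (RingHom.ext fun z => ?_)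
    change ψ (φ (ι z)) = ι z
    rw [hφ, h1]
  let e : L ≃ₐ[FibreRing κ Rel] FibreRing κ' Rel' :=
    AlgEquiv.ofRingEquiv (f := RingEquiv.ofRingHom φ ψ.toRingHom h2 h3) hφ
  exact IsLocalization.isLocalization_of_algEquiv _ e

end map

end SymTensor

namespace CurveLift

open SymTensor

/-- `Γ(X, U)`, as an algebra over `ℂ`, for a scheme `X` over `ℂ` with structure morphism `s`. -/
def Sec {X : Scheme.{0}} (_s : X ⟶ Spec (.of ℂ)) (U : X.Opens) : Type := Γ(X, U)

section Sec

variable {X Y Z : Scheme.{0}} (s : Y ⟶ Spec (.of ℂ))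

instance (U : Y.Opens) : CommRing (Sec s U) := inferInstanceAs (CommRing Γ(Y, U))

lemma le_preimage_top {X : Scheme.{0}} (s : X ⟶ Spec (.of ℂ)) (U : X.Opens) : U ≤ s ⁻¹ᵁ ⊤ :=
  fun _ _ => trivial

instance (U : Y.Opens) : Algebra ℂ (Sec s U) :=
  RingHom.toAlgebra ((Scheme.ΓSpecIso (.of ℂ)).inv ≫ s.appLE ⊤ U (le_preimage_top s U)).hom

/-- Pullback of functions along a morphism `f : X ⟶ Y` of schemes over `ℂ`, from `U ⊆ Y` to
`V ⊆ f⁻¹ U`. -/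
def secPull (f : X ⟶ Y) (U : Y.Opens) (V : X.Opens) (h : V ≤ f ⁻¹ᵁ U) :
    Sec s U →ₐ[ℂ] Sec (f ≫ s) V :=
  { (f.appLE U V h).hom with
    commutes' := fun r => by
      change ((Scheme.ΓSpecIso (.of ℂ)).inv ≫ s.appLE ⊤ U (le_preimage_top s U) ≫ f.appLE U V h).hom r =
        ((Scheme.ΓSpecIso (.of ℂ)).inv ≫ (f ≫ s).appLE ⊤ V (le_preimage_top (f ≫ s) V)).hom r
      rw [Scheme.Hom.appLE_comp_appLE] }

/-- Restriction of functions to a smaller open subset. -/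
def secRes {U V : Y.Opens} (h : V ≤ U) : Sec s U →ₐ[ℂ] Sec s V :=
  { (Y.presheaf.map (homOfLE h).op).hom with
    commutes' := fun r => by
      change ((Scheme.ΓSpecIso (.of ℂ)).inv ≫ s.appLE ⊤ U (le_preimage_top s U) ≫
        Y.presheaf.map (homOfLE h).op).hom r =
        ((Scheme.ΓSpecIso (.of ℂ)).inv ≫ s.appLE ⊤ V (le_preimage_top s V)).hom r
      rw [Scheme.Hom.appLE_map] }

lemma secRes_self {U : Y.Opens} (h : U ≤ U) : secRes s h = AlgHom.id ℂ _ := by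
  refine AlgHom.ext fun a => ?_
  change (Y.presheaf.map (homOfLE h).op).hom a = a
  rw [show (homOfLE h).op = 𝟙 _ from rfl, Y.presheaf.map_id]
  rfl

lemma secRes_comp {U V W : Y.Opens} (h : V ≤ U) (h' : W ≤ V) :
    (secRes s h').comp (secRes s h) = secRes s (h'.trans h) := by
  refine AlgHom.ext fun a => ?_
  change (Y.presheaf.map (homOfLE h).op ≫ Y.presheaf.map (homOfLE h').op).hom a = _
  rw [← Y.presheaf.map_comp]
  rfl

lemma secRes_secPull (f : X ⟶ Y) {U U' : Y.Opens} {V V' : X.Opens} (h : V ≤ f ⁻¹ᵁ U)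
    (h' : V' ≤ f ⁻¹ᵁ U') (hU : U' ≤ U) (hV : V' ≤ V) :
    (secRes (f ≫ s) hV).comp (secPull s f U V h) = (secPull s f U' V' h').comp (secRes s hU) := by
  refine AlgHom.ext fun a => ?_
  change (f.appLE U V h ≫ X.presheaf.map (homOfLE hV).op).hom a =
    (Y.presheaf.map (homOfLE hU).op ≫ f.appLE U' V' h').hom a
  rw [Scheme.Hom.appLE_map, Scheme.Hom.map_appLE]

end Sec

/-- The complex points of a scheme `X` over `ℂ`; when `X` is of finite type these are the closed
points of `X`. -/
def CPoint {X : Scheme.{0}} (s : X ⟶ Spec (.of ℂ)) : Type :=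
  {p : Spec (.of ℂ) ⟶ X // p ≫ s = 𝟙 _}

namespace CPoint

variable {X Y : Scheme.{0}} {s : Y ⟶ Spec (.of ℂ)}

/-- The underlying (closed) point of the scheme. -/
def pt (p : CPoint s) : Y := p.1 (IsLocalRing.closedPoint ℂ)

/-- The image of a complex point under a morphism. -/
def map (f : X ⟶ Y) (p : CPoint (f ≫ s)) : CPoint s :=
  ⟨p.1 ≫ f, by rw [Category.assoc]; exact p.2⟩

lemma pt_map (f : X ⟶ Y) (p : CPoint (f ≫ s)) : (p.map f).pt = f p.pt := rfl

lemma le_preimage (p : CPoint s) {U : Y.Opens} (h : p.pt ∈ U) : ⊤ ≤ p.1 ⁻¹ᵁ U := by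
  intro x _
  have : x = IsLocalRing.closedPoint ℂ := Subsingleton.elim (α := PrimeSpectrum ℂ) _ _
  rw [this]
  exact h

/-- The value of a function at a complex point. -/
def eval (p : CPoint s) (U : Y.Opens) (h : p.pt ∈ U) : Sec s U →ₐ[ℂ] ℂ :=
  { (p.1.appLE U ⊤ (p.le_preimage h) ≫ (Scheme.ΓSpecIso (.of ℂ)).hom).hom with
    commutes' := fun r => by
      change ((Scheme.ΓSpecIso (.of ℂ)).inv ≫ (s.appLE ⊤ U (le_preimage_top s U) ≫
        p.1.appLE U ⊤ (p.le_preimage h)) ≫ (Scheme.ΓSpecIso (.of ℂ)).hom).hom r = r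
      rw [Scheme.Hom.appLE_comp_appLE]
      have : ∀ (f : Spec (.of ℂ) ⟶ Spec (.of ℂ)) (hf : f = 𝟙 _) (e : ⊤ ≤ f ⁻¹ᵁ ⊤),
          f.appLE ⊤ ⊤ e = 𝟙 _ := by
        rintro f rfl e
        exact (Category.id_comp _).trans ((Spec (.of ℂ)).presheaf.map_id _)
      rw [this _ p.2, Category.id_comp, Iso.inv_hom_id]
      rfl }

lemma eval_secRes (p : CPoint s) {U V : Y.Opens} (h : V ≤ U) (hp : p.pt ∈ V) :
    (p.eval V hp).comp (secRes s h) = p.eval U (h hp) := by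
  refine AlgHom.ext fun a => ?_
  change ((Y.presheaf.map (homOfLE h).op ≫ p.1.appLE V ⊤ (p.le_preimage hp)) ≫
    (Scheme.ΓSpecIso (.of ℂ)).hom).hom a = _
  rw [Scheme.Hom.map_appLE]
  rfl

lemma eval_secPull (f : X ⟶ Y) (p : CPoint (f ≫ s)) {U : Y.Opens} {V : X.Opens}
    (h : V ≤ f ⁻¹ᵁ U) (hp : p.pt ∈ V) (hp' : (p.map f).pt ∈ U) :
    (p.eval V hp).comp (secPull s f U V h) = (p.map f).eval U hp' := by
  refine AlgHom.ext fun a => ?_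
  change ((f.appLE U V h ≫ p.1.appLE V ⊤ (p.le_preimage hp)) ≫
    (Scheme.ΓSpecIso (.of ℂ)).hom).hom a = _
  rw [Scheme.Hom.appLE_comp_appLE]
  rfl

lemma eval_eq_zero (p : CPoint s) {U : Y.Opens} (h : p.pt ∈ U) (g : Γ(Y, U))
    (hg : p.pt ∉ Y.basicOpen g) : p.eval U h g = 0 := by
  by_contra hne
  have hu : IsUnit ((p.1.appLE U ⊤ (p.le_preimage h)).hom g) := by
    have : IsUnit ((Scheme.ΓSpecIso (.of ℂ)).hom.hom ((p.1.appLE U ⊤ (p.le_preimage h)).hom g)) :=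
      (isUnit_iff_ne_zero (G₀ := ℂ)).2 hne
    have h3 := this.map (Scheme.ΓSpecIso (.of ℂ)).inv.hom
    rwa [← CommRingCat.comp_apply, Iso.hom_inv_id] at h3
  apply hg
  have h1 := Scheme.basicOpen_of_isUnit _ hu
  have h2 : p.1 ⁻¹ᵁ (Y.basicOpen g) = ⊤ := by
    rw [eq_top_iff, ← h1]
    rw [Scheme.Hom.appLE, CommRingCat.hom_comp, RingHom.comp_apply, Scheme.basicOpen_res,
      ← Scheme.preimage_basicOpen]
    exact inf_le_right
  have : IsLocalRing.closedPoint ℂ ∈ p.1 ⁻¹ᵁ (Y.basicOpen g) := by rw [h2]; trivial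
  exact this

end CPoint

/-- The multiplicity of `x` in the fibre of `f : X ⟶ Y` through `x`: the length of
`𝒪_{X,x} / 𝔪_{f x} 𝒪_{X,x}`. For a finite morphism of smooth curves over `ℂ` and a closed point `x`
it is the number `e` with `f^* t = unit · u^e` for uniformizers `t` at `f x` and `u` at `x`; `x` is
a ramification point of index `e - 1` when `e > 1`. -/
def ramMult {X Y : Scheme.{0}} (f : X ⟶ Y) (x : X) : ℕ :=
  (Module.length (X.presheaf.stalk x) (X.presheaf.stalk x ⧸
    (IsLocalRing.maximalIdeal (Y.presheaf.stalk (f x))).map (f.stalkMap x).hom)).toNat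

section Fibre

variable {X Y : Scheme.{0}} (ρ : X ⟶ Y) (s : Y ⟶ Spec (.of ℂ))

open Classical in
/-- `D` is the sum of the points of the fibre of `ρ` over `y`, with their multiplicities. -/
def IsFibreDivisor (y : CPoint s) (D : Multiset (CPoint (ρ ≫ s))) : Prop :=
  ∀ p : CPoint (ρ ≫ s), D.count p = if p.map ρ = y then ramMult ρ p.pt else 0

/-- For an open `V ⊆ Y` with preimage `U ⊆ X`: the function `a` on `V` is the pullback of the
function `f` on `U⁽ⁿ⁾` under the map `V ⟶ U⁽ⁿ⁾ ⊆ X⁽ⁿ⁾` which sends a point `y` to the sum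
`x₁ + ⋯ + xₙ` of its preimages. -/
def IsPullbackFunction {n : ℕ} (V : Y.Opens) (a : Sec s V) (f : TS n (Sec (ρ ≫ s) (ρ ⁻¹ᵁ V))) : Prop :=
  ∀ (y : CPoint s) (hy : y.pt ∈ V) (x : Fin n → CPoint (ρ ≫ s)) (hx : ∀ i, (x i).pt ∈ ρ ⁻¹ᵁ V),
    IsFibreDivisor ρ s y (Multiset.ofList (List.ofFn x)) →
      y.eval V hy a = prodLift (fun i => (x i).eval _ (hx i)) (f : TPow n _)

variable {ρ s}

lemma IsFibreDivisor.map_eq {n : ℕ} {y : CPoint s} {x : Fin n → CPoint (ρ ≫ s)}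
    (h : IsFibreDivisor ρ s y (Multiset.ofList (List.ofFn x))) (i : Fin n) : (x i).map ρ = y := by
  classical
  by_contra hne
  have h1 := h (x i)
  rw [if_neg hne, Multiset.count_eq_zero] at h1
  exact h1 (by simp [List.mem_ofFn])

end Fibre

section Curve

variable {Xt X Y : Scheme.{0}} (κ : Xt ⟶ X) (ρ : X ⟶ Y) (s : Y ⟶ Spec (.of ℂ)) (n : ℕ)

/-- The coordinate ring of the part over `V` of the fibre product of `Y` and `X̃⁽ⁿ⁾` over
`X⁽ⁿ⁾`, for `V ⊆ Y` affine: with `U`, `Ũ` the preimages of `V` in `X` and `X̃`, it is the fibre product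
of `V` and `Ũ⁽ⁿ⁾ = Spec (TS n Γ(Ũ))` over `U⁽ⁿ⁾ = Spec (TS n Γ(U))`. -/
abbrev liftRing (V : Y.Opens) : Type :=
  FibreRing (n := n) (secPull (ρ ≫ s) κ (ρ ⁻¹ᵁ V) (κ ⁻¹ᵁ ρ ⁻¹ᵁ V) le_rfl) (IsPullbackFunction ρ s V)

lemma IsPullbackFunction.res {V V' : Y.Opens} (h : V' ≤ V) (a : Sec s V)
    (f : TS n (Sec (ρ ≫ s) (ρ ⁻¹ᵁ V))) (ha : IsPullbackFunction ρ s V a f) :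
    IsPullbackFunction ρ s V' (secRes s h a) (tsMap (secRes (ρ ≫ s) (ρ.preimage_mono h)) f) := by
  intro y hy x hx hD
  have := ha y (h hy) x (fun i => h (hx i)) hD
  rw [← CPoint.eval_secRes y h hy] at this
  rw [coe_tsMap, prodLift_tmap]
  simp only [CPoint.eval_secRes]
  exact this

/-- Restriction maps for `liftRing`. -/
def liftRes {V V' : Y.Opens} (h : V' ≤ V) : liftRing κ ρ s n V →ₐ[ℂ] liftRing κ ρ s n V' :=
  fibreMap (secRes s h) (secRes (ρ ≫ s) (ρ.preimage_mono h))
    (secRes (κ ≫ ρ ≫ s) (κ.preimage_mono (ρ.preimage_mono h)))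
    (secRes_secPull (ρ ≫ s) κ le_rfl le_rfl _ _)
    (fun a f => IsPullbackFunction.res ρ s n h a f)

/-- The functions on `V`, as functions on the fibre product. -/
abbrev liftLeft (V : Y.Opens) : Sec s V →ₐ[ℂ] liftRing κ ρ s n V := fibreLeft _ _

/-- The functions on `Ũ⁽ⁿ⁾`, as functions on the fibre product. -/
abbrev liftRight (V : Y.Opens) :
    TS n (Sec (κ ≫ ρ ≫ s) (κ ⁻¹ᵁ ρ ⁻¹ᵁ V)) →ₐ[ℂ] liftRing κ ρ s n V := fibreRight _ _

lemma liftRes_left {V V' : Y.Opens} (h : V' ≤ V) (a : Sec s V) :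
    liftRes κ ρ s n h (liftLeft κ ρ s n V a) = liftLeft κ ρ s n V' (secRes s h a) :=
  fibreMap_left _ _ _ _ _ a

lemma liftRes_right {V V' : Y.Opens} (h : V' ≤ V)
    (t : TS n (Sec (κ ≫ ρ ≫ s) (κ ⁻¹ᵁ ρ ⁻¹ᵁ V))) :
    liftRes κ ρ s n h (liftRight κ ρ s n V t) = liftRight κ ρ s n V'
      (tsMap (secRes (κ ≫ ρ ≫ s) (κ.preimage_mono (ρ.preimage_mono h))) t) :=
  fibreMap_right _ _ _ _ _ t

lemma tsMap_comp {B B' B'' : Type} [CommRing B] [Algebra ℂ B] [CommRing B'] [Algebra ℂ B']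
    [CommRing B''] [Algebra ℂ B''] (φ : B →ₐ[ℂ] B') (ψ : B' →ₐ[ℂ] B'') (t : TS n B) :
    tsMap (ψ.comp φ) t = tsMap ψ (tsMap φ t) := Subtype.ext (by simp [tmap_comp])

lemma tsMap_id {B : Type} [CommRing B] [Algebra ℂ B] (t : TS n B) :
    tsMap (AlgHom.id ℂ B) t = t := Subtype.ext (by simp [tmap_id])

lemma liftRes_self {V : Y.Opens} (h : V ≤ V) :
    (liftRes κ ρ s n h).toRingHom = RingHom.id _ := by
  refine fibreHom_ext (fun a => ?_) (fun t => ?_)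
  · refine (liftRes_left κ ρ s n _ a).trans ?_
    rw [secRes_self]; rfl
  · refine (liftRes_right κ ρ s n _ t).trans ?_
    rw [secRes_self, tsMap_id]; rfl

lemma liftRes_comp {V V' V'' : Y.Opens} (h : V' ≤ V) (h' : V'' ≤ V') :
    (liftRes κ ρ s n (h'.trans h)).toRingHom =
      (liftRes κ ρ s n h').toRingHom.comp (liftRes κ ρ s n h).toRingHom := by
  refine fibreHom_ext (fun a => ?_) (fun t => ?_)
  · refine (liftRes_left κ ρ s n _ a).trans ?_
    refine Eq.trans ?_ (congrArg (liftRes κ ρ s n h') (liftRes_left κ ρ s n h a)).symm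
    rw [liftRes_left, ← secRes_comp s h h']; rfl
  · refine (liftRes_right κ ρ s n _ t).trans ?_
    refine Eq.trans ?_ (congrArg (liftRes κ ρ s n h') (liftRes_right κ ρ s n h t)).symm
    rw [liftRes_right, ← tsMap_comp, secRes_comp]

/-- The presheaf `V ↦ liftRing V` on the affine open subsets of `Y`. -/
def liftDiagram : Y.AffineZariskiSiteᵒᵖ ⥤ CommRingCat where
  obj V := .of (liftRing κ ρ s n V.unop.1)
  map i := CommRingCat.ofHom
    (liftRes κ ρ s n (Scheme.AffineZariskiSite.toOpens_mono i.unop.le)).toRingHom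
  map_id V := CommRingCat.hom_ext (liftRes_self κ ρ s n _)
  map_comp i j := CommRingCat.hom_ext (liftRes_comp κ ρ s n
    (Scheme.AffineZariskiSite.toOpens_mono i.unop.le)
    (Scheme.AffineZariskiSite.toOpens_mono j.unop.le))

/-- The structure map from functions on `V` to `liftRing V`. -/
def liftDiagramMap :
    (Scheme.AffineZariskiSite.toOpensFunctor Y).op ⋙ Y.presheaf ⟶ liftDiagram κ ρ s n where
  app V := CommRingCat.ofHom (liftLeft κ ρ s n V.unop.1).toRingHom
  naturality _ _ i := by
    refine CommRingCat.hom_ext (RingHom.ext fun a => ?_)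
    exact (liftRes_left κ ρ s n (Scheme.AffineZariskiSite.toOpens_mono i.unop.le) a).symm

lemma isLocalization_secRes {V V' : Y.Opens} (hV : IsAffineOpen V) (g : Sec s V) (h : V' ≤ V)
    (hV' : V' = Y.basicOpen (U := V) g) :
    letI := (secRes s h).toRingHom.toAlgebra
    IsLocalization.Away (R := Sec s V) g (Sec s V') := by
  subst hV'
  exact hV.isLocalization_basicOpen g

lemma preimage_basicOpen_eq (f : X ⟶ Y) {V : Y.Opens} (g : Sec s V) :
    f ⁻¹ᵁ Y.basicOpen (U := V) g =
      X.basicOpen (U := f ⁻¹ᵁ V) (secPull s f V (f ⁻¹ᵁ V) le_rfl g) := by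
  refine (Scheme.preimage_basicOpen f (U := V) g).trans ?_
  rw [Scheme.Hom.app_eq_appLE]
  rfl

lemma isLocalization_liftRes [NeZero n] [IsAffineHom κ] [IsAffineHom ρ] {V V' : Y.Opens}
    (hV : IsAffineOpen V) (g : Sec s V) (hle : V' ≤ V) (hV' : V' = Y.basicOpen (U := V) g) :
    letI := (liftRes κ ρ s n hle).toRingHom.toAlgebra
    IsLocalization.Away (liftLeft κ ρ s n V g) (liftRing κ ρ s n V') := by
  let b : Sec (ρ ≫ s) (ρ ⁻¹ᵁ V) := secPull s ρ V (ρ ⁻¹ᵁ V) le_rfl g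
  have hbV : ρ ⁻¹ᵁ V' = X.basicOpen (U := ρ ⁻¹ᵁ V) b := by
    rw [hV', preimage_basicOpen_eq s]
  have hcV : κ ⁻¹ᵁ ρ ⁻¹ᵁ V' = Xt.basicOpen (U := κ ⁻¹ᵁ ρ ⁻¹ᵁ V)
      (secPull (ρ ≫ s) κ (ρ ⁻¹ᵁ V) (κ ⁻¹ᵁ ρ ⁻¹ᵁ V) le_rfl b) := by
    rw [hbV, preimage_basicOpen_eq (ρ ≫ s)]
  have hA := isLocalization_secRes s hV g hle hV'
  have hB := isLocalization_secRes (ρ ≫ s) (hV.preimage ρ) b (ρ.preimage_mono hle) hbV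
  have hC := isLocalization_secRes (κ ≫ ρ ≫ s) ((hV.preimage ρ).preimage κ) _
    (κ.preimage_mono (ρ.preimage_mono hle)) hcV
  have hdiag : ∀ (y : CPoint s) (hy : y.pt ∈ V) (x : Fin n → CPoint (ρ ≫ s))
      (hx : ∀ i, (x i).pt ∈ ρ ⁻¹ᵁ V), IsFibreDivisor ρ s y (Multiset.ofList (List.ofFn x)) →
      prodLift (fun i => (x i).eval _ (hx i)) (diagTensor n b : TPow n _) =
        y.eval V hy g ^ n := by
    intro y hy x hx hD
    rw [diagTensor, prodLift_tprod]
    have : ∀ i, (x i).eval _ (hx i) b = y.eval V hy g := by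
      intro i
      have hi := hD.map_eq i
      subst hi
      exact DFunLike.congr_fun (CPoint.eval_secPull ρ (x i) le_rfl (hx i) hy) g
    simp [this]
  refine isLocalization_fibreMap (secRes s hle) (secRes (ρ ≫ s) (ρ.preimage_mono hle))
    (secRes (κ ≫ ρ ≫ s) (κ.preimage_mono (ρ.preimage_mono hle))) _ _ g b hA hC ?_ ?_
  · intro y hy x hx hD
    rw [hdiag y hy x hx hD, map_pow]
  · intro a' f' h'
    let := (secRes s hle).toRingHom.toAlgebra
    let := (tsMap (n := n) (secRes (ρ ≫ s) (ρ.preimage_mono hle))).toRingHom.toAlgebra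
    have hT := isLocalization_tsMap (n := n) b _ hB
    obtain ⟨N₁, a₁, ha₁⟩ := IsLocalization.Away.surj (R := Sec s V) g a'
    obtain ⟨N₂, f₁, hf₁⟩ := IsLocalization.Away.surj (diagTensor n b) f'
    replace ha₁ : a' * secRes s hle g ^ N₁ = secRes s hle a₁ := ha₁
    replace hf₁ : f' * tsMap (secRes (ρ ≫ s) (ρ.preimage_mono hle)) (diagTensor n b) ^ N₂ =
      tsMap (secRes (ρ ≫ s) (ρ.preimage_mono hle)) f₁ := hf₁
    have hN : N₁ ≤ n * (N₁ + N₂) :=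
      (Nat.le_add_right N₁ N₂).trans (Nat.le_mul_of_pos_left _ (NeZero.pos n))
    have ea : secRes s hle (g ^ n * (g ^ (n * (N₁ + N₂) - N₁) * a₁)) =
        secRes s hle g ^ (n * (N₁ + N₂ + 1)) * a' := by
      rw [map_mul, map_mul, map_pow, map_pow, ← ha₁, mul_comm a', ← mul_assoc, ← mul_assoc,
        ← pow_add, ← pow_add]
      congr 2
      rw [mul_add n (N₁ + N₂) 1]
      omega
    have ef : tsMap (secRes (ρ ≫ s) (ρ.preimage_mono hle))
        (diagTensor n b * (diagTensor n b ^ N₁ * f₁)) =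
        diagTensor n (secRes (ρ ≫ s) (ρ.preimage_mono hle) b) ^ (N₁ + N₂ + 1) * f' := by
      rw [map_mul, map_mul, map_pow, ← hf₁, tsMap_diagTensor]
      ring
    refine ⟨N₁ + N₂ + 1, _, _, ?_, ea, ef⟩
    intro y hy x hx hD
    by_cases hyg : y.pt ∈ V'
    · have hx' : ∀ i, (x i).pt ∈ ρ ⁻¹ᵁ V' := by
        intro i
        have hi := hD.map_eq i
        subst hi
        exact hyg
      have e1 := h' y hyg x hx' hD
      have e2 := hdiag y hy x hx hD
      rw [← CPoint.eval_secRes y hle hyg, AlgHom.comp_apply, ea, map_mul, e1]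
      have e3 : prodLift (fun i => (x i).eval _ (hx i))
          ((diagTensor n b * (diagTensor n b ^ N₁ * f₁) : TS n _) : TPow n _) =
          prodLift (fun i => (x i).eval _ (hx' i))
          ((tsMap (secRes (ρ ≫ s) (ρ.preimage_mono hle))
            (diagTensor n b * (diagTensor n b ^ N₁ * f₁)) : TS n _) : TPow n _) := by
        rw [coe_tsMap, prodLift_tmap]
        simp only [CPoint.eval_secRes]
      have e4 : prodLift (fun i => (x i).eval _ (hx' i))
          ((diagTensor n (secRes (ρ ≫ s) (ρ.preimage_mono hle) b) : TS n _) : TPow n _) =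
          y.eval V hy g ^ n := by
        rw [← e2, ← tsMap_diagTensor, coe_tsMap, prodLift_tmap]
        simp only [CPoint.eval_secRes]
      rw [e3, ef, MulMemClass.coe_mul, SubmonoidClass.coe_pow, map_mul, map_pow, map_pow, e4,
        ← pow_mul, ← AlgHom.comp_apply, CPoint.eval_secRes]
    · have e0 : y.eval V hy g = 0 := y.eval_eq_zero hy g (by rwa [← hV'])
      have e1 := hdiag y hy x hx hD
      rw [e0, zero_pow (NeZero.ne n)] at e1
      rw [map_mul, map_pow, e0, zero_pow (NeZero.ne n), zero_mul]
      refine ((map_mul (prodLift fun i => (x i).eval _ (hx i)) _ _).trans ?_).symm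
      rw [e1, zero_mul]

variable [NeZero n] [IsAffineHom κ] [IsAffineHom ρ]

lemma coequifibered_liftDiagramMap : (liftDiagramMap κ ρ s n).Coequifibered := by
  refine Scheme.AffineZariskiSite.coequifibered_iff_forall_isLocalizationAway.2 fun V g => ?_
  exact isLocalization_liftRes κ ρ s n V.2 g (Y.basicOpen_le g) rfl

/-- The curve `C̃`: the fibre product of `Y` and `X̃⁽ⁿ⁾` over `X⁽ⁿ⁾`, obtained by glueing the spectra
of the rings `liftRing V` for `V ⊆ Y` affine open. -/
def liftCurve : Scheme.{0} :=
  (Scheme.AffineZariskiSite.relativeGluingData (coequifibered_liftDiagramMap κ ρ s n)).glued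

/-- The inclusion of the part of `C̃` over the affine open subset `V` of `Y`. -/
def liftCurveChart (V : Y.AffineZariskiSite) :
    Spec (.of (liftRing κ ρ s n V.1)) ⟶ liftCurve κ ρ s n :=
  (Scheme.AffineZariskiSite.relativeGluingData
    (coequifibered_liftDiagramMap κ ρ s n)).cover.f V

/-- `c` is the point `(y, D)` of `C̃ ⊆ Y × X̃⁽ⁿ⁾`, for an effective divisor `D = x₁ + ⋯ + xₙ` on `X̃`:
over some affine open neighbourhood `V` of `y`, a function `a` on `V` has the value `a(y)` at `c`,
and a function `t` on `Ũ⁽ⁿ⁾` has the value `t(x₁, …, xₙ)` at `c`. -/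
def IsPointOf (c : liftCurve κ ρ s n) (y : CPoint s) (D : Multiset (CPoint (κ ≫ ρ ≫ s))) : Prop :=
  ∃ (V : Y.AffineZariskiSite) (hy : y.pt ∈ V.1) (x : Fin n → CPoint (κ ≫ ρ ≫ s))
    (hx : ∀ i, (x i).pt ∈ κ ⁻¹ᵁ ρ ⁻¹ᵁ V.1) (χ : liftRing κ ρ s n V.1 →ₐ[ℂ] ℂ),
    D = Multiset.ofList (List.ofFn x) ∧
    (∀ a, χ (liftLeft κ ρ s n V.1 a) = y.eval V.1 hy a) ∧
    (∀ t, χ (liftRight κ ρ s n V.1 t) = prodLift (fun i => (x i).eval _ (hx i)) (t : TPow n _)) ∧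
    c = liftCurveChart κ ρ s n V (Spec.map (CommRingCat.ofHom χ.toRingHom)
      (IsLocalRing.closedPoint ℂ))

end Curve

/-- A scheme over `ℂ` is a smooth projective curve if it is smooth of relative dimension one, proper
(for smooth curves this is the same as projective) and connected. -/
structure IsSmoothProjectiveCurve {Y : Scheme.{0}} (s : Y ⟶ Spec (.of ℂ)) : Prop where
  smooth : SmoothOfRelativeDimension 1 s
  proper : IsProper s
  connected : ConnectedSpace Y

/-- The fibre of `ρ` over `y` contains at most one ramification point, and its index is one. -/
def IsSimplyRamifiedOver {X Y : Scheme.{0}} (ρ : X ⟶ Y) (s : Y ⟶ Spec (.of ℂ)) (y : CPoint s) :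
    Prop :=
  (∀ p : CPoint (ρ ≫ s), p.map ρ = y → ramMult ρ p.pt = 1 ∨ ramMult ρ p.pt = 2) ∧
  ∀ p q : CPoint (ρ ≫ s), p.map ρ = y → q.map ρ = y →
    ramMult ρ p.pt ≠ 1 → ramMult ρ q.pt ≠ 1 → p = q

/-- The fibre of `ρ` over `y` contains exactly two ramification points, `p₁` and `p₂`, and both have
index one. -/
structure HasTwoRamificationPoints {X Y : Scheme.{0}} (ρ : X ⟶ Y) (s : Y ⟶ Spec (.of ℂ))
    (y : CPoint s) (p₁ p₂ : CPoint (ρ ≫ s)) : Prop where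
  ne : p₁ ≠ p₂
  map_left : p₁.map ρ = y
  map_right : p₂.map ρ = y
  ramMult_left : ramMult ρ p₁.pt = 2
  ramMult_right : ramMult ρ p₂.pt = 2
  ramMult_other : ∀ p : CPoint (ρ ≫ s), p.map ρ = y → p ≠ p₁ → p ≠ p₂ → ramMult ρ p.pt = 1

/-- `D = x₁ + x₁' + x₂ + x₂' + E`, where `{x₁, x₁'} = κ⁻¹(p₁)`, `{x₂, x₂'} = κ⁻¹(p₂)` and
`E = x₃ + ⋯ + xₙ₋₂` consists of one point of `X̃` above each of the other points of `ρ⁻¹(y)`. -/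
def IsDoubleLift {Xt X Y : Scheme.{0}} (κ : Xt ⟶ X) (ρ : X ⟶ Y) (s : Y ⟶ Spec (.of ℂ))
    (y : CPoint s) (p₁ p₂ : CPoint (ρ ≫ s)) (D : Multiset (CPoint (κ ≫ ρ ≫ s))) : Prop :=
  ∃ (x₁ x₁' x₂ x₂' : CPoint (κ ≫ ρ ≫ s)) (E : Multiset (CPoint (κ ≫ ρ ≫ s))),
    x₁ ≠ x₁' ∧ {q : CPoint (κ ≫ ρ ≫ s) | q.map κ = p₁} = {x₁, x₁'} ∧
    x₂ ≠ x₂' ∧ {q : CPoint (κ ≫ ρ ≫ s) | q.map κ = p₂} = {x₂, x₂'} ∧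
    (E.map (CPoint.map κ)).Nodup ∧
    (∀ p, p ∈ E.map (CPoint.map κ) ↔ p.map ρ = y ∧ p ≠ p₁ ∧ p ≠ p₂) ∧
    D = {x₁, x₁', x₂, x₂'} + E

/-- The set of singular points of a scheme: the points whose local ring is not regular. -/
def singularPoints (C : Scheme.{0}) : Set C := {c | ¬ IsRegularLocalRing (C.presheaf.stalk c)}

end CurveLift

end

/-!
Over an affine open `V = Spec A` of `Y` on which `X` is free with ring `B`, and with `C` the ring
of the part of `X̃` over `V`, the curve `C̃` is the spectrum of the quotient `R` of `A ⊗ TS n C`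
which identifies a function on the symmetric power of `Spec B` with its pullback along the fibres
of `ρ`. In characteristic zero power sums generate the symmetric tensors, and the power sum of `b`
pulls back to the trace of `b` over `A`. So a complex point of `R` is a point `y` together with a
divisor `D = x₁ + ⋯ + xₙ` such that the values of each `b` at the points `κ xᵢ` add up to the value
of its trace at `y`; by independence of characters this means that `κ` maps `D` to the fibre
divisor of `y`.

Say that `D` splits at `p` if it contains both points over `p`; then `p` has multiplicity at least
two in the fibre.

* If `D` splits nowhere, `κ` is an isomorphism near the points of `D`, hence every power sum of
  functions on `X̃` is to first order a trace, and the cotangent space at `(y, D)` is generated by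
  a parameter of `Y` at `y` (`ker_le_of_injOn`).
* If `D` splits at exactly one point `p`, of multiplicity two, the same argument leaves one
  function, which moves one of the two points over `p`. The parameter `t` of `Y` vanishes to second
  order at `p`, and multiplying it by the trace of a bump function at `p` shows that it has no
  differential on `C̃`. Again one function generates the cotangent space
  (`exists_ker_le_span_of_pair`).
* If `D` splits at two points, then moving the two points over either of them in opposite
  directions keeps traces constant to first order, and this gives two independent tangent vectors
  (`not_isRegularLocalRing_of_two_pairs`), whereas the local ring has dimension at most one, as the
  fibres of `C̃` over `Y` are finite (`height_ker_le_one`).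

In the first two cases the local ring has principal maximal ideal, and it is a discrete valuation
ring as soon as the parameter `t` is not nilpotent in it. This holds because `(y, D)` lies on a
branch which dominates `Y` (`mul_pow_ne_zero`): over the integral closure of the local ring of `Y`
at `y` in an algebraic closure of the function field, the fibre of `ρ` becomes a sum of sections,
and going down for the flat covering `κ` lifts these sections to sections of `X̃` through the
points of `D`. A point of `C̃` which is not closed specializes to infinitely many closed points,
hence to a regular one not over `y`, and is therefore regular.

By the hypotheses on ramification, a divisor which splits at two points lies over the special point
`y` and splits exactly at `p₁` and `p₂`. It is determined by the choice of one of two points over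
each of the other `n - 4` points of the fibre (`ncard_setOf_isDoubleLift`), and distinct divisors
give distinct points of `C̃`, by independence of characters once more.
-/

/-! ### Symmetric tensors and power sums -/

namespace SymTensor

variable {n : ℕ} {B C : Type} [CommRing B] [Algebra ℂ B] [CommRing C] [Algebra ℂ C]

/-- The `i`-th coordinate inclusion `b ↦ 1 ⊗ ⋯ ⊗ b ⊗ ⋯ ⊗ 1`. -/
noncomputable def single (i : Fin n) : B →ₐ[ℂ] TPow n B :=
  PiTensorProduct.singleAlgHom (R := ℂ) (A := fun _ : Fin n => B) i

@[simp] lemma perm_single (σ : Equiv.Perm (Fin n)) (i : Fin n) (b : B) :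
    perm σ (single i b) = single (σ.symm i) b := by
  rw [single, PiTensorProduct.singleAlgHom_apply, perm_tprod, single,
    PiTensorProduct.singleAlgHom_apply]
  congr 1
  ext j
  by_cases h : j = σ.symm i
  · subst h; simp
  · have : σ j ≠ i := fun h' => h (by simp [← h'])
    simp [h, this]

@[simp] lemma tmap_single (φ : B →ₐ[ℂ] C) (i : Fin n) (b : B) :
    tmap φ (single i b) = single i (φ b) := by
  rw [single, PiTensorProduct.singleAlgHom_apply, tmap_tprod, single,
    PiTensorProduct.singleAlgHom_apply]
  congr 1
  ext j
  by_cases h : j = i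
  · subst h; simp
  · simp [h]

@[simp] lemma prodLift_single {S : Type} [CommRing S] [Algebra ℂ S] (φ : Fin n → (B →ₐ[ℂ] S))
    (i : Fin n) (b : B) : prodLift φ (single i b) = φ i b := by
  rw [single, PiTensorProduct.singleAlgHom_apply, prodLift_tprod, Finset.prod_eq_single i]
  · simp
  · intro j _ hj; simp [hj]
  · simp

lemma tprod_eq_prod_single (b : Fin n → B) :
    PiTensorProduct.tprod ℂ b = ∏ i, single i (b i) := (prod_single b 1).symm

/-- The elements `single i b` generate the tensor power as an algebra. -/
lemma adjoin_single :
    Algebra.adjoin ℂ (⋃ i : Fin n, Set.range (single i : B →ₐ[ℂ] TPow n B)) = ⊤ := by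
  rw [eq_top_iff]
  rintro t -
  induction t using PiTensorProduct.induction_on with
  | smul_tprod r b =>
    rw [tprod_eq_prod_single]
    refine Subalgebra.smul_mem _ (Subalgebra.prod_mem _ fun i _ => Algebra.subset_adjoin ?_) r
    exact Set.mem_iUnion.2 ⟨i, Set.mem_range_self (b i)⟩
  | add x y hx hy => exact Subalgebra.add_mem _ hx hy

/-- The symmetrization `t ↦ ∑ σ, σ t`, linear over the symmetric tensors. -/
noncomputable def symmetrize : TPow n B →ₗ[TS n B] TS n B where
  toFun t := ⟨∑ σ, perm σ t, mem_TS.2 fun τ => by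
    rw [map_sum]
    have : ∀ σ, perm τ (perm σ t) = perm (σ * τ) t := by
      intro σ
      have : (perm τ).comp (perm (B := B) σ) = perm (σ * τ) :=
        algHom_ext_tprod fun b => by simp
      exact DFunLike.congr_fun this t
    simp only [this]
    exact Fintype.sum_equiv (Equiv.mulRight τ) _ _ fun σ => rfl⟩
  map_add' x y := Subtype.ext (by simp [Finset.sum_add_distrib])
  map_smul' r x := Subtype.ext (by
    simp only [Algebra.smul_def, RingHom.id_apply, MulMemClass.coe_mul, Finset.mul_sum]
    refine Finset.sum_congr rfl fun σ _ => ?_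
    change perm σ ((r : TPow n B) * x) = (r : TPow n B) * perm σ x
    rw [map_mul, mem_TS.1 r.2])

lemma coe_symmetrize (t : TPow n B) : (symmetrize t : TPow n B) = ∑ σ, perm σ t := rfl

lemma symmetrize_coe (t : TS n B) : symmetrize (t : TPow n B) = (n.factorial : ℂ) • t := by
  apply Subtype.ext
  rw [coe_symmetrize]
  simp [mem_TS.1 t.2, Fintype.card_perm, Nat.cast_smul_eq_nsmul]

lemma eq_smul_symmetrize (t : TS n B) :
    t = (n.factorial : ℂ)⁻¹ • symmetrize (t : TPow n B) := by
  rw [symmetrize_coe, smul_smul, inv_mul_cancel₀ (Nat.cast_ne_zero.2 n.factorial_ne_zero), one_smul]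

/-- Averaging over permutations: extending an ideal of symmetric tensors to the tensor power adds
no new symmetric tensors. -/
lemma mem_of_mem_map (I : Ideal (TS n B)) {f : TS n B}
    (hf : (f : TPow n B) ∈ I.map (algebraMap (TS n B) (TPow n B))) : f ∈ I := by
  have key : ∀ t ∈ I.map (algebraMap (TS n B) (TPow n B)), ∀ a, symmetrize (a * t) ∈ I := by
    intro t ht
    rw [Ideal.map, ← Ideal.submodule_span_eq] at ht
    induction ht using Submodule.span_induction with
    | mem x h =>
      obtain ⟨y, hy, rfl⟩ := h
      intro a
      have : a * algebraMap (TS n B) (TPow n B) y = y • a := by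
        rw [Algebra.smul_def, mul_comm]
      rw [this, map_smul]
      exact I.mul_mem_right _ hy
    | zero => simp
    | add x y _ _ hx hy => intro a; rw [mul_add, map_add]; exact I.add_mem (hx a) (hy a)
    | smul b x _ hx => intro a; rw [smul_eq_mul, ← mul_assoc]; exact hx _
  rw [eq_smul_symmetrize f]
  exact Submodule.smul_of_tower_mem I _ (by simpa using key _ hf 1)

/-- The power sum `∑ i, 1 ⊗ ⋯ ⊗ b ⊗ ⋯ ⊗ 1` of an element `b`. -/
noncomputable def psum (n : ℕ) (b : B) : TS n B :=
  ⟨∑ i, single i b, mem_TS.2 fun σ => by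
    rw [map_sum]
    simp only [perm_single]
    exact Fintype.sum_equiv σ.symm _ _ fun i => rfl⟩

@[simp] lemma coe_psum (b : B) : (psum n b : TPow n B) = ∑ i, single i b := rfl

lemma prodLift_psum {S : Type} [CommRing S] [Algebra ℂ S] (φ : Fin n → (B →ₐ[ℂ] S)) (b : B) :
    prodLift φ (psum n b : TPow n B) = ∑ i, φ i b := by simp

lemma tsMap_psum (φ : B →ₐ[ℂ] C) (b : B) : tsMap φ (psum n b) = psum n (φ b) :=
  Subtype.ext (by simp)

lemma psum_add (b c : B) : psum n (b + c) = psum n b + psum n c :=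
  Subtype.ext (by simp [Finset.sum_add_distrib])

lemma psum_sub (b c : B) : psum n (b - c) = psum n b - psum n c :=
  Subtype.ext (by simp [Finset.sum_sub_distrib])

lemma psum_smul (r : ℂ) (b : B) : psum n (r • b) = r • psum n b :=
  Subtype.ext (by
    change ∑ i, single i (r • b) = r • ∑ i, single i b
    simp [Finset.smul_sum])

/-- The sum of `∏ j, b_j` placed in the positions `f j`, over all injections `f` of `Fin k` into
the set of positions: for `k = n` it is the symmetrization of `b₁ ⊗ ⋯ ⊗ bₙ`. -/
noncomputable def injSum {k : ℕ} (b : Fin k → B) : TPow n B :=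
  ∑ f : Fin k ↪ Fin n, ∏ j, single (f j) (b j)

/-- A recursion which expresses `injSum` through power sums: multiplying by the power sum of `b₀`
puts `b₀` into an arbitrary position, which is either new or already occupied by some `b j`. -/
lemma injSum_succ {k : ℕ} (b₀ : B) (b : Fin k → B) :
    (injSum (Fin.cons b₀ b : Fin (k + 1) → B) : TPow n B) =
      (∑ i, single i b₀) * injSum b - ∑ j, injSum (Function.update b j (b₀ * b j)) := by
  classical
  have h1 : (injSum (Fin.cons b₀ b : Fin (k + 1) → B) : TPow n B) =
      ∑ f : Fin k ↪ Fin n, ∑ i ∈ (Finset.univ.map f)ᶜ, single i b₀ * ∏ j, single (f j) (b j) := by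
    rw [injSum]
    rw [Finset.sum_sigma']
    refine Finset.sum_bij' (fun f _ => ⟨(Fin.succEmb k).trans f, f 0⟩)
      (fun p hp => ⟨Fin.cons p.2 p.1, by
        rw [Fin.cons_injective_iff]
        refine ⟨?_, p.1.injective⟩
        have := (Finset.mem_sigma.1 hp).2
        rintro ⟨j, hj⟩
        simp [← hj] at this⟩) ?_ ?_ ?_ ?_ ?_
    · intro f _
      simp [Fin.succ_ne_zero]
    · intro p hp; simp
    · intro f _
      ext j
      refine Fin.cases ?_ (fun j => ?_) j <;> simp
    · rintro ⟨f, i⟩ hp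
      simp
      rfl
    · intro f _
      rw [Fin.prod_univ_succ]
      simp
  have h2 : ∀ f : Fin k ↪ Fin n, ∀ j, single (f j) b₀ * ∏ j, single (f j) (b j) =
      ∏ l, single (f l) (Function.update b j (b₀ * b j) l) := by
    intro f j
    rw [← Finset.mul_prod_erase _ _ (Finset.mem_univ j), ← Finset.mul_prod_erase _
      (fun l => single (f l) (Function.update b j (b₀ * b j) l)) (Finset.mem_univ j)]
    rw [Function.update_self, map_mul, mul_assoc]
    congr 2
    refine Finset.prod_congr rfl fun l hl => ?_
    rw [Function.update_of_ne (Finset.ne_of_mem_erase hl)]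
  rw [h1]
  simp only [injSum]
  rw [Finset.sum_comm, Finset.mul_sum, ← Finset.sum_sub_distrib]
  refine Finset.sum_congr rfl fun f _ => ?_
  rw [eq_sub_iff_add_eq, ← Finset.sum_congr rfl fun j _ => h2 f j, ← Finset.sum_mul,
    ← Finset.sum_mul, ← add_mul]
  congr 1
  rw [← Finset.sum_compl_add_sum (Finset.univ.map f), Finset.sum_map]

/-- The power sums generate the algebra of symmetric tensors. -/
lemma adjoin_psum : Algebra.adjoin ℂ (Set.range (psum (B := B) n)) = ⊤ := by
  have key : ∀ (k : ℕ) (b : Fin k → B), ∃ t ∈ Algebra.adjoin ℂ (Set.range (psum (B := B) n)),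
      (t : TPow n B) = injSum b := by
    intro k
    induction k with
    | zero =>
      intro b
      refine ⟨1, Subalgebra.one_mem _, ?_⟩
      simp [injSum]
    | succ k ih =>
      intro b
      obtain ⟨t, ht, et⟩ := ih (Fin.tail b)
      choose s hs es using fun j => ih (Function.update (Fin.tail b) j (b 0 * Fin.tail b j))
      refine ⟨psum n (b 0) * t - ∑ j, s j, Subalgebra.sub_mem _ (Subalgebra.mul_mem _
        (Algebra.subset_adjoin ⟨_, rfl⟩) ht) (Subalgebra.sum_mem _ fun j _ => hs j), ?_⟩
      conv_rhs => rw [← Fin.cons_self_tail b]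
      rw [injSum_succ]
      simp [et, es]
  have key2 : ∀ t : TPow n B, symmetrize t ∈ Algebra.adjoin ℂ (Set.range (psum (B := B) n)) := by
    intro t
    induction t using PiTensorProduct.induction_on with
    | smul_tprod r b =>
      have : symmetrize (r • PiTensorProduct.tprod ℂ b) =
          r • symmetrize (PiTensorProduct.tprod ℂ b) := Subtype.ext (by
            change _ = r • (symmetrize (PiTensorProduct.tprod ℂ b) : TPow n B)
            simp [coe_symmetrize, Finset.smul_sum])
      rw [this]
      refine Subalgebra.smul_mem _ ?_ r
      obtain ⟨t, ht, et⟩ := key n b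
      convert ht
      apply Subtype.ext
      rw [et, coe_symmetrize, injSum]
      refine Fintype.sum_equiv ((Equiv.inv _).trans (Equiv.embeddingEquivOfFinite (Fin n)).symm)
        _ _ fun σ => ?_
      rw [tprod_eq_prod_single, map_prod]
      refine Finset.prod_congr rfl fun i _ => ?_
      rw [perm_single]
      rfl
    | add x y hx hy => rw [map_add]; exact Subalgebra.add_mem _ hx hy
  rw [eq_top_iff]
  rintro t -
  rw [eq_smul_symmetrize t]
  exact Subalgebra.smul_mem _ (key2 _) _

/-- The coefficients of `∏ l, (X - b^{(l)})` are symmetric. -/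
lemma exists_coeff_prod_X_sub (b : B) (k : ℕ) : ∃ t : TS n B,
    (t : TPow n B) = (∏ l : Fin n, (Polynomial.X - Polynomial.C (single l b))).coeff k := by
  refine ⟨⟨_, mem_TS.2 fun σ => ?_⟩, rfl⟩
  have := Polynomial.coeff_map (p := ∏ l : Fin n, (Polynomial.X - Polynomial.C (single l b)))
    (perm σ : TPow n B →ₐ[ℂ] TPow n B).toRingHom k
  refine this.symm.trans ?_
  congr 1
  rw [Polynomial.map_prod]
  refine Fintype.prod_equiv σ.symm _ _ fun i => ?_
  simp only [Polynomial.map_sub, Polynomial.map_X, Polynomial.map_C]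
  congr 2
  exact perm_single σ i b

/-- The Cayley–Hamilton identity: `b^{(i)}` is a root of `∏ l, (X - b^{(l)})`. -/
lemma eval_prod_X_sub (b : B) (i : Fin n) :
    (∏ l : Fin n, (Polynomial.X - Polynomial.C (single l b))).eval (single i b) = 0 := by
  rw [Polynomial.eval_prod]
  exact Finset.prod_eq_zero (Finset.mem_univ i) (by simp)

lemma isIntegral_single (i : Fin n) (b : B) : IsIntegral (TS n B) (single i b) := by
  rcases subsingleton_or_nontrivial (TPow n B) with h | h
  · exact ⟨1, Polynomial.monic_one, Subsingleton.elim _ _⟩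
  choose t ht using exists_coeff_prod_X_sub (n := n) b
  have hm : (∏ l : Fin n, (Polynomial.X - Polynomial.C (single l b))).Monic :=
    Polynomial.monic_prod_of_monic _ _ fun l _ => Polynomial.monic_X_sub_C _
  have hl : (∏ l : Fin n, (Polynomial.X - Polynomial.C (single l b))) ∈
      Polynomial.lifts (algebraMap (TS n B) (TPow n B)) := by
    rw [Polynomial.lifts_iff_coeff_lifts]
    exact fun k => ⟨t k, ht k⟩
  obtain ⟨q, hq, -, hqm⟩ := Polynomial.lifts_and_degree_eq_and_monic hl hm
  exact ⟨q, hqm, by rw [← Polynomial.eval_map, hq, eval_prod_X_sub]⟩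

instance : Algebra.IsIntegral (TS n B) (TPow n B) := by
  refine ⟨fun t => ?_⟩
  have h : (⊤ : Subalgebra ℂ (TPow n B)) ≤
      (integralClosure (TS n B) (TPow n B)).restrictScalars ℂ := by
    rw [← adjoin_single, Algebra.adjoin_le_iff]
    rintro _ ⟨_, ⟨i, rfl⟩, b, rfl⟩
    exact isIntegral_single i b
  exact (Subalgebra.mem_restrictScalars ℂ).1 (h (Algebra.mem_top (x := t)))

/-- The points of the tensor power are the `n`-tuples of points. -/
lemma tpow_algHom_ext {S : Type} [CommRing S] [Algebra ℂ S] (f : TPow n B →ₐ[ℂ] S) :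
    f = prodLift fun i => f.comp (single i) :=
  AlgHom.ext_of_adjoin_eq_top adjoin_single (by
    rintro _ ⟨_, ⟨i, rfl⟩, b, rfl⟩
    exact (prodLift_single (fun i => f.comp (single i)) i b).symm)

/-- A `ℂ`-valued point of an integral extension lifts. -/
lemma exists_algHom_extend {R S : Type*} [CommRing R] [CommRing S] [Algebra ℂ R] [Algebra ℂ S]
    [Algebra R S] [IsScalarTower ℂ R S] [Algebra.IsIntegral R S] (χ : R →ₐ[ℂ] ℂ)
    (h : RingHom.ker (algebraMap R S) ≤ RingHom.ker χ) :
    ∃ ψ : S →ₐ[ℂ] ℂ, ∀ r, ψ (algebraMap R S r) = χ r := by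
  have hs : Function.Surjective χ := fun z => ⟨algebraMap ℂ R z, by simp⟩
  have : (RingHom.ker χ).IsMaximal := RingHom.ker_isMaximal_of_surjective χ hs
  obtain ⟨Q, hQ, hc⟩ := Ideal.exists_ideal_over_maximal_of_isIntegral (S := S) (RingHom.ker χ) h
  have : Algebra.IsIntegral ℂ (S ⧸ Q) := by
    refine ⟨fun z => ?_⟩
    obtain ⟨z, rfl⟩ := Ideal.Quotient.mk_surjective z
    obtain ⟨p, hp, hz⟩ := Algebra.IsIntegral.isIntegral (R := R) z
    refine ⟨p.map (χ : R →+* ℂ), hp.map _, ?_⟩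
    have e : (algebraMap ℂ (S ⧸ Q)).comp (χ : R →+* ℂ) =
        (Ideal.Quotient.mk Q).comp (algebraMap R S) := by
      ext r
      simp only [RingHom.comp_apply, RingHom.coe_coe]
      rw [IsScalarTower.algebraMap_apply ℂ S, Ideal.Quotient.algebraMap_eq, Ideal.Quotient.eq,
        IsScalarTower.algebraMap_apply ℂ R S, ← map_sub, ← Ideal.mem_comap, hc]
      simp [RingHom.mem_ker]
    rw [Polynomial.eval₂_map, e, ← Polynomial.hom_eval₂, hz, map_zero]
  have hb : Function.Bijective (Algebra.ofId ℂ (S ⧸ Q)) := by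
    exact IsAlgClosed.algebraMap_bijective_of_isIntegral
  let e := AlgEquiv.ofBijective _ hb
  refine ⟨(e.symm : (S ⧸ Q) →ₐ[ℂ] ℂ).comp (Ideal.Quotient.mkₐ ℂ Q), fun r => ?_⟩
  rw [AlgHom.comp_apply]
  change e.symm _ = _
  rw [AlgEquiv.symm_apply_eq]
  change Ideal.Quotient.mk Q _ = algebraMap ℂ _ _
  rw [IsScalarTower.algebraMap_apply ℂ S, Ideal.Quotient.algebraMap_eq, Ideal.Quotient.eq,
    IsScalarTower.algebraMap_apply ℂ R S, ← map_sub, ← Ideal.mem_comap, hc]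
  simp [RingHom.mem_ker]

/-- The complex points of the symmetric power are unordered `n`-tuples of points. -/
lemma exists_eq_prodLift (χ : TS n C →ₐ[ℂ] ℂ) :
    ∃ x : Fin n → (C →ₐ[ℂ] ℂ), ∀ t : TS n C, χ t = prodLift x (t : TPow n C) := by
  obtain ⟨ψ, hψ⟩ := exists_algHom_extend (S := TPow n C) χ (by
    intro t ht
    have : t = 0 := Subtype.ext ht
    simp [this])
  exact ⟨fun i => ψ.comp (single i), fun t => by rw [← tpow_algHom_ext, ← hψ]; rfl⟩

instance [Algebra.FiniteType ℂ B] : Algebra.FiniteType ℂ (TPow n B) := by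
  classical
  obtain ⟨s, hs⟩ := Algebra.FiniteType.out (R := ℂ) (A := B)
  refine ⟨⟨Finset.univ.biUnion fun i => s.image (single i), ?_⟩⟩
  rw [eq_top_iff, ← adjoin_single, Algebra.adjoin_le_iff]
  rintro _ ⟨_, ⟨i, rfl⟩, b, rfl⟩
  have h1 : (Algebra.adjoin ℂ (s : Set B)).map (single i) ≤ Algebra.adjoin ℂ
      ((Finset.univ.biUnion fun i => s.image (single (n := n) i) : Finset _) : Set (TPow n B)) := by
    rw [AlgHom.map_adjoin]
    refine Algebra.adjoin_mono ?_
    rintro _ ⟨a, ha, rfl⟩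
    simp only [Finset.coe_biUnion, Set.mem_iUnion, Finset.coe_image]
    exact ⟨i, by simp, a, ha, rfl⟩
  exact h1 ⟨b, by rw [hs]; trivial, rfl⟩

instance [Algebra.FiniteType ℂ B] : Algebra.FiniteType ℂ (TS n B) := by
  have : Algebra.FiniteType (TS n B) (TPow n B) :=
    Algebra.FiniteType.of_restrictScalars_finiteType ℂ (TS n B) (TPow n B)
  have : Module.Finite (TS n B) (TPow n B) := Algebra.IsIntegral.finite
  exact ⟨fg_of_fg_of_fg ℂ (TS n B) (TPow n B) Algebra.FiniteType.out Module.Finite.fg_top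
    Subtype.val_injective⟩

end SymTensor

/-! ### Complex points of the fibre product -/

namespace SymTensor

section Points

variable {A : Type} [CommRing A] [Algebra ℂ A]

/-- Nullstellensatz: maximal ideals of a finitely generated algebra are complex points. -/
lemma exists_ker_eq_of_isMaximal [Algebra.FiniteType ℂ A] (M : Ideal A) [M.IsMaximal] :
    ∃ y : A →ₐ[ℂ] ℂ, RingHom.ker y = M := by
  let _ : Field (A ⧸ M) := Ideal.Quotient.field M
  have : Algebra.FiniteType ℂ (A ⧸ M) :=
    Algebra.FiniteType.of_surjective (Ideal.Quotient.mkₐ ℂ M) Ideal.Quotient.mk_surjective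
  have : Module.Finite ℂ (A ⧸ M) := finite_of_finite_type_of_isJacobsonRing ℂ (A ⧸ M)
  have hb : Function.Bijective (Algebra.ofId ℂ (A ⧸ M)) :=
    IsAlgClosed.algebraMap_bijective_of_isIntegral
  let e := AlgEquiv.ofBijective _ hb
  refine ⟨(e.symm : (A ⧸ M) →ₐ[ℂ] ℂ).comp (Ideal.Quotient.mkₐ ℂ M), ?_⟩
  ext a
  rw [RingHom.mem_ker]
  change e.symm (Ideal.Quotient.mk M a) = 0 ↔ _
  rw [EmbeddingLike.map_eq_zero_iff, Ideal.Quotient.eq_zero_iff_mem]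

lemma isNilpotent_of_forall_point [Algebra.FiniteType ℂ A] {a : A}
    (h : ∀ y : A →ₐ[ℂ] ℂ, y a = 0) : IsNilpotent a := by
  have : IsJacobsonRing A := isJacobsonRing_of_finiteType (A := ℂ)
  have h0 : (⊥ : Ideal A).radical.jacobson = (⊥ : Ideal A).radical :=
    IsJacobsonRing.out ‹_› (Ideal.radical_isRadical ⊥)
  have : a ∈ (⊥ : Ideal A).radical := by
    rw [← h0, Ideal.jacobson, Submodule.mem_sInf]
    rintro J ⟨-, hJ⟩
    obtain ⟨y, rfl⟩ := exists_ker_eq_of_isMaximal J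
    exact h y
  exact mem_nilradical.1 this

instance ker_isMaximal (y : A →ₐ[ℂ] ℂ) : (RingHom.ker y).IsMaximal :=
  RingHom.ker_isMaximal_of_surjective y fun z => ⟨algebraMap ℂ A z, by simp⟩

lemma algHom_eq_of_ker_le {y y' : A →ₐ[ℂ] ℂ} (h : RingHom.ker y ≤ RingHom.ker y') : y = y' := by
  ext a
  have : a - algebraMap ℂ A (y a) ∈ RingHom.ker y' := h (by simp [RingHom.mem_ker])
  rw [RingHom.mem_ker, map_sub, AlgHom.commutes, sub_eq_zero] at this
  exact this.symm

end Points

section Characters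

variable {B K : Type} [CommRing B] [Algebra ℂ B] [CommRing K] [IsDomain K] [Algebra ℂ K]

/-- Independence of characters: a finite multiset of characters is determined by its sum. -/
lemma multiset_eq_of_sum_eq {D D' : Multiset (B →ₐ[ℂ] K)}
    (h : ∀ b, (D.map fun x => x b).sum = (D'.map fun x => x b).sum) : D = D' := by
  classical
  have : CharZero K := charZero_of_injective_algebraMap (algebraMap ℂ K).injective
  have hli := linearIndependent_toLinearMap ℂ B K
  rw [linearIndependent_iff'] at hli
  have := hli (D.toFinset ∪ D'.toFinset) (fun x => (D.count x : K) - D'.count x) (by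
    ext b
    have e1 : ∀ E : Multiset (B →ₐ[ℂ] K), E.toFinset ⊆ D.toFinset ∪ D'.toFinset →
        (E.map fun x => x b).sum = ∑ x ∈ D.toFinset ∪ D'.toFinset, (E.count x : K) * x b := by
      intro E hE
      rw [Finset.sum_multiset_map_count]
      simp only [nsmul_eq_mul]
      refine Finset.sum_subset hE fun x _ hx => ?_
      rw [Multiset.mem_toFinset, ← Multiset.count_eq_zero] at hx
      simp [hx]
    have := h b
    rw [e1 D Finset.subset_union_left, e1 D' Finset.subset_union_right, ← sub_eq_zero,
      ← Finset.sum_sub_distrib] at this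
    simpa [sub_mul] using this)
  ext x
  by_cases hx : x ∈ D.toFinset ∪ D'.toFinset
  · exact_mod_cast sub_eq_zero.1 (this x hx)
  · simp only [Finset.mem_union, Multiset.mem_toFinset, not_or] at hx
    rw [Multiset.count_eq_zero.2 hx.1, Multiset.count_eq_zero.2 hx.2]

end Characters

lemma exists_perm_of_map_eq {n : ℕ} {X : Type*} {x x' : Fin n → X}
    (h : Finset.univ.val.map x = Finset.univ.val.map x') :
    ∃ σ : Equiv.Perm (Fin n), ∀ i, x' (σ i) = x i := by
  classical
  have : ∀ c, Nonempty ({i // x i = c} ≃ {i // x' i = c}) := by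
    intro c
    refine ⟨Fintype.equivOfCardEq ?_⟩
    have := congrArg (Multiset.count c) h
    rw [Multiset.count_map, Multiset.count_map] at this
    rw [Fintype.card_subtype, Fintype.card_subtype]
    simpa only [Finset.card_def, Finset.filter_val, eq_comm] using this
  exact ⟨Equiv.ofFiberEquiv fun c => (this c).some, fun i => Equiv.ofFiberEquiv_map _ i⟩

variable {n : ℕ} {A B C : Type} [CommRing A] [Algebra ℂ A] [CommRing B] [Algebra ℂ B]
  [CommRing C] [Algebra ℂ C]

/-- The family `x` of points of `Spec B` is the fibre over the point `α` of `Spec A`, with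
multiplicities: `tr` is to be thought of as the trace of the finite flat algebra `B` over `A`. -/
def IsTraceFibre (tr : B → A) {S : Type} [CommRing S] [Algebra ℂ S] (α : A →ₐ[ℂ] S)
    (x : Fin n → (B →ₐ[ℂ] S)) : Prop := ∀ b, ∑ i, x i b = α (tr b)

/-- The function `a` on `Spec A` is the pullback of `f` along `y ↦ x₁ + ⋯ + xₙ`, where
`x₁ + ⋯ + xₙ` is the fibre over `y`. -/
def TraceRel (tr : B → A) (a : A) (f : TS n B) : Prop :=
  ∀ (y : A →ₐ[ℂ] ℂ) (x : Fin n → (B →ₐ[ℂ] ℂ)), IsTraceFibre tr y x →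
    y a = prodLift x (f : TPow n B)

lemma traceRel_psum (tr : B → A) (b : B) : TraceRel (n := n) tr (tr b) (psum n b) :=
  fun _ _ h => by rw [prodLift_psum, h b]

/-- Since power sums generate, a symmetric function on the fibres is a polynomial in traces,
whatever the values of the points. -/
lemma exists_forall_eq_prodLift (tr : B → A) (f : TS n B) :
    ∃ a : A, ∀ (S : Type) [CommRing S] [Algebra ℂ S] (α : A →ₐ[ℂ] S) (x : Fin n → (B →ₐ[ℂ] S)),
      IsTraceFibre tr α x → α a = prodLift x (f : TPow n B) := by
  have hf : f ∈ Algebra.adjoin ℂ (Set.range (psum (B := B) n)) := by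
    rw [adjoin_psum]; trivial
  induction hf using Algebra.adjoin_induction with
  | mem f hf =>
    obtain ⟨b, rfl⟩ := hf
    exact ⟨tr b, fun S _ _ α x h => by rw [prodLift_psum, h b]⟩
  | algebraMap r =>
    exact ⟨algebraMap ℂ A r, fun S _ _ α x h => by
      rw [AlgHom.commutes]; exact ((prodLift x).commutes r).symm⟩
  | add f g _ _ hf hg =>
    obtain ⟨a, ha⟩ := hf
    obtain ⟨b, hb⟩ := hg
    exact ⟨a + b, fun S _ _ α x h => by
      rw [map_add, ha S α x h, hb S α x h]; exact (map_add (prodLift x) _ _).symm⟩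
  | mul f g _ _ hf hg =>
    obtain ⟨a, ha⟩ := hf
    obtain ⟨b, hb⟩ := hg
    exact ⟨a * b, fun S _ _ α x h => by
      rw [map_mul, ha S α x h, hb S α x h]; exact (map_mul (prodLift x) _ _).symm⟩

/-- A relation which holds at all complex points of `Spec A` holds at all families of points with
values in a reduced algebra. -/
lemma TraceRel.eq_prodLift [Algebra.FiniteType ℂ A] {tr : B → A}
    (hex : ∀ y : A →ₐ[ℂ] ℂ, ∃ x : Fin n → (B →ₐ[ℂ] ℂ), IsTraceFibre tr y x)
    {a : A} {f : TS n B} (h : TraceRel tr a f) {S : Type} [CommRing S] [IsReduced S] [Algebra ℂ S]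
    {α : A →ₐ[ℂ] S} {x : Fin n → (B →ₐ[ℂ] S)} (hx : IsTraceFibre tr α x) :
    α a = prodLift x (f : TPow n B) := by
  obtain ⟨a₀, h₀⟩ := exists_forall_eq_prodLift tr f
  have : IsNilpotent (a - a₀) := isNilpotent_of_forall_point fun y => by
    obtain ⟨x, hx⟩ := hex y
    rw [map_sub, h y x hx, h₀ ℂ y x hx, sub_self]
  have := (this.map α).eq_zero
  rw [map_sub, sub_eq_zero] at this
  rw [this, h₀ S α x hx]

/-- A relation which holds at all complex points of `Spec A` holds at infinitesimal deformations
of a fibre with constant traces. -/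
lemma TraceRel.eq_prodLift_of_const {tr : B → A} {a : A} {f : TS n B} (h : TraceRel tr a f)
    {y : A →ₐ[ℂ] ℂ} {x : Fin n → (B →ₐ[ℂ] ℂ)} (hy : IsTraceFibre tr y x)
    {S : Type} [CommRing S] [Algebra ℂ S] {x' : Fin n → (B →ₐ[ℂ] S)}
    (hx : IsTraceFibre tr ((Algebra.ofId ℂ S).comp y) x') :
    algebraMap ℂ S (y a) = prodLift x' (f : TPow n B) := by
  obtain ⟨a₀, h₀⟩ := exists_forall_eq_prodLift tr f
  rw [h y x hy, ← h₀ ℂ y x hy, ← h₀ S _ _ hx]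
  rfl

section FibreRing

variable {κ : B →ₐ[ℂ] C} {Rel : A → TS n B → Prop}

lemma adjoin_fibre : Algebra.adjoin ℂ (Set.range (fibreLeft κ Rel) ∪
    Set.range fun c => fibreRight κ Rel (psum n c)) = ⊤ := by
  rw [eq_top_iff]
  rintro z -
  obtain ⟨z, rfl⟩ := fibreMk_surjective κ Rel z
  induction z using TensorProduct.induction_on with
  | zero => rw [map_zero]; exact Subalgebra.zero_mem _
  | tmul a t =>
    have : fibreMk κ Rel (a ⊗ₜ[ℂ] t) = fibreLeft κ Rel a * fibreRight κ Rel t := by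
      change _ = fibreMk κ Rel (a ⊗ₜ[ℂ] 1) * fibreMk κ Rel (1 ⊗ₜ[ℂ] t)
      rw [← map_mul]
      simp
    rw [this]
    refine Subalgebra.mul_mem _ (Algebra.subset_adjoin (Or.inl ⟨a, rfl⟩)) ?_
    have h1 : (Algebra.adjoin ℂ (Set.range (psum (B := C) n))).map (fibreRight κ Rel) ≤
        Algebra.adjoin ℂ (Set.range (fibreLeft κ Rel) ∪
          Set.range fun c => fibreRight κ Rel (psum n c)) := by
      rw [AlgHom.map_adjoin]
      refine Algebra.adjoin_mono ?_
      rintro _ ⟨_, ⟨c, rfl⟩, rfl⟩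
      exact Or.inr ⟨c, rfl⟩
    exact h1 ⟨t, by rw [adjoin_psum]; trivial, rfl⟩
  | add x y hx hy => rw [map_add]; exact Subalgebra.add_mem _ hx hy

lemma fibreAlgHom_ext {S : Type} [CommRing S] [Algebra ℂ S] {f g : FibreRing κ Rel →ₐ[ℂ] S}
    (h₁ : ∀ a, f (fibreLeft κ Rel a) = g (fibreLeft κ Rel a))
    (h₂ : ∀ c, f (fibreRight κ Rel (psum n c)) = g (fibreRight κ Rel (psum n c))) : f = g :=
  AlgHom.ext_of_adjoin_eq_top adjoin_fibre (by
    rintro _ (⟨a, rfl⟩ | ⟨c, rfl⟩)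
    exacts [h₁ a, h₂ c])

instance [Algebra.FiniteType ℂ A] [Algebra.FiniteType ℂ C] :
    Algebra.FiniteType ℂ (FibreRing κ Rel) :=
  have : Algebra.FiniteType A (A ⊗[ℂ] TS n C) := Algebra.FiniteType.baseChange A
  have : Algebra.FiniteType ℂ (A ⊗[ℂ] TS n C) := Algebra.FiniteType.trans (S := A) ‹_› ‹_›
  Algebra.FiniteType.of_surjective (fibreMk κ Rel) (fibreMk_surjective κ Rel)

/-- The ideal of a point of the fibre product is generated by the obvious functions. -/
lemma ker_le_of_mem (χ : FibreRing κ Rel →ₐ[ℂ] ℂ) (I : Ideal (FibreRing κ Rel))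
    (h₁ : ∀ a, χ (fibreLeft κ Rel a) = 0 → fibreLeft κ Rel a ∈ I)
    (h₂ : ∀ c, fibreRight κ Rel (psum n c) -
      algebraMap ℂ _ (χ (fibreRight κ Rel (psum n c))) ∈ I) : RingHom.ker χ ≤ I := by
  have key : Ideal.Quotient.mkₐ ℂ I = (Algebra.ofId ℂ _).comp χ := by
    refine fibreAlgHom_ext (fun a => ?_) (fun c => ?_)
    · change Ideal.Quotient.mk I _ = algebraMap ℂ _ _
      rw [IsScalarTower.algebraMap_apply ℂ (FibreRing κ Rel), Ideal.Quotient.algebraMap_eq,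
        Ideal.Quotient.eq]
      have := h₁ (a - algebraMap ℂ A (χ (fibreLeft κ Rel a))) (by simp)
      simpa using this
    · change Ideal.Quotient.mk I _ = algebraMap ℂ _ _
      rw [IsScalarTower.algebraMap_apply ℂ (FibreRing κ Rel), Ideal.Quotient.algebraMap_eq,
        Ideal.Quotient.eq]
      exact h₂ c
  intro z hz
  have := DFunLike.congr_fun key z
  rw [AlgHom.comp_apply, (RingHom.mem_ker).1 hz, map_zero] at this
  exact Ideal.Quotient.eq_zero_iff_mem.1 this

/-- Complex points of the fibre product are pairs of a point `y` and a divisor `x₁ + ⋯ + xₙ` whose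
image is the fibre over `y`. -/
lemma exists_point_eq {tr : B → A} (hR : ∀ b, Rel (tr b) (psum n b))
    (χ : FibreRing κ Rel →ₐ[ℂ] ℂ) : ∃ x : Fin n → (C →ₐ[ℂ] ℂ),
      (∀ t, χ (fibreRight κ Rel t) = prodLift x (t : TPow n C)) ∧
      IsTraceFibre tr (χ.comp (fibreLeft κ Rel)) fun i => (x i).comp κ := by
  obtain ⟨x, hx⟩ := exists_eq_prodLift (χ.comp (fibreRight κ Rel))
  refine ⟨x, hx, fun b => ?_⟩
  have := hx (tsMap κ (psum n b))
  rw [AlgHom.comp_apply, ← fibreLeft_eq (hR b), tsMap_psum, prodLift_psum] at this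
  exact this.symm

end FibreRing

end SymTensor

/-! ### Double covers and the cotangent space of a symmetric power -/

namespace SymTensor

section Interpolation

variable {B C : Type} [CommRing B] [Algebra ℂ B] [CommRing C] [Algebra ℂ C]

lemma isCoprime_ker {p q : B →ₐ[ℂ] ℂ} (h : p ≠ q) : IsCoprime (RingHom.ker p) (RingHom.ker q) :=
  Ideal.isCoprime_of_isMaximal fun e => h (algHom_eq_of_ker_le e.le)

/-- Interpolation to any order at finitely many points. -/
lemma exists_forall_sub_mem (Q : Finset (B →ₐ[ℂ] ℂ)) (k : ℕ) (v : (B →ₐ[ℂ] ℂ) → B) :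
    ∃ b, ∀ q ∈ Q, b - v q ∈ RingHom.ker q ^ k := by
  obtain ⟨b, hb⟩ := Ideal.exists_forall_sub_mem_ideal (ι := Q)
    (I := fun q => RingHom.ker q.1 ^ k)
    (fun p q h => (isCoprime_ker fun e => h (Subtype.ext e)).pow) (fun q => v q.1)
  exact ⟨b, fun q hq => hb ⟨q, hq⟩⟩

lemma mem_iInf_ker_pow {Q : Finset (B →ₐ[ℂ] ℂ)} {k : ℕ} {b : B}
    (h : ∀ q ∈ Q, b ∈ RingHom.ker q ^ k) : b ∈ (⨅ q ∈ Q, RingHom.ker q) ^ k := by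
  rw [← Ideal.prod_eq_iInf_of_pairwise_isCoprime, ← Finset.prod_pow,
    Ideal.prod_eq_iInf_of_pairwise_isCoprime]
  · simpa [Submodule.mem_iInf] using h
  · exact fun p _ q _ h => (isCoprime_ker h).pow
  · exact fun p _ q _ h => isCoprime_ker h

/-- `Spec C → Spec B` is an étale double cover, on the level of complex points: every point `p` has
exactly two preimages, and their reduced union is the scheme-theoretic fibre. -/
def IsDoubleCover (κ : B →ₐ[ℂ] C) : Prop :=
  ∀ p : B →ₐ[ℂ] ℂ, ∃ q q' : C →ₐ[ℂ] ℂ, q ≠ q' ∧ (∀ r : C →ₐ[ℂ] ℂ, r.comp κ = p ↔ r = q ∨ r = q') ∧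
    RingHom.ker q ⊓ RingHom.ker q' ≤ (RingHom.ker p).map κ

lemma IsDoubleCover.exists_conj {κ : B →ₐ[ℂ] C} (h : IsDoubleCover κ) (q : C →ₐ[ℂ] ℂ) :
    ∃ q' : C →ₐ[ℂ] ℂ, q ≠ q' ∧ (∀ r : C →ₐ[ℂ] ℂ, r.comp κ = q.comp κ ↔ r = q ∨ r = q') ∧
    RingHom.ker q ⊓ RingHom.ker q' ≤ (RingHom.ker (q.comp κ)).map κ := by
  obtain ⟨q₁, q₂, hne, hf, hk⟩ := h (q.comp κ)
  rcases (hf q).1 rfl with rfl | rfl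
  · exact ⟨q₂, hne, hf, hk⟩
  · exact ⟨q₁, hne.symm, fun r => (hf r).trans or_comm, by rwa [inf_comm]⟩

lemma map_ker_pow_le (κ : B →ₐ[ℂ] C) (q : C →ₐ[ℂ] ℂ) (k : ℕ) :
    (RingHom.ker (q.comp κ) ^ k).map κ ≤ RingHom.ker q ^ k := by
  rw [Ideal.map_pow]
  refine Ideal.pow_right_mono (Ideal.map_le_iff_le_comap.2 fun b hb => ?_) k
  exact hb

/-- A double cover is an isomorphism on infinitesimal neighbourhoods. -/
lemma IsDoubleCover.exists_sub_mem {κ : B →ₐ[ℂ] C} (h : IsDoubleCover κ) (q : C →ₐ[ℂ] ℂ) (k : ℕ)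
    (c : C) : ∃ b, c - κ b ∈ RingHom.ker q ^ k := by
  obtain ⟨q', hne, -, hk⟩ := h.exists_conj q
  set I := RingHom.ker q
  set J := RingHom.ker (q.comp κ)
  -- near `q` the fibre is reduced, so functions on `Spec B` generate the cotangent space at `q`
  have h1 : I ≤ J.map κ ⊔ I ^ 2 := by
    intro c hc
    obtain ⟨e, he, f, hf, hef⟩ := (isCoprime_ker hne).symm.exists
    rw [show c = c * e + c * f by rw [← mul_add, hef, mul_one]]
    refine Submodule.add_mem_sup (hk ⟨I.mul_mem_right _ hc, Ideal.mul_mem_left _ _ he⟩) ?_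
    rw [pow_two]
    exact Ideal.mul_mem_mul hc hf
  have h2 : J.map κ ≤ I := by simpa using map_ker_pow_le κ q 1
  have h3 : ∀ k, I ^ k ≤ (J ^ k).map κ ⊔ I ^ (k + 1) := by
    intro k
    induction k with
    | zero =>
      rw [pow_zero, pow_zero, Ideal.one_eq_top, Ideal.one_eq_top, Ideal.map_top, top_sup_eq]
    | succ k ih =>
      calc I ^ (k + 1) = I ^ k * I := pow_succ _ _
        _ ≤ ((J ^ k).map κ ⊔ I ^ (k + 1)) * (J.map κ ⊔ I ^ 2) := Ideal.mul_mono ih h1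
        _ ≤ _ := by
          rw [Ideal.sup_mul, Ideal.mul_sup, Ideal.mul_sup]
          refine sup_le (sup_le ?_ ?_) (sup_le ?_ ?_)
          · rw [← Ideal.map_mul, ← pow_succ]; exact le_sup_left
          · refine le_trans ?_ le_sup_right
            rw [show k + 1 + 1 = k + 2 by rfl, pow_add]
            exact Ideal.mul_mono_left (map_ker_pow_le κ q k)
          · refine le_trans ?_ le_sup_right
            rw [pow_succ I (k + 1)]
            exact Ideal.mul_mono_right h2
          · refine le_trans ?_ le_sup_right
            rw [← pow_add]
            exact Ideal.pow_le_pow_right (by omega)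
  have h0 : ∀ c, ∃ b, c - κ b ∈ I := fun c => ⟨algebraMap ℂ B (q c), by simp [I, RingHom.mem_ker]⟩
  induction k with
  | zero => exact ⟨0, by simp⟩
  | succ k ih =>
    obtain ⟨b, hb⟩ := ih
    obtain ⟨z, hz, w, hw, e⟩ := Submodule.mem_sup.1 (h3 k hb)
    have h4 : ∀ z ∈ (J ^ k).map κ, ∃ b, z - κ b ∈ I ^ (k + 1) := by
      intro z hz
      rw [Ideal.map, ← Ideal.submodule_span_eq] at hz
      induction hz using Submodule.span_induction with
      | mem z hz => obtain ⟨b, -, rfl⟩ := hz; exact ⟨b, by simp⟩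
      | zero => exact ⟨0, by simp⟩
      | add z w _ _ hz hw =>
        obtain ⟨b, hb⟩ := hz
        obtain ⟨b', hb'⟩ := hw
        refine ⟨b + b', ?_⟩
        rw [map_add, add_sub_add_comm]
        exact Ideal.add_mem _ hb hb'
      | smul a z hz' hz =>
        obtain ⟨b, hb⟩ := hz
        obtain ⟨a', ha'⟩ := h0 a
        refine ⟨a' * b, ?_⟩
        have hz2 : z ∈ I ^ k := map_ker_pow_le κ q k hz'
        rw [map_mul, smul_eq_mul,
          show a * z - κ a' * κ b = z * (a - κ a') + κ a' * (z - κ b) by ring]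
        refine Ideal.add_mem _ ?_ (Ideal.mul_mem_left _ _ hb)
        rw [pow_succ]
        exact Ideal.mul_mem_mul hz2 ha'
    obtain ⟨b', hb'⟩ := h4 z hz
    refine ⟨b + b', ?_⟩
    rw [map_add, ← sub_sub, ← e, add_sub_right_comm]
    exact Ideal.add_mem _ hb' hw

/-- At finitely many points with different images, a function on a double cover is to any given
order the pullback of a function. -/
lemma IsDoubleCover.exists_forall_sub_mem {κ : B →ₐ[ℂ] C} (h : IsDoubleCover κ)
    (Q : Finset (C →ₐ[ℂ] ℂ)) (hQ : Set.InjOn (fun q => q.comp κ) (Q : Set (C →ₐ[ℂ] ℂ))) (k : ℕ)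
    (c : C) : ∃ b, ∀ q ∈ Q, c - κ b ∈ RingHom.ker q ^ k := by
  classical
  choose b hb using fun q => h.exists_sub_mem q k c
  have : ∃ v : (B →ₐ[ℂ] ℂ) → B, ∀ q ∈ Q, v (q.comp κ) = b q := by
    refine ⟨fun p => if hp : ∃ q ∈ Q, q.comp κ = p then b hp.choose else 0, fun q hq => ?_⟩
    have hp : ∃ q' ∈ Q, q'.comp κ = q.comp κ := ⟨q, hq, rfl⟩
    simp only [dif_pos hp]
    rw [hQ hp.choose_spec.1 hq hp.choose_spec.2]
  obtain ⟨v, hv⟩ := this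
  obtain ⟨a, ha⟩ := SymTensor.exists_forall_sub_mem (Q.image fun q => q.comp κ) k v
  refine ⟨a, fun q hq => ?_⟩
  have h1 := ha _ (Finset.mem_image_of_mem _ hq)
  rw [hv q hq] at h1
  have h2 := map_ker_pow_le κ q k (Ideal.mem_map_of_mem κ h1)
  rw [map_sub] at h2
  have := Ideal.sub_mem _ (hb q) h2
  rwa [sub_sub_sub_cancel_right] at this

end Interpolation

section Cotangent

variable {n : ℕ} {C : Type} [CommRing C] [Algebra ℂ C] (x : Fin n → (C →ₐ[ℂ] ℂ))

/-- The value of a symmetric tensor at the point `x₁ + ⋯ + xₙ` of the symmetric power. -/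
noncomputable def evalSym : TS n C →ₐ[ℂ] ℂ := (prodLift x).comp (TS n C).val

lemma evalSym_apply (t : TS n C) : evalSym x t = prodLift x (t : TPow n C) := rfl

@[simp] lemma evalSym_psum (c : C) : evalSym x (psum n c) = ∑ i, x i c := prodLift_psum x c

/-- The extension to the tensor power of the square of the ideal of a point. -/
noncomputable def sqIdeal : Ideal (TPow n C) :=
  (RingHom.ker (evalSym x) ^ 2).map (algebraMap (TS n C) (TPow n C))

lemma mem_ker_sq {f : TS n C} (h : (f : TPow n C) ∈ sqIdeal x) : f ∈ RingHom.ker (evalSym x) ^ 2 :=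
  mem_of_mem_map _ h

/-- `single i c` is a root of the monic polynomial `∏ l, (X - single l c)`, whose lower coefficients
vanish at the point `x₁ + ⋯ + xₙ`. -/
lemma single_pow_mem {c : C} (hc : ∀ i, x i c = 0) (i : Fin n) :
    single i c ^ n ∈ (RingHom.ker (evalSym x)).map (algebraMap (TS n C) (TPow n C)) := by
  choose t ht using exists_coeff_prod_X_sub (n := n) c
  set p : Polynomial (TPow n C) := ∏ l : Fin n, (Polynomial.X - Polynomial.C (single l c)) with hp
  have ht0 : ∀ k < n, t k ∈ RingHom.ker (evalSym x) := by
    intro k hk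
    rw [RingHom.mem_ker, evalSym_apply, ht]
    have := Polynomial.coeff_map (p := p) (prodLift x).toRingHom k
    refine this.symm.trans ?_
    have e : p.map (prodLift x).toRingHom = Polynomial.X ^ n := by
      rw [hp, Polynomial.map_prod]
      have : ∀ l : Fin n, Polynomial.map (prodLift x).toRingHom
          (Polynomial.X - Polynomial.C (single l c)) = Polynomial.X := by
        intro l
        have h0 : (prodLift x).toRingHom (single l c) = 0 := (prodLift_single x l c).trans (hc l)
        rw [Polynomial.map_sub, Polynomial.map_X, Polynomial.map_C, h0]
        simp
      rw [Finset.prod_congr rfl fun l _ => this l]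
      simp
    rw [e, Polynomial.coeff_X_pow, if_neg hk.ne]
  have hdeg : p.natDegree ≤ n := by
    refine (Polynomial.natDegree_prod_le _ _).trans ?_
    refine (Finset.sum_le_card_nsmul _ _ 1 fun l _ => Polynomial.natDegree_X_sub_C_le _).trans ?_
    simp
  have hn : p.coeff n = 1 := by
    have hm : p.Monic := Polynomial.monic_prod_of_monic _ _ fun l _ => Polynomial.monic_X_sub_C _
    rcases subsingleton_or_nontrivial (TPow n C) with h | h
    · exact Subsingleton.elim _ _
    have : p.natDegree = n := by
      rw [hp, Polynomial.natDegree_prod_of_monic _ _ fun l _ => Polynomial.monic_X_sub_C _]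
      simp
    have h2 := hm.coeff_natDegree
    rwa [this] at h2
  have h0 := eval_prod_X_sub (n := n) c i
  rw [← hp, Polynomial.eval_eq_sum_range' (Nat.lt_succ_of_le hdeg), Finset.sum_range_succ, hn,
    one_mul] at h0
  rw [eq_neg_of_add_eq_zero_right h0]
  refine Ideal.neg_mem_iff _ |>.2 (Ideal.sum_mem _ fun k hk => Ideal.mul_mem_right _ _ ?_)
  rw [← ht]
  exact Ideal.mem_map_of_mem _ (ht0 k (Finset.mem_range.1 hk))

/-- Functions which vanish to high order on the support of a divisor do not contribute to the
cotangent space of the symmetric power. -/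
lemma exists_single_mem_sqIdeal [Algebra.FiniteType ℂ C] :
    ∃ M : ℕ, ∀ j : C, (∀ i, j ∈ RingHom.ker (x i) ^ M) → ∀ i, single i j ∈ sqIdeal x := by
  classical
  have : IsNoetherianRing C := Algebra.FiniteType.isNoetherianRing ℂ C
  let Q : Finset (C →ₐ[ℂ] ℂ) := Finset.univ.image x
  let I : Ideal C := ⨅ q ∈ Q, RingHom.ker q
  let J : Ideal C := ⨅ i, (sqIdeal x).comap (single i)
  have hIJ : I ≤ J.radical := by
    intro c hc
    refine ⟨n * 2, ?_⟩
    have hc' : ∀ i, x i c = 0 := fun i => by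
      have : I ≤ RingHom.ker (x i) := iInf₂_le (x i) (by simp [Q])
      exact this hc
    simp only [J, Submodule.mem_iInf, Ideal.mem_comap]
    intro i
    rw [map_pow, pow_mul, sqIdeal, Ideal.map_pow]
    exact Ideal.pow_mem_pow (single_pow_mem x hc' i) 2
  obtain ⟨M, hM⟩ := Ideal.exists_pow_le_of_le_radical_of_fg hIJ (IsNoetherian.noetherian I)
  refine ⟨M, fun j hj i => ?_⟩
  have h1 : j ∈ I ^ M := mem_iInf_ker_pow (by
    intro q hq
    obtain ⟨i, -, rfl⟩ := Finset.mem_image.1 hq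
    exact hj i)
  have h2 := hM h1
  simp only [J, Submodule.mem_iInf, Ideal.mem_comap] at h2
  exact h2 i

lemma psum_mem_sq {j : C} (h : ∀ i, single i j ∈ sqIdeal x) :
    psum n j ∈ RingHom.ker (evalSym x) ^ 2 :=
  mem_ker_sq x (by rw [coe_psum]; exact Ideal.sum_mem _ fun i _ => h i)

lemma mem_sq_of_mul_mem_sq {R : Type*} [CommRing R] {m : Ideal R} [hm : m.IsMaximal] {e f : R}
    (he : e ∉ m) (h : e * f ∈ m ^ 2) : f ∈ m ^ 2 := by
  have hf : f ∈ m := ((hm.isPrime.mem_or_mem (Ideal.pow_le_self two_ne_zero h)).resolve_left he)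
  obtain ⟨u, z, hz, hu⟩ := hm.exists_inv he
  rw [show f = u * (e * f) + z * f by rw [← mul_assoc, ← add_mul, hu, one_mul]]
  refine Ideal.add_mem _ (Ideal.mul_mem_left _ _ h) ?_
  rw [pow_two]
  exact Ideal.mul_mem_mul hz hf

/-- At a point of multiplicity one of a divisor, cut out by the approximate idempotent `h`, the map
`c ↦ ∑ᵢ (h c)(xᵢ)` is multiplicative to first order. -/
lemma psum_mul_psum_sub_mem {h : C} {i₀ : Fin n} (h₁ : x i₀ h = 1) (h₀ : ∀ i ≠ i₀, x i h = 0)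
    (hj : ∀ c, ∀ i, single i (h * (1 - h) * c) ∈ sqIdeal x) (c c' : C) :
    psum n (h * c) * psum n (h * c') - psum n (h * (c * c')) ∈ RingHom.ker (evalSym x) ^ 2 := by
  classical
  let g := 1 - h
  -- `E` is invertible at the point. Each of its terms omits one index only, so it contains `g` at
  -- one of the two places of a mixed product `single a (h * c) * single b (h * c')`, and
  -- `single a (g * h * c)` is negligible.
  let E : TS n C := ⟨∑ i, ∏ j ∈ Finset.univ.erase i, single j g, mem_TS.2 fun σ => by
    rw [map_sum]
    refine Fintype.sum_equiv σ.symm _ _ fun i => ?_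
    rw [map_prod]
    refine Finset.prod_bij' (fun j _ => σ.symm j) (fun j _ => σ j) ?_ ?_ ?_ ?_ ?_
    · intro j hj; simpa using hj
    · intro j hj
      simp only [Finset.mem_erase, Finset.mem_univ, and_true] at hj ⊢
      exact fun e => hj (by rw [← e]; simp)
    · simp
    · simp
    · intro j _; exact perm_single σ j g⟩
  have hE : E ∉ RingHom.ker (evalSym x) := by
    rw [RingHom.mem_ker, evalSym_apply]
    have : prodLift x (E : TPow n C) = 1 := by
      change prodLift x (∑ i, ∏ j ∈ Finset.univ.erase i, single j g) = 1
      rw [map_sum, Finset.sum_eq_single i₀]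
      · rw [map_prod]
        refine Finset.prod_eq_one fun j hj => ?_
        rw [prodLift_single, map_sub, map_one, h₀ j (Finset.ne_of_mem_erase hj), sub_zero]
      · intro i _ hi
        rw [map_prod]
        refine Finset.prod_eq_zero (i := i₀) (by simp [hi.symm]) ?_
        rw [prodLift_single, map_sub, map_one, h₁, sub_self]
      · simp
    rw [this]; exact one_ne_zero
  have key : ∀ i a c, a ≠ i → (∏ j ∈ Finset.univ.erase i, single j g) * single a (h * c) ∈
      sqIdeal x := by
    intro i a c hai
    rw [← Finset.prod_erase_mul _ _ (show a ∈ Finset.univ.erase i by simp [hai]), mul_assoc,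
      ← map_mul]
    refine Ideal.mul_mem_left _ _ ?_
    rw [show g * (h * c) = h * (1 - h) * c by ring]
    exact hj c a
  have h3 : psum n (h * c) * psum n (h * c') - psum n (h * h * (c * c')) ∈
      RingHom.ker (evalSym x) ^ 2 := by
    refine mem_sq_of_mul_mem_sq hE (mem_ker_sq x ?_)
    change (∑ i, ∏ j ∈ Finset.univ.erase i, single j g) * ((∑ i, single i (h * c)) *
      (∑ i, single i (h * c')) - ∑ i, single i (h * h * (c * c'))) ∈ _
    have e : (∑ i : Fin n, single i (h * c)) * (∑ i : Fin n, single i (h * c')) -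
        ∑ i : Fin n, single i (h * h * (c * c')) =
        ∑ a : Fin n, ∑ b ∈ Finset.univ.erase a, single a (h * c) * single b (h * c') := by
      rw [Finset.sum_mul_sum, ← Finset.sum_sub_distrib]
      refine Finset.sum_congr rfl fun a _ => ?_
      rw [← Finset.sum_erase_add _ _ (Finset.mem_univ a), ← map_mul,
        show h * c * (h * c') = h * h * (c * c') by ring, add_sub_cancel_right]
    rw [e, Finset.sum_mul]
    refine Ideal.sum_mem _ fun i _ => ?_
    rw [Finset.mul_sum]
    refine Ideal.sum_mem _ fun a _ => ?_
    rw [Finset.mul_sum]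
    refine Ideal.sum_mem _ fun b hb => ?_
    by_cases hai : a = i
    · subst hai
      rw [mul_left_comm]
      exact Ideal.mul_mem_left _ _ (key a b c' (Finset.ne_of_mem_erase hb))
    · rw [← mul_assoc]
      exact Ideal.mul_mem_right _ _ (key i a c hai)
  have h4 : psum n (h * (c * c')) - psum n (h * h * (c * c')) ∈ RingHom.ker (evalSym x) ^ 2 := by
    rw [← psum_sub]
    refine psum_mem_sq x fun i => ?_
    rw [show h * (c * c') - h * h * (c * c') = h * (1 - h) * (c * c') by ring]
    exact hj _ i
  have := Ideal.sub_mem _ h3 h4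
  rwa [sub_sub_sub_cancel_right] at this

end Cotangent

end SymTensor

/-! ### The cotangent space of the fibre product -/

namespace SymTensor

section Bump

variable {n : ℕ} {C : Type} [CommRing C] [Algebra ℂ C] {x : Fin n → (C →ₐ[ℂ] ℂ)}

/-- To order `M`, the function `h` is `1` at `x i₀` and `0` at the other points. -/
structure IsBump (x : Fin n → (C →ₐ[ℂ] ℂ)) (M : ℕ) (i₀ : Fin n) (h : C) : Prop where
  sub_one_mem : h - 1 ∈ RingHom.ker (x i₀) ^ M
  mem : ∀ i ≠ i₀, h ∈ RingHom.ker (x i) ^ M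

lemma exists_isBump (M : ℕ) {i₀ : Fin n} (hi : ∀ i ≠ i₀, x i ≠ x i₀) : ∃ h, IsBump x M i₀ h := by
  classical
  obtain ⟨h, hh⟩ := exists_forall_sub_mem (Finset.univ.image x) M
    fun q => if q = x i₀ then (1 : C) else 0
  refine ⟨h, ?_, fun i hne => ?_⟩
  · simpa using hh (x i₀) (by simp)
  · simpa [hi i hne] using hh (x i) (by simp)

variable {M : ℕ} {i₀ : Fin n} {h : C}

lemma IsBump.apply_self (hh : IsBump x M i₀ h) (hM : M ≠ 0) : x i₀ h = 1 := by
  have := Ideal.pow_le_self hM hh.sub_one_mem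
  rwa [RingHom.mem_ker, map_sub, map_one, sub_eq_zero] at this

lemma IsBump.apply_of_ne (hh : IsBump x M i₀ h) (hM : M ≠ 0) {i : Fin n} (hi : i ≠ i₀) :
    x i h = 0 := Ideal.pow_le_self hM (hh.mem i hi)

lemma IsBump.evalSym_psum (hh : IsBump x M i₀ h) (hM : M ≠ 0) (c : C) :
    evalSym x (psum n (h * c)) = x i₀ c := by
  rw [SymTensor.evalSym_psum, Finset.sum_eq_single i₀]
  · rw [map_mul, hh.apply_self hM, one_mul]
  · intro i _ hi
    rw [map_mul, hh.apply_of_ne hM hi, zero_mul]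
  · simp

lemma IsBump.psum_mul (hh : IsBump x M i₀ h) (hM : M ≠ 0)
    (hS : ∀ j : C, (∀ i, j ∈ RingHom.ker (x i) ^ M) → ∀ i, single i j ∈ sqIdeal x) (c c' : C) :
    psum n (h * c) * psum n (h * c') - psum n (h * (c * c')) ∈ RingHom.ker (evalSym x) ^ 2 := by
  refine psum_mul_psum_sub_mem x (hh.apply_self hM) (fun i => hh.apply_of_ne hM) (fun c => hS _ ?_)
    c c'
  intro i
  refine Ideal.mul_mem_right _ _ ?_
  by_cases hi : i = i₀
  · subst hi
    refine Ideal.mul_mem_left _ _ ?_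
    rw [← neg_sub]
    exact (Ideal.neg_mem_iff _).2 hh.sub_one_mem
  · exact Ideal.mul_mem_right _ _ (hh.mem i hi)

/-- To first order `psum n h` is idempotent, and its value is not zero. -/
lemma IsBump.psum_sub_one (hh : IsBump x M i₀ h) (hM : M ≠ 0)
    (hS : ∀ j : C, (∀ i, j ∈ RingHom.ker (x i) ^ M) → ∀ i, single i j ∈ sqIdeal x) :
    psum n h - 1 ∈ RingHom.ker (evalSym x) ^ 2 := by
  have h1 := hh.psum_mul hM hS 1 1
  have h2 := hh.evalSym_psum hM 1
  rw [mul_one, mul_one] at h1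
  rw [mul_one, map_one] at h2
  refine mem_sq_of_mul_mem_sq (e := psum n h) ?_ ?_
  · rw [RingHom.mem_ker, h2]; exact one_ne_zero
  · rw [mul_one] at h1
    rwa [mul_sub, mul_one]

lemma IsBump.psum_mem_sq (hh : IsBump x M i₀ h) (hM : M ≠ 0)
    (hS : ∀ j : C, (∀ i, j ∈ RingHom.ker (x i) ^ M) → ∀ i, single i j ∈ sqIdeal x) {c : C}
    (hc : c ∈ RingHom.ker (x i₀) ^ 2) : psum n (h * c) ∈ RingHom.ker (evalSym x) ^ 2 := by
  rw [pow_two] at hc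
  induction hc using Submodule.mul_induction_on' with
  | mem_mul_mem a ha b hb =>
    have h1 := hh.psum_mul hM hS a b
    have h2 : psum n (h * a) * psum n (h * b) ∈ RingHom.ker (evalSym x) ^ 2 := by
      rw [pow_two]
      exact Ideal.mul_mem_mul ((hh.evalSym_psum hM a).trans ha) ((hh.evalSym_psum hM b).trans hb)
    simpa using Ideal.sub_mem _ h2 h1
  | add a _ b _ ha hb =>
    rw [mul_add, psum_add]
    exact Ideal.add_mem _ ha hb

end Bump

section FibreCotangent

variable {n : ℕ} {A B C : Type} [CommRing A] [Algebra ℂ A] [CommRing B] [Algebra ℂ B]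
  [CommRing C] [Algebra ℂ C] {κ : B →ₐ[ℂ] C} {Rel : A → TS n B → Prop} {tr : B → A}
  {χ : FibreRing κ Rel →ₐ[ℂ] ℂ} {x : Fin n → (C →ₐ[ℂ] ℂ)}

lemma fibreRight_mem_sq (hχ : ∀ t, χ (fibreRight κ Rel t) = prodLift x (t : TPow n C))
    {t : TS n C} (ht : t ∈ RingHom.ker (evalSym x) ^ 2) :
    fibreRight κ Rel t ∈ RingHom.ker χ ^ 2 := by
  have h1 : (RingHom.ker (evalSym x)).map (fibreRight κ Rel) ≤ RingHom.ker χ :=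
    Ideal.map_le_iff_le_comap.2 fun t ht => (hχ t).trans ht
  have h2 := Ideal.mem_map_of_mem (fibreRight κ Rel) ht
  rw [Ideal.map_pow] at h2
  exact Ideal.pow_right_mono h1 2 h2

lemma left_sub_mem {I : Ideal (FibreRing κ Rel)}
    (hI : (RingHom.ker (χ.comp (fibreLeft κ Rel))).map (fibreLeft κ Rel) ≤ I) (a : A) :
    fibreLeft κ Rel a - algebraMap ℂ _ (χ (fibreLeft κ Rel a)) ∈ I := by
  have h : a - algebraMap ℂ A (χ (fibreLeft κ Rel a)) ∈
      RingHom.ker (χ.comp (fibreLeft κ Rel)) := by simp [RingHom.mem_ker]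
  have := hI (Ideal.mem_map_of_mem _ h)
  rwa [map_sub, AlgHom.commutes] at this

lemma sub_algebraMap_mem {R : Type*} [CommRing R] [Algebra ℂ R] {χ : R →ₐ[ℂ] ℂ} {I : Ideal R}
    (hI : I ≤ RingHom.ker χ) {r : R} {z : ℂ} (h : r - algebraMap ℂ R z ∈ I) :
    r - algebraMap ℂ R (χ r) ∈ I := by
  have h1 := hI h
  rw [RingHom.mem_ker, map_sub, AlgHom.commutes, sub_eq_zero] at h1
  have h2 : χ r = z := h1
  rwa [h2]

/-- If the divisor contains no two distinct points with the same image under `κ`, then the cotangent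
space of the fibre product is generated by functions on `Spec A`. -/
lemma ker_le_of_injOn [Algebra.FiniteType ℂ C] (hκ : IsDoubleCover κ)
    (hR : ∀ b, Rel (tr b) (psum n b))
    (hχ : ∀ t, χ (fibreRight κ Rel t) = prodLift x (t : TPow n C))
    (hx : ∀ i j, (x i).comp κ = (x j).comp κ → x i = x j) :
    RingHom.ker χ ≤ (RingHom.ker (χ.comp (fibreLeft κ Rel))).map (fibreLeft κ Rel) ⊔
      RingHom.ker χ ^ 2 := by
  classical
  have hle : (RingHom.ker (χ.comp (fibreLeft κ Rel))).map (fibreLeft κ Rel) ⊔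
      RingHom.ker χ ^ 2 ≤ RingHom.ker χ :=
    sup_le (Ideal.map_le_iff_le_comap.2 fun t ht => ht) (Ideal.pow_le_self two_ne_zero)
  obtain ⟨M, hM⟩ := exists_single_mem_sqIdeal x
  refine ker_le_of_mem χ _ (fun a ha => Ideal.mem_sup_left (Ideal.mem_map_of_mem _ ha)) fun c => ?_
  obtain ⟨b, hb⟩ := hκ.exists_forall_sub_mem (Finset.univ.image x) (by
    intro q hq q' hq' h
    simp only [Finset.coe_image, Finset.coe_univ, Set.image_univ, Set.mem_range] at hq hq'
    obtain ⟨i, rfl⟩ := hq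
    obtain ⟨j, rfl⟩ := hq'
    exact hx i j h) M c
  have h1 : fibreRight κ Rel (psum n (c - κ b)) ∈ RingHom.ker χ ^ 2 :=
    fibreRight_mem_sq hχ (psum_mem_sq x (hM _ fun i => hb _ (by simp)))
  refine sub_algebraMap_mem hle (z := χ (fibreLeft κ Rel (tr b))) ?_
  rw [show c = (c - κ b) + κ b by ring, psum_add, map_add, ← tsMap_psum, ← fibreLeft_eq (hR b),
    add_sub_assoc]
  exact Ideal.add_mem _ (Ideal.mem_sup_right h1) (left_sub_mem le_sup_left _)

/-- If the divisor contains exactly one pair of distinct points `q'`, `q''` with the same image `p`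
under `κ`, and `Spec B → Spec A` is ramified at `p`, then the cotangent space of the fibre
product is generated by one function, which moves `q''` only. -/
lemma exists_ker_le_span_of_pair [Algebra.FiniteType ℂ C] (hκ : IsDoubleCover κ)
    (hR : ∀ b, Rel (tr b) (psum n b)) {ρ : A →ₐ[ℂ] B} (htr : ∀ a b, tr (ρ a * b) = a * tr b)
    (hχ : ∀ t, χ (fibreRight κ Rel t) = prodLift x (t : TPow n C)) {i₁ i₂ : Fin n}
    (h₁₂ : x i₁ ≠ x i₂) (hκ₁₂ : (x i₁).comp κ = (x i₂).comp κ)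
    (hne : ∀ i, i ≠ i₁ → i ≠ i₂ → (x i).comp κ ≠ (x i₂).comp κ)
    (hx : ∀ i j, i ≠ i₁ → i ≠ i₂ → (x i).comp κ = (x j).comp κ → x i = x j)
    (hram : ∀ t, χ (fibreLeft κ Rel t) = 0 → ρ t ∈ RingHom.ker ((x i₂).comp κ) ^ 2) {u : B}
    (hu₀ : x i₂ (κ u) = 0)
    (hu : RingHom.ker ((x i₂).comp κ) ≤ Ideal.span {u} ⊔ RingHom.ker ((x i₂).comp κ) ^ 2) :
    ∃ g, χ g = 0 ∧ RingHom.ker χ ≤ Ideal.span {g} ⊔ RingHom.ker χ ^ 2 := by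
  classical
  have hi₁₂ : i₁ ≠ i₂ := fun h => h₁₂ (by rw [h])
  obtain ⟨M', hM'⟩ := exists_single_mem_sqIdeal x
  set M := M' + 2 with hMdef
  have hM0 : M ≠ 0 := by omega
  have hM : ∀ j : C, (∀ i, j ∈ RingHom.ker (x i) ^ M) → ∀ i, single i j ∈ sqIdeal x :=
    fun j hj => hM' j fun i => Ideal.pow_le_pow_right (by omega) (hj i)
  obtain ⟨h₁, hb₁⟩ := exists_isBump (x := x) M (i₀ := i₁) fun i hi e => by
    by_cases hi' : i = i₂
    · exact h₁₂ (by rw [← e, hi'])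
    · exact hne i hi hi' (by rw [e, hκ₁₂])
  obtain ⟨h₂, hb₂⟩ := exists_isBump (x := x) M (i₀ := i₂) fun i hi e => by
    by_cases hi' : i = i₁
    · exact h₁₂ (by rw [← e, hi'])
    · exact hne i hi' hi (by rw [e])
  have hsq : ∀ {t : TS n C}, t ∈ RingHom.ker (evalSym x) ^ 2 →
      fibreRight κ Rel t ∈ RingHom.ker χ ^ 2 := fun ht => fibreRight_mem_sq hχ ht
  -- Functions `t` on `Spec A` have no differential: if `b` is one at `p` and small at the other
  -- points of the fibre, then `tr b` has the value two, and `t * tr b = tr (ρ t * b)` is a sum of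
  -- contributions of `q'` and `q''`, at which `ρ t` vanishes to second order.
  have hleft : ∀ a, χ (fibreLeft κ Rel a) = 0 → fibreLeft κ Rel a ∈ RingHom.ker χ ^ 2 := by
    intro t ht
    obtain ⟨b, hb⟩ := exists_forall_sub_mem (Finset.univ.image fun i => (x i).comp κ) M
      fun p => if p = (x i₂).comp κ then (1 : B) else 0
    have hb1 : b - 1 ∈ RingHom.ker ((x i₂).comp κ) ^ M := by
      simpa using hb ((x i₂).comp κ) (by simp)
    have hb0 : ∀ i, i ≠ i₁ → i ≠ i₂ → b ∈ RingHom.ker ((x i).comp κ) ^ M := fun i hi hi' => by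
      simpa [hne i hi hi'] using hb ((x i).comp κ) (by simp)
    have hκmem : ∀ {i : Fin n} {k : ℕ} {b : B}, b ∈ RingHom.ker ((x i).comp κ) ^ k →
        κ b ∈ RingHom.ker (x i) ^ k := fun hb =>
      map_ker_pow_le κ _ _ (Ideal.mem_map_of_mem κ hb)
    refine mem_sq_of_mul_mem_sq (e := fibreLeft κ Rel (tr b)) ?_ ?_
    · rw [RingHom.mem_ker, fibreLeft_eq (hR b), hχ, tsMap_psum, prodLift_psum,
        ← Finset.add_sum_erase _ _ (Finset.mem_univ i₁),
        ← Finset.add_sum_erase _ _ (show i₂ ∈ Finset.univ.erase i₁ by simp [hi₁₂.symm]),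
        Finset.sum_eq_zero]
      · have e2 : x i₂ (κ b) = 1 := by
          have := Ideal.pow_le_self hM0 hb1
          rw [RingHom.mem_ker, map_sub, map_one, sub_eq_zero] at this
          exact this
        have e1 : x i₁ (κ b) = 1 := (DFunLike.congr_fun hκ₁₂ b).trans e2
        rw [e1, e2]
        norm_num
      · intro i hi
        simp only [Finset.mem_erase, Finset.mem_univ, and_true] at hi
        exact Ideal.pow_le_self hM0 (hb0 i hi.2 hi.1)
    · rw [← map_mul, mul_comm, ← htr, fibreLeft_eq (hR _), tsMap_psum]
      apply hsq
      have e : psum n (κ (ρ t * b)) = psum n (κ (ρ t) * (κ b - h₁ - h₂)) +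
          psum n (h₁ * κ (ρ t)) + psum n (h₂ * κ (ρ t)) := by
        rw [← psum_add, ← psum_add, map_mul]
        congr 1
        ring
      have hρt := hram t ht
      have hρt' : ρ t ∈ RingHom.ker ((x i₁).comp κ) ^ 2 := by rwa [hκ₁₂]
      rw [e]
      refine Ideal.add_mem _ (Ideal.add_mem _ (psum_mem_sq x (hM _ fun i => ?_))
        (hb₁.psum_mem_sq hM0 hM (hκmem hρt'))) (hb₂.psum_mem_sq hM0 hM (hκmem hρt))
      refine Ideal.mul_mem_left _ _ ?_
      by_cases hi₁ : i = i₁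
      · subst hi₁
        have h1 : κ (b - 1) ∈ RingHom.ker (x i) ^ M := hκmem (by rwa [hκ₁₂])
        rw [map_sub, map_one] at h1
        rw [show κ b - h₁ - h₂ = (κ b - 1) - (h₁ - 1) - h₂ by ring]
        exact Ideal.sub_mem _ (Ideal.sub_mem _ h1 hb₁.sub_one_mem) (hb₂.mem i hi₁₂)
      by_cases hi₂ : i = i₂
      · subst hi₂
        have h1 : κ (b - 1) ∈ RingHom.ker (x i) ^ M := hκmem hb1
        rw [map_sub, map_one] at h1
        rw [show κ b - h₁ - h₂ = (κ b - 1) - h₁ - (h₂ - 1) by ring]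
        exact Ideal.sub_mem _ (Ideal.sub_mem _ h1 (hb₁.mem i hi₁₂.symm)) hb₂.sub_one_mem
      · exact Ideal.sub_mem _ (Ideal.sub_mem _ (hκmem (hb0 i hi₁ hi₂)) (hb₁.mem i hi₁))
          (hb₂.mem i hi₂)
  set g := fibreRight κ Rel (psum n (h₂ * κ u)) with hg
  set I := Ideal.span {g} ⊔ RingHom.ker χ ^ 2 with hI
  have hsqI : ∀ {t : TS n C}, t ∈ RingHom.ker (evalSym x) ^ 2 → fibreRight κ Rel t ∈ I :=
    fun ht => Ideal.mem_sup_right (hsq ht)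
  have hg0 : χ g = 0 := by
    rw [hg, hχ]
    exact (hb₂.evalSym_psum hM0 _).trans hu₀
  have hle : I ≤ RingHom.ker χ := by
    refine sup_le ?_ (Ideal.pow_le_self two_ne_zero)
    rwa [Ideal.span_singleton_le_iff_mem, RingHom.mem_ker]
  have hbump : ∀ c, fibreRight κ Rel (psum n (h₂ * c)) - algebraMap ℂ _ (x i₂ c) ∈ I := by
    intro c
    obtain ⟨b, hb⟩ := hκ.exists_sub_mem (x i₂) 2 (c - algebraMap ℂ C (x i₂ c))
    have hb0 : b ∈ RingHom.ker ((x i₂).comp κ) := by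
      have := Ideal.pow_le_self two_ne_zero hb
      rw [RingHom.mem_ker, map_sub, map_sub, AlgHom.commutes] at this
      change x i₂ (κ b) = 0
      simpa using this
    obtain ⟨_, hd, w, hw, hdw⟩ := Submodule.mem_sup.1 (hu hb0)
    obtain ⟨d, rfl⟩ := Ideal.mem_span_singleton'.1 hd
    have hκw : κ w ∈ RingHom.ker (x i₂) ^ 2 := map_ker_pow_le κ _ _ (Ideal.mem_map_of_mem κ hw)
    have e : psum n (h₂ * c) = psum n (h₂ * (c - algebraMap ℂ C (x i₂ c) - κ b)) +
        psum n (h₂ * κ w) + psum n (h₂ * (κ u * κ d)) + x i₂ c • psum n h₂ := by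
      rw [← psum_smul, ← psum_add, ← psum_add, ← psum_add, ← hdw, Algebra.smul_def, map_add,
        map_mul]
      congr 1
      ring
    have hmul : fibreRight κ Rel (psum n (h₂ * (κ u * κ d))) ∈ I := by
      have h1 := hsqI (hb₂.psum_mul hM0 hM (κ u) (κ d))
      rw [map_sub, map_mul, ← hg] at h1
      have h2 : g * fibreRight κ Rel (psum n (h₂ * κ d)) ∈ I :=
        Ideal.mem_sup_left (Ideal.mul_mem_right _ _ (Ideal.mem_span_singleton_self g))
      simpa using Ideal.sub_mem _ h2 h1
    have hone : fibreRight κ Rel (x i₂ c • psum n h₂) - algebraMap ℂ _ (x i₂ c) ∈ I := by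
      have h1 := hsqI (hb₂.psum_sub_one hM0 hM)
      rw [map_sub, map_one] at h1
      rw [map_smul, Algebra.algebraMap_eq_smul_one, ← smul_sub, Algebra.smul_def]
      exact Ideal.mul_mem_left _ _ h1
    rw [e, map_add, map_add, map_add, add_sub_assoc]
    exact Ideal.add_mem _ (Ideal.add_mem _ (Ideal.add_mem _ (hsqI (hb₂.psum_mem_sq hM0 hM hb))
      (hsqI (hb₂.psum_mem_sq hM0 hM hκw))) hmul) hone
  -- Modulo functions on `Spec B`, whose power sums are traces, any `c` is concentrated at `q''`.
  refine ⟨g, hg0, ker_le_of_mem χ I (fun a ha => Ideal.mem_sup_right (hleft a ha)) fun c => ?_⟩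
  obtain ⟨b, hb⟩ := hκ.exists_forall_sub_mem ((Finset.univ.erase i₂).image x) (by
    intro q hq q' hq' h
    simp only [Finset.coe_image, Finset.coe_erase, Set.mem_image, Finset.coe_univ,
      Set.mem_sdiff, Set.mem_univ, true_and, Set.mem_singleton_iff] at hq hq'
    obtain ⟨i, hi, rfl⟩ := hq
    obtain ⟨j, hj, rfl⟩ := hq'
    by_cases hi' : i = i₁
    · by_cases hj' : j = i₁
      · rw [hi', hj']
      · exact (hx j i hj' hj h.symm).symm
    · exact hx i j hi' hi h) M c
  have e : psum n c = psum n ((1 - h₂) * (c - κ b)) + psum n (h₂ * (c - κ b)) + psum n (κ b) := by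
    rw [← psum_add, ← psum_add]
    congr 1
    ring
  have hm1 : psum n ((1 - h₂) * (c - κ b)) ∈ RingHom.ker (evalSym x) ^ 2 := by
    refine psum_mem_sq x (hM _ fun i => ?_)
    by_cases hi₂ : i = i₂
    · subst hi₂
      refine Ideal.mul_mem_right _ _ ?_
      rw [← neg_sub]
      exact (Ideal.neg_mem_iff _).2 hb₂.sub_one_mem
    · exact Ideal.mul_mem_left _ _ (hb _ (Finset.mem_image_of_mem _ (by simp [hi₂])))
  refine sub_algebraMap_mem hle
    (z := x i₂ (c - κ b) + χ (fibreLeft κ Rel (tr b))) ?_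
  rw [e, map_add, map_add, ← tsMap_psum, ← fibreLeft_eq (hR b), map_add]
  have e2 : ∀ p q r s t : FibreRing κ Rel, p + q + r - (s + t) = p + (q - s) + (r - t) := by
    intros; ring
  rw [e2]
  refine Ideal.add_mem _ (Ideal.add_mem _ (hsqI hm1) (hbump _)) (left_sub_mem ?_ _)
  exact Ideal.map_le_iff_le_comap.2 fun t ht => Ideal.mem_sup_right (hleft t ht)

end FibreCotangent

end SymTensor

/-! ### Local rings with principal maximal ideal -/

namespace SymTensor

section Regular

/-- A Noetherian local ring of positive dimension with principal maximal ideal is a discrete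
valuation ring. -/
lemma isDomain_and_isPrincipalIdealRing {R : Type*} [CommRing R] [IsLocalRing R]
    [IsNoetherianRing R] {g t : R} (hg : IsLocalRing.maximalIdeal R = Ideal.span {g})
    (ht : t ∈ IsLocalRing.maximalIdeal R) (hn : ¬ IsNilpotent t) :
    IsDomain R ∧ IsPrincipalIdealRing R := by
  have hgn : ∀ k, g ^ k ≠ 0 := by
    intro k hk
    rw [hg] at ht
    obtain ⟨c, rfl⟩ := Ideal.mem_span_singleton'.1 ht
    exact hn ⟨k, by rw [mul_pow, hk, mul_zero]⟩
  have hdec : ∀ r : R, r ≠ 0 → ∃ (k : ℕ) (u : R), IsUnit u ∧ r = u * g ^ k := by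
    intro r hr
    have hk : ∃ k, r ∉ IsLocalRing.maximalIdeal R ^ k := by
      by_contra! hk
      apply hr
      have := Ideal.iInf_pow_eq_bot_of_isLocalRing (IsLocalRing.maximalIdeal R)
        (IsLocalRing.maximalIdeal.isMaximal R).ne_top
      rw [← Submodule.mem_bot (R := R), ← this]
      simpa [Submodule.mem_iInf] using hk
    classical
    obtain ⟨k, hk1, hk2⟩ : ∃ k, r ∈ IsLocalRing.maximalIdeal R ^ k ∧
        r ∉ IsLocalRing.maximalIdeal R ^ (k + 1) := by
      have h0 : Nat.find hk ≠ 0 := fun h0 => by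
        have := Nat.find_spec hk
        rw [h0] at this
        exact this (by simp)
      obtain ⟨k, hk'⟩ := Nat.exists_eq_succ_of_ne_zero h0
      refine ⟨k, ?_, ?_⟩
      · by_contra h
        exact Nat.find_min hk (m := k) (by omega) h
      · have := Nat.find_spec hk
        rwa [hk'] at this
    rw [hg, Ideal.span_singleton_pow] at hk1 hk2
    obtain ⟨u, rfl⟩ := Ideal.mem_span_singleton'.1 hk1
    refine ⟨k, u, ?_, rfl⟩
    by_contra hu
    have : u ∈ IsLocalRing.maximalIdeal R := hu
    rw [hg] at this
    obtain ⟨c, rfl⟩ := Ideal.mem_span_singleton'.1 this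
    exact hk2 (Ideal.mem_span_singleton'.2 ⟨c, by ring⟩)
  have : NoZeroDivisors R := by
    refine ⟨fun {a b} hab => ?_⟩
    by_contra! h
    obtain ⟨k, u, hu, rfl⟩ := hdec a h.1
    obtain ⟨l, v, hv, rfl⟩ := hdec b h.2
    have : u * v * g ^ (k + l) = 0 := by rw [← hab]; ring
    exact hgn _ ((hu.mul hv).mul_right_eq_zero.1 this)
  have hd : IsDomain R := NoZeroDivisors.to_isDomain R
  refine ⟨hd, ?_⟩
  by_cases hf : IsField R
  · let := hf.toField
    infer_instance
  · have := IsDiscreteValuationRing.TFAE R hf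
    have h5 : (IsLocalRing.maximalIdeal R).IsPrincipal := ⟨⟨g, hg⟩⟩
    have h1 : IsDiscreteValuationRing R := (this.out 0 4).2 h5
    infer_instance

/-- Generizations of a point whose local ring is a principal ideal domain are regular. -/
lemma isRegularLocalRing_of_le {R : Type} [CommRing R] {Q P : Ideal R} [Q.IsPrime] [P.IsPrime]
    (hPQ : P ≤ Q)
    (h : IsDomain (Localization.AtPrime Q) ∧ IsPrincipalIdealRing (Localization.AtPrime Q)) :
    IsRegularLocalRing (Localization.AtPrime P) := by
  obtain ⟨h1, h2⟩ := h
  have hd : Disjoint (Q.primeCompl : Set R) P := by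
    rw [Set.disjoint_left]
    exact fun x hx hx' => hx (hPQ hx')
  let P' : Ideal (Localization.AtPrime Q) := P.map (algebraMap R _)
  have hP' : P'.IsPrime := IsLocalization.isPrime_of_isPrime_disjoint Q.primeCompl _ P ‹_› hd
  have hc : P'.comap (algebraMap R (Localization.AtPrime Q)) = P :=
    IsLocalization.under_map_of_isPrime_disjoint Q.primeCompl _ ‹_› hd
  have hr : IsRegularLocalRing (Localization.AtPrime P') := inferInstance
  have hl : IsLocalization.AtPrime (Localization.AtPrime P') P := by
    convert IsLocalization.isLocalization_isLocalization_atPrime_isLocalization Q.primeCompl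
      (Localization.AtPrime P') P'
    exact hc.symm
  exact IsRegularLocalRing.of_ringEquiv
    (IsLocalization.algEquiv P.primeCompl (Localization.AtPrime P')
      (Localization.AtPrime P)).toRingEquiv

section Points

variable {R : Type} [CommRing R] [Algebra ℂ R]

/-- At a point where the cotangent space is generated by one function, the local ring is a
principal ideal domain, if it has positive dimension. -/
lemma localization_isDomain_and_isPrincipalIdealRing [IsNoetherianRing R] {χ : R →ₐ[ℂ] ℂ} {g t : R}
    (hg₀ : χ g = 0) (hg : RingHom.ker χ ≤ Ideal.span {g} ⊔ RingHom.ker χ ^ 2) (ht : χ t = 0)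
    (hn : ∀ s, χ s ≠ 0 → ∀ k : ℕ, s * t ^ k ≠ 0) :
    IsDomain (Localization.AtPrime (RingHom.ker χ)) ∧
      IsPrincipalIdealRing (Localization.AtPrime (RingHom.ker χ)) := by
  set S := Localization.AtPrime (RingHom.ker χ)
  have hmap : IsLocalRing.maximalIdeal S = (RingHom.ker χ).map (algebraMap R S) :=
    (Localization.AtPrime.map_eq_maximalIdeal (I := RingHom.ker χ)).symm
  have : IsNoetherianRing S := IsLocalization.isNoetherianRing (RingHom.ker χ).primeCompl S ‹_›
  have h1 : IsLocalRing.maximalIdeal S = Ideal.span {algebraMap R S g} := by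
    refine le_antisymm ?_ ?_
    · refine Submodule.le_of_le_smul_of_le_jacobson_bot (I := IsLocalRing.maximalIdeal S)
        (IsNoetherian.noetherian _) (IsLocalRing.maximalIdeal_le_jacobson ⊥) ?_
      have := Ideal.map_mono (f := algebraMap R S) hg
      rw [Ideal.map_sup, Ideal.map_pow, ← hmap, Ideal.map_span, Set.image_singleton,
        pow_two] at this
      exact this
    · rw [Ideal.span_singleton_le_iff_mem, hmap]
      exact Ideal.mem_map_of_mem _ hg₀
  refine isDomain_and_isPrincipalIdealRing h1 (t := algebraMap R S t) ?_ ?_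
  · rw [hmap]
    exact Ideal.mem_map_of_mem _ ht
  · rintro ⟨k, hk⟩
    rw [← map_pow, IsLocalization.map_eq_zero_iff (RingHom.ker χ).primeCompl] at hk
    obtain ⟨⟨s, hs⟩, hk⟩ := hk
    exact hn s hs k hk

/-- A point which is not closed specializes to closed points outside any finite set. -/
lemma exists_notMem_of_not_isMaximal [Algebra.FiniteType ℂ R] {P : Ideal R} [hP : P.IsPrime]
    (hM : ¬ P.IsMaximal) {F : Set (R →ₐ[ℂ] ℂ)} (hF : F.Finite) :
    ∃ χ : R →ₐ[ℂ] ℂ, χ ∉ F ∧ P ≤ RingHom.ker χ := by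
  by_contra! h
  have : IsJacobsonRing R := isJacobsonRing_of_finiteType (A := ℂ)
  have hJ : P.jacobson = P := IsJacobsonRing.out ‹_› hP.isRadical
  have hle : (hF.toFinset.inf fun χ => RingHom.ker χ ⊔ P) ≤ P := by
    intro r hr
    rw [← hJ, Ideal.jacobson, Submodule.mem_sInf]
    rintro J ⟨hPJ, hJm⟩
    obtain ⟨χ, hχ⟩ := exists_ker_eq_of_isMaximal J
    have hχF : χ ∈ F := by
      by_contra hF
      exact h χ hF (by rwa [hχ])
    have := (Finset.inf_le (f := fun χ : R →ₐ[ℂ] ℂ => RingHom.ker χ ⊔ P)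
      (hF.mem_toFinset.2 hχF) : _ ≤ _) hr
    rwa [sup_of_le_left (by rwa [hχ]), hχ] at this
  obtain ⟨χ, -, hχ⟩ := (Ideal.IsPrime.inf_le' hP).1 hle
  have hker : RingHom.ker χ = P := by
    have h1 : RingHom.ker χ ≤ P := le_sup_left.trans hχ
    exact (ker_isMaximal χ).eq_of_le hP.ne_top h1
  exact hM (hker ▸ ker_isMaximal χ)

end Points

end Regular

end SymTensor

/-! ### Tangent vectors of the fibre product -/

namespace SymTensor

section Tangent

variable {B C : Type} [CommRing B] [Algebra ℂ B] [CommRing C] [Algebra ℂ C]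

/-- If `u` vanishes at `p`, but not to second order, then some tangent vector at `p` detects `u`. -/
lemma exists_tangent {p : B →ₐ[ℂ] ℂ} {u : B} (hu : p u = 0) (hu₂ : u ∉ RingHom.ker p ^ 2) :
    ∃ θ : B →ₐ[ℂ] DualNumber ℂ, (∀ b, (θ b).fst = p b) ∧ (θ u).snd ≠ 0 := by
  let W : Submodule ℂ B := (RingHom.ker p ^ 2).restrictScalars ℂ
  obtain ⟨l, hl, hW⟩ := Submodule.exists_le_ker_of_notMem (p := W) (v := u) hu₂
  let d : B →ₗ[ℂ] ℂ := l.comp (LinearMap.id - (Algebra.linearMap ℂ B).comp p.toLinearMap)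
  have hd : ∀ b, d b = l (b - algebraMap ℂ B (p b)) := fun b => rfl
  have hmul : ∀ a b, d (a * b) = p a * d b + p b * d a := by
    intro a b
    have h0 : ∀ c, c - algebraMap ℂ B (p c) ∈ RingHom.ker p := fun c => by simp [RingHom.mem_ker]
    have h1 : (a - algebraMap ℂ B (p a)) * (b - algebraMap ℂ B (p b)) ∈ W := by
      change _ ∈ RingHom.ker p ^ 2
      rw [pow_two]
      exact Ideal.mul_mem_mul (h0 a) (h0 b)
    have h2 : l ((a - algebraMap ℂ B (p a)) * (b - algebraMap ℂ B (p b))) = 0 := hW h1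
    rw [hd, hd, hd, ← smul_eq_mul (p a), ← smul_eq_mul (p b), ← map_smul l, ← map_smul l,
      ← map_add, ← sub_eq_zero, ← map_sub, ← h2]
    congr 1
    rw [Algebra.smul_def, Algebra.smul_def, map_mul, map_mul]
    ring
  have hone : d 1 = 0 := by rw [hd]; simp
  refine ⟨AlgHom.ofLinearMap (LinearMap.prod p.toLinearMap d : B →ₗ[ℂ] ℂ × ℂ)
    ?_ ?_, fun b => rfl, ?_⟩
  · refine TrivSqZeroExt.ext ?_ ?_
    · exact map_one p
    · exact hone
  · intro a b
    refine TrivSqZeroExt.ext ?_ ?_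
    · exact map_mul p a b
    · exact (hmul a b).trans (congrArg (p a * d b + ·) (mul_comm _ _))
  · have : d u ≠ 0 := by rw [hd, hu]; simpa using hl
    exact this

/-- Tangent vectors lift along étale morphisms. -/
lemma exists_lift_tangent {κ : B →ₐ[ℂ] C} (hκ : κ.toRingHom.FormallyEtale) {q : C →ₐ[ℂ] ℂ}
    {θ : B →ₐ[ℂ] DualNumber ℂ} (hθ : ∀ b, (θ b).fst = q (κ b)) :
    ∃ Θ : C →ₐ[ℂ] DualNumber ℂ, (∀ c, (Θ c).fst = q c) ∧ ∀ b, Θ (κ b) = θ b := by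
  let _ := κ.toRingHom.toAlgebra
  let _ := θ.toRingHom.toAlgebra
  let _ := (q.comp κ).toRingHom.toAlgebra
  have : Algebra.FormallyEtale B C := hκ
  let f : DualNumber ℂ →ₐ[B] ℂ := ⟨TrivSqZeroExt.fstHom ℂ ℂ ℂ, hθ⟩
  let g : C →ₐ[B] ℂ := ⟨q.toRingHom, fun b => rfl⟩
  have hf : Function.Surjective f := fun z => ⟨TrivSqZeroExt.inl z, rfl⟩
  have hn : IsNilpotent (RingHom.ker f) := ⟨2, TrivSqZeroExt.kerIdeal_sq ℂ ℂ⟩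
  let Θ := Algebra.FormallySmooth.liftOfSurjective g f hf hn
  have h1 : ∀ b, Θ (κ b) = θ b := Θ.commutes
  have h2 : ∀ c, (Θ c).fst = q c := Algebra.FormallySmooth.liftOfSurjective_apply g f hf hn
  exact ⟨⟨Θ, fun z => by
    change Θ (algebraMap ℂ C z) = _
    rw [← κ.commutes, h1, θ.commutes]⟩, h2, h1⟩

lemma snd_eq_zero_of_mem_sq {q : C →ₐ[ℂ] ℂ} {Θ : C →ₐ[ℂ] DualNumber ℂ}
    (hΘ : ∀ c, (Θ c).fst = q c) {c : C} (hc : c ∈ RingHom.ker q ^ 2) : (Θ c).snd = 0 := by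
  rw [pow_two] at hc
  induction hc using Submodule.mul_induction_on' with
  | mem_mul_mem a ha b hb =>
    rw [RingHom.mem_ker] at ha hb
    simp [hΘ, ha, hb]
  | add a _ b _ ha hb => rw [map_add, TrivSqZeroExt.snd_add, ha, hb, add_zero]

variable {R : Type} [CommRing R] [Algebra ℂ R]

/-- A point of height at most one with two linearly independent tangent vectors is singular: if it
were regular, its maximal ideal would be principal, and all tangent vectors would be proportional.
-/
lemma not_isRegularLocalRing_of_tangent {χ : R →ₐ[ℂ] ℂ} {δ δ' : R →ₐ[ℂ] DualNumber ℂ}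
    (hδ : ∀ r, (δ r).fst = χ r) (hδ' : ∀ r, (δ' r).fst = χ r) {r r' : R} (hr : χ r = 0)
    (hr' : χ r' = 0) (h₁ : (δ r).snd ≠ 0) (h₂ : (δ' r).snd = 0)
    (h₃ : (δ' r').snd ≠ 0) (hdim : (RingHom.ker χ).height ≤ 1) :
    ¬ IsRegularLocalRing (Localization.AtPrime (RingHom.ker χ)) := by
  intro hreg
  set S := Localization.AtPrime (RingHom.ker χ)
  have hmap : IsLocalRing.maximalIdeal S = (RingHom.ker χ).map (algebraMap R S) :=
    (Localization.AtPrime.map_eq_maximalIdeal (I := RingHom.ker χ)).symm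
  have hp : (IsLocalRing.maximalIdeal S).IsPrincipal := by
    have h := hreg.spanFinrank_maximalIdeal
    rw [IsLocalization.AtPrime.ringKrullDim_eq_height (RingHom.ker χ) S] at h
    have h' : (((IsLocalRing.maximalIdeal S).spanFinrank : ℕ∞) : WithBot ℕ∞) ≤
        ((1 : ℕ∞) : WithBot ℕ∞) := by
      refine le_trans (le_of_eq h) ?_
      exact_mod_cast hdim
    have h'' : (IsLocalRing.maximalIdeal S).spanFinrank ≤ 1 := by exact_mod_cast h'
    rcases Nat.le_one_iff_eq_zero_or_eq_one.1 h'' with h0 | h1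
    · have : IsLocalRing.maximalIdeal S = ⊥ :=
        (Submodule.spanFinrank_eq_zero_iff_eq_bot (IsNoetherian.noetherian _)).1 h0
      rw [this]
      infer_instance
    · exact ((Submodule.spanFinrank_eq_one_iff _).1 h1).1
  obtain ⟨w, hw⟩ := hp
  -- both tangent vectors extend to the local ring, where they are determined by their values at the
  -- generator `w` of the maximal ideal
  have hlift : ∀ δ : R →ₐ[ℂ] DualNumber ℂ, (∀ r, (δ r).fst = χ r) →
      ∃ Δ : S →+* DualNumber ℂ, ∀ r, Δ (algebraMap R S r) = δ r := by
    intro δ hδ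
    refine ⟨IsLocalization.lift (M := (RingHom.ker χ).primeCompl) (g := δ.toRingHom) ?_, ?_⟩
    · rintro ⟨s, hs⟩
      rw [TrivSqZeroExt.isUnit_iff_isUnit_fst]
      refine isUnit_iff_ne_zero.2 ?_
      rw [AlgHom.toRingHom_eq_coe, RingHom.coe_coe, hδ]
      exact hs
    · intro r
      exact IsLocalization.lift_eq _ r
  obtain ⟨Δ, hΔ⟩ := hlift δ hδ
  obtain ⟨Δ', hΔ'⟩ := hlift δ' hδ'
  have hfst : (TrivSqZeroExt.fstHom ℂ ℂ ℂ).toRingHom.comp Δ =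
      (TrivSqZeroExt.fstHom ℂ ℂ ℂ).toRingHom.comp Δ' := by
    refine IsLocalization.ringHom_ext (RingHom.ker χ).primeCompl (RingHom.ext fun r => ?_)
    simp [hΔ, hΔ', hδ, hδ']
  have hm : ∀ z ∈ IsLocalRing.maximalIdeal S, (Δ z).fst = 0 := by
    intro z hz
    have : IsLocalRing.maximalIdeal S ≤
        RingHom.ker ((TrivSqZeroExt.fstHom ℂ ℂ ℂ).toRingHom.comp Δ) := by
      rw [hmap, Ideal.map_le_iff_le_comap]
      intro r hr
      simp only [Ideal.mem_comap, RingHom.mem_ker, RingHom.comp_apply, hΔ]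
      exact (hδ r).trans hr
    exact this hz
  have hm' : ∀ z ∈ IsLocalRing.maximalIdeal S, (Δ' z).fst = 0 := fun z hz =>
    (RingHom.congr_fun hfst z).symm.trans (hm z hz)
  have hwm : w ∈ IsLocalRing.maximalIdeal S := by
    rw [hw]; exact Ideal.mem_span_singleton_self w
  have hmul : ∀ r, χ r = 0 → ∃ d, (δ r).snd = (Δ d).fst * (Δ w).snd ∧
      (δ' r).snd = (Δ d).fst * (Δ' w).snd := by
    intro r hr
    have : algebraMap R S r ∈ IsLocalRing.maximalIdeal S := by
      rw [hmap]; exact Ideal.mem_map_of_mem _ hr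
    rw [hw] at this
    obtain ⟨d, hd⟩ := Ideal.mem_span_singleton'.1 this
    have hf : (Δ d).fst = (Δ' d).fst := RingHom.congr_fun hfst d
    refine ⟨d, ?_, ?_⟩
    · rw [← hΔ, ← hd, map_mul, TrivSqZeroExt.snd_mul, hm w hwm]
      simp
    · rw [← hΔ', ← hd, map_mul, TrivSqZeroExt.snd_mul, hm' w hwm, hf]
      simp
  obtain ⟨d, hd₁, hd₂⟩ := hmul r hr
  obtain ⟨d', hd₁', hd₂'⟩ := hmul r' hr'
  rw [hd₁] at h₁
  rw [h₂] at hd₂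
  rw [hd₂'] at h₃
  rcases mul_eq_zero.1 hd₂.symm with h | h
  · exact h₁ (by rw [h, zero_mul])
  · exact h₃ (by rw [h, mul_zero])

end Tangent

section FibreTangent

variable {n : ℕ} {A B C : Type} [CommRing A] [Algebra ℂ A] [CommRing B] [Algebra ℂ B]
  [CommRing C] [Algebra ℂ C] {κ : B →ₐ[ℂ] C} {tr : B → A}

/-- Points of the fibre product over a point of `Spec A` are divisors lifting the fibre, so there
are finitely many of them. -/
lemma finite_setOf_comp_left_eq (hκ : IsDoubleCover κ) (y : A →ₐ[ℂ] ℂ) :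
    {χ : FibreRing (n := n) κ (TraceRel tr) →ₐ[ℂ] ℂ | χ.comp (fibreLeft κ _) = y}.Finite := by
  classical
  rcases Set.eq_empty_or_nonempty
    {χ : FibreRing (n := n) κ (TraceRel tr) →ₐ[ℂ] ℂ | χ.comp (fibreLeft κ _) = y} with he | ⟨χ₀, h₀⟩
  · rw [he]; exact Set.finite_empty
  obtain ⟨x, -, hx⟩ := exists_point_eq (traceRel_psum tr) χ₀
  rw [h₀] at hx
  let Q : Set (C →ₐ[ℂ] ℂ) := {q | ∃ i, q.comp κ = (x i).comp κ}
  have hQ : Q.Finite := by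
    have : Q = ⋃ i, {q | q.comp κ = (x i).comp κ} := by ext; simp [Q]
    rw [this]
    refine Set.finite_iUnion fun i => ?_
    obtain ⟨q, q', -, h, -⟩ := hκ ((x i).comp κ)
    have : {r : C →ₐ[ℂ] ℂ | r.comp κ = (x i).comp κ} = {q, q'} := by ext r; simp [h]
    rw [this]
    exact Set.toFinite _
  -- a point over `y` is determined by an enumeration of its divisor
  have hpi := Set.Finite.pi' (fun _ : Fin n => hQ)
  refine Set.Finite.subset (hpi.image fun x' => if h : ∃ χ :
    FibreRing (n := n) κ (TraceRel tr) →ₐ[ℂ] ℂ, χ.comp (fibreLeft κ _) = y ∧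
      ∀ t, χ (fibreRight κ _ t) = prodLift x' (t : TPow n C) then h.choose else χ₀) ?_
  intro χ hχ
  obtain ⟨x', hx', htr⟩ := exists_point_eq (traceRel_psum tr) χ
  rw [hχ] at htr
  refine ⟨x', fun i => ?_, ?_⟩
  · have hD : Finset.univ.val.map (fun i => (x i).comp κ) =
        Finset.univ.val.map (fun i => (x' i).comp κ) := by
      refine multiset_eq_of_sum_eq fun b => ?_
      rw [Multiset.map_map, Multiset.map_map]
      exact (hx b).trans (htr b).symm
    obtain ⟨σ, hσ⟩ := exists_perm_of_map_eq hD
    exact ⟨σ.symm i, by rw [← hσ]; simp⟩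
  · have h : ∃ χ : FibreRing (n := n) κ (TraceRel tr) →ₐ[ℂ] ℂ, χ.comp (fibreLeft κ _) = y ∧
      ∀ t, χ (fibreRight κ _ t) = prodLift x' (t : TPow n C) := ⟨χ, hχ, hx'⟩
    simp only [dif_pos h]
    refine fibreAlgHom_ext (fun a => ?_) fun c => ?_
    · exact (DFunLike.congr_fun h.choose_spec.1 a).trans (DFunLike.congr_fun hχ a).symm
    · rw [h.choose_spec.2, hx']

variable {χ : FibreRing (n := n) κ (TraceRel tr) →ₐ[ℂ] ℂ} {x : Fin n → (C →ₐ[ℂ] ℂ)}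

/-- If `t` generates the ideal of a point of `Spec A` locally, then the points of the fibre product
over this point are isolated in the zero locus of `t`, because there are finitely many of them. By
Krull's principal ideal theorem they have height at most one. -/
lemma height_ker_le_one [Algebra.FiniteType ℂ A] [Algebra.FiniteType ℂ C] (hκ : IsDoubleCover κ)
    {t : A} (ht : χ (fibreLeft κ _ t) = 0)
    (hts : ∀ a, χ (fibreLeft κ _ a) = 0 → ∃ s, χ (fibreLeft κ _ s) ≠ 0 ∧ s * a ∈ Ideal.span {t}) :
    (RingHom.ker χ).height ≤ 1 := by
  have : IsNoetherianRing (FibreRing (n := n) κ (TraceRel tr)) :=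
    Algebra.FiniteType.isNoetherianRing ℂ _
  refine Ideal.height_le_one_of_isPrincipal_of_mem_minimalPrimes
    (Ideal.span {fibreLeft κ _ t}) _ ⟨⟨inferInstance, ?_⟩, ?_⟩
  · rwa [Ideal.span_singleton_le_iff_mem]
  · rintro P ⟨hP, htP⟩ hPχ
    rw [Ideal.span_singleton_le_iff_mem] at htP
    by_cases hM : P.IsMaximal
    · exact (hM.eq_of_le (ker_isMaximal χ).ne_top hPχ).ge
    · exfalso
      obtain ⟨χ', hχ', hle⟩ := exists_notMem_of_not_isMaximal hM
        (finite_setOf_comp_left_eq (n := n) (tr := tr) hκ (χ.comp (fibreLeft κ _)))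
      refine hχ' ?_
      refine (algHom_eq_of_ker_le fun a ha => ?_).symm
      refine hle ?_
      obtain ⟨s, hs, hsa⟩ := hts a ha
      obtain ⟨d, hd⟩ := Ideal.mem_span_singleton'.1 hsa
      have h2 : fibreLeft κ (TraceRel (n := n) tr) s * fibreLeft κ _ a ∈ P := by
        rw [← map_mul, ← hd, map_mul]
        exact P.mul_mem_left _ htP
      refine (hP.mem_or_mem h2).resolve_left fun h => hs (hPχ h)

/-- At a divisor which contains two distinct points with the same image `p`, moving one of them
along a tangent vector and the other one along the opposite tangent vector does not change the
traces of functions on `Spec B`, to first order. This gives a tangent vector of the fibre product.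
-/
lemma exists_pair_tangent (hκ : κ.toRingHom.FormallyEtale)
    (hχ : ∀ t, χ (fibreRight κ _ t) = prodLift x (t : TPow n C)) {i₁ i₂ : Fin n}
    (h₁₂ : x i₁ ≠ x i₂) (hκ₁₂ : (x i₁).comp κ = (x i₂).comp κ) {u : B}
    (hu : x i₁ (κ u) = 0) (hu₂ : u ∉ RingHom.ker ((x i₁).comp κ) ^ 2) :
    ∃ (δ : FibreRing (n := n) κ (TraceRel tr) →ₐ[ℂ] DualNumber ℂ) (Θ₁ Θ₂ : C →ₐ[ℂ] DualNumber ℂ),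
      (∀ r, (δ r).fst = χ r) ∧ (∀ c, (Θ₁ c).fst = x i₁ c) ∧ (∀ c, (Θ₂ c).fst = x i₂ c) ∧
      (Θ₁ (κ u)).snd ≠ 0 ∧
      ∀ c, (δ (fibreRight κ _ (psum n c))).snd = (Θ₁ c).snd + (Θ₂ c).snd := by
  classical
  obtain ⟨θ, hθ, hθu⟩ := exists_tangent (p := (x i₁).comp κ) hu hu₂
  obtain ⟨Θ₁, hΘ₁, hΘ₁κ⟩ := exists_lift_tangent hκ hθ
  -- the opposite tangent vector
  let ν : DualNumber ℂ →ₐ[ℂ] DualNumber ℂ := TrivSqZeroExt.map (-LinearMap.id)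
  obtain ⟨Θ₂, hΘ₂, hΘ₂κ⟩ := exists_lift_tangent (q := x i₂) (θ := ν.comp θ) hκ fun b => by
    rw [AlgHom.comp_apply, TrivSqZeroExt.fst_map, hθ, hκ₁₂]
    rfl
  have hi₁₂ : i₂ ∈ Finset.univ.erase i₁ := by simp; rintro rfl; exact h₁₂ rfl
  let x' : Fin n → (C →ₐ[ℂ] DualNumber ℂ) := fun i =>
    if i = i₁ then Θ₁ else if i = i₂ then Θ₂ else (Algebra.ofId ℂ (DualNumber ℂ)).comp (x i)
  have hx'fst : ∀ i c, (x' i c).fst = x i c := by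
    intro i c
    by_cases h₁ : i = i₁
    · subst h₁; simp [x', hΘ₁]
    by_cases h₂ : i = i₂
    · subst h₂; simp [x', h₁, hΘ₂]
    · simp only [x', if_neg h₁, if_neg h₂]
      rfl
  have hx'snd : ∀ c, (∑ i, x' i c).snd = (Θ₁ c).snd + (Θ₂ c).snd := by
    intro c
    rw [← Finset.add_sum_erase _ _ (Finset.mem_univ i₁), ← Finset.add_sum_erase _ _ hi₁₂,
      TrivSqZeroExt.snd_add, TrivSqZeroExt.snd_add, TrivSqZeroExt.snd_sum, Finset.sum_eq_zero,
      add_zero]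
    · simp only [x', if_pos, if_neg (Finset.ne_of_mem_erase hi₁₂)]
    · intro i hi
      simp only [Finset.mem_erase, Finset.mem_univ, and_true] at hi
      simp only [x', if_neg hi.1, if_neg hi.2]
      rfl
  set y := χ.comp (fibreLeft κ (TraceRel (n := n) tr)) with hy
  have hfib : IsTraceFibre tr y fun i => (x i).comp κ := by
    intro b
    have := hχ (tsMap κ (psum n b))
    rw [← fibreLeft_eq (traceRel_psum tr b), tsMap_psum, prodLift_psum] at this
    exact this.symm
  have hfib' : IsTraceFibre tr ((Algebra.ofId ℂ (DualNumber ℂ)).comp y)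
      fun i => (x' i).comp κ := by
    intro b
    refine TrivSqZeroExt.ext ?_ ?_
    · rw [TrivSqZeroExt.fst_sum]
      simp only [AlgHom.comp_apply, hx'fst]
      exact hfib b
    · refine (hx'snd (κ b)).trans ?_
      rw [hΘ₁κ, hΘ₂κ, AlgHom.comp_apply, TrivSqZeroExt.snd_map]
      simp only [LinearMap.neg_apply, LinearMap.id_apply, add_neg_cancel]
      rfl
  let δ : FibreRing (n := n) κ (TraceRel tr) →ₐ[ℂ] DualNumber ℂ :=
    fibreLift κ _ ((Algebra.ofId ℂ (DualNumber ℂ)).comp y) ((prodLift x').comp (TS n C).val) (by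
      intro a f haf
      refine (haf.eq_prodLift_of_const hfib hfib').trans ?_
      exact (prodLift_tmap κ x' (f : TPow n B)).symm)
  have hδl : ∀ a, δ (fibreLeft κ _ a) = Algebra.ofId ℂ (DualNumber ℂ) (y a) := fun a =>
    fibreLift_left _ _ _ a
  have hδr : ∀ c, δ (fibreRight κ _ (psum n c)) = ∑ i, x' i c := fun c =>
    (fibreLift_right _ _ _ (psum n c)).trans (prodLift_psum x' c)
  refine ⟨δ, Θ₁, Θ₂, fun r => ?_, hΘ₁, hΘ₂, by rwa [hΘ₁κ], fun c => by rw [hδr, hx'snd]⟩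
  have : (TrivSqZeroExt.fstHom ℂ ℂ ℂ).comp δ = χ := by
    refine fibreAlgHom_ext (fun a => ?_) fun c => ?_
    · rw [AlgHom.comp_apply, hδl]
      rfl
    · rw [AlgHom.comp_apply, hδr, map_sum, hχ, prodLift_psum]
      exact Finset.sum_congr rfl fun i _ => hx'fst i c
  exact DFunLike.congr_fun this r

/-- At a divisor which contains both preimages of two different points, the fibre product has two
independent tangent vectors: each of them moves the two preimages of one point oppositely. -/
lemma not_isRegularLocalRing_of_two_pairs (hκ : κ.toRingHom.FormallyEtale)
    (hχ : ∀ t, χ (fibreRight κ _ t) = prodLift x (t : TPow n C)) {i₁ i₂ j₁ j₂ : Fin n}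
    (hi : x i₁ ≠ x i₂) (hκi : (x i₁).comp κ = (x i₂).comp κ)
    (hj : x j₁ ≠ x j₂) (hκj : (x j₁).comp κ = (x j₂).comp κ)
    (hij : (x i₁).comp κ ≠ (x j₁).comp κ) {u v : B}
    (hu : x i₁ (κ u) = 0) (hu₂ : u ∉ RingHom.ker ((x i₁).comp κ) ^ 2)
    (hv : x j₁ (κ v) = 0) (hv₂ : v ∉ RingHom.ker ((x j₁).comp κ) ^ 2)
    (hdim : (RingHom.ker χ).height ≤ 1) :
    ¬ IsRegularLocalRing (Localization.AtPrime (RingHom.ker χ)) := by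
  classical
  obtain ⟨δ, Θ₁, Θ₂, hδ, hΘ₁, hΘ₂, hΘu, hδr⟩ := exists_pair_tangent hκ hχ hi hκi hu hu₂
  obtain ⟨δ', Θ₁', Θ₂', hδ', hΘ₁', hΘ₂', hΘv, hδr'⟩ := exists_pair_tangent hκ hχ hj hκj hv hv₂
  have hi₁j₂ : x i₁ ≠ x j₂ := fun h => hij (by rw [h, hκj])
  have hi₁j₁ : x i₁ ≠ x j₁ := fun h => hij (by rw [h])
  -- a function which vanishes to second order at all points of the divisor except `x i`
  have key : ∀ (i : Fin n) (w : C), x i w = 0 → ∃ c, (∀ k, x k c = 0) ∧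
      (∀ k, x i ≠ x k → c ∈ RingHom.ker (x k) ^ 2) ∧ c - w ∈ RingHom.ker (x i) ^ 2 := by
    intro i w hw
    obtain ⟨c, hc⟩ := exists_forall_sub_mem (Finset.univ.image x) 2
      fun q => if x i = q then w else 0
    have h1 : c - w ∈ RingHom.ker (x i) ^ 2 := by simpa using hc (x i) (by simp)
    have h2 : ∀ k, x i ≠ x k → c ∈ RingHom.ker (x k) ^ 2 := fun k hk => by
      simpa [hk] using hc (x k) (by simp)
    refine ⟨c, fun k => ?_, h2, h1⟩
    by_cases hk : x i = x k
    · have := Ideal.pow_le_self two_ne_zero h1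
      rwa [RingHom.mem_ker, map_sub, hw, sub_zero, hk] at this
    · exact Ideal.pow_le_self two_ne_zero (h2 k hk)
  have hsub : ∀ {q : C →ₐ[ℂ] ℂ} {Θ : C →ₐ[ℂ] DualNumber ℂ}, (∀ c, (Θ c).fst = q c) → ∀ {c w : C},
      c - w ∈ RingHom.ker q ^ 2 → (Θ c).snd = (Θ w).snd := by
    intro q Θ hΘ c w h
    have := snd_eq_zero_of_mem_sq hΘ h
    rwa [map_sub, TrivSqZeroExt.snd_sub, sub_eq_zero] at this
  obtain ⟨c, hc₀, hc, hcu⟩ := key i₁ (κ u) hu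
  obtain ⟨d, hd₀, hd, hdv⟩ := key j₁ (κ v) hv
  have hzero : ∀ c, (∀ k, x k c = 0) → χ (fibreRight κ _ (psum n c)) = 0 := fun c h => by
    rw [hχ, prodLift_psum]
    exact Finset.sum_eq_zero fun k _ => h k
  refine not_isRegularLocalRing_of_tangent hδ hδ' (hzero c hc₀) (hzero d hd₀) ?_ ?_ ?_ hdim
  · rw [hδr, snd_eq_zero_of_mem_sq hΘ₂ (hc i₂ hi), add_zero, hsub hΘ₁ hcu]
    exact hΘu
  · rw [hδr', snd_eq_zero_of_mem_sq hΘ₁' (hc j₁ hi₁j₁), snd_eq_zero_of_mem_sq hΘ₂' (hc j₂ hi₁j₂),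
      add_zero]
  · rw [hδr', snd_eq_zero_of_mem_sq hΘ₂' (hd j₂ hj), add_zero, hsub hΘ₁' hdv]
    exact hΘv

end FibreTangent

end SymTensor

/-! ### Traces and fibres with multiplicities -/

namespace SymTensor

section Trace

lemma trace_pi {k ι : Type*} [Field k] [Fintype ι] (E : ι → Type*) [∀ i, CommRing (E i)]
    [∀ i, Algebra k (E i)] [∀ i, Module.Finite k (E i)] (e : ∀ i, E i) :
    Algebra.trace k (∀ i, E i) e = ∑ i, Algebra.trace k (E i) (e i) := by
  classical
  let b := fun i => Module.Free.chooseBasis k (E i)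
  rw [Algebra.trace_eq_matrix_trace (Pi.basis b)]
  simp only [Algebra.trace_eq_matrix_trace (b _), Matrix.trace, Fintype.sum_sigma]
  refine Finset.sum_congr rfl fun i _ => Finset.sum_congr rfl fun j _ => ?_
  simp [Algebra.leftMulMatrix_eq_repr_mul, Pi.basis_repr]

variable {k E : Type*} [Field k] [CommRing E] [Algebra k E] [Module.Finite k E]

lemma trace_eq_sum_trace_localization [Fintype (PrimeSpectrum E)] (e : E) :
    Algebra.trace k E e = ∑ p : PrimeSpectrum E,
      Algebra.trace k (Localization.AtPrime p.asIdeal) (algebraMap E _ e) := by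
  have : IsArtinianRing E := IsArtinianRing.of_finite k E
  have (p : Ideal E) [p.IsPrime] : Module.Finite k (Localization.AtPrime p) :=
    Module.Finite.of_surjective (Algebra.algHom k E (Localization.AtPrime p)).toLinearMap
      (IsArtinianRing.localization_surjective p.primeCompl (Localization.AtPrime p))
  rw [← trace_pi (k := k) (fun p : PrimeSpectrum E => Localization.AtPrime p.asIdeal)]
  exact (Algebra.trace_eq_of_algEquiv
    ((PrimeSpectrum.toPiLocalizationEquiv (R := E)).restrictScalars k) e).symm

/-- The trace of a finite algebra over an algebraically closed field is the sum of its points, with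
the multiplicities given by the dimensions of the local rings. -/
lemma exists_trace_eq_sum [IsAlgClosed k] [Fintype (PrimeSpectrum E)] :
    ∃ ψ : PrimeSpectrum E → (E →ₐ[k] k), (∀ p, RingHom.ker (ψ p) = p.asIdeal) ∧
      ∀ e, Algebra.trace k E e =
        ∑ p : PrimeSpectrum E, Module.finrank k (Localization.AtPrime p.asIdeal) • ψ p e := by
  have : IsArtinianRing E := IsArtinianRing.of_finite k E
  have (p : Ideal E) [p.IsPrime] : Module.Finite k (Localization.AtPrime p) :=
    Module.Finite.of_surjective (Algebra.algHom k E (Localization.AtPrime p)).toLinearMap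
      (IsArtinianRing.localization_surjective p.primeCompl (Localization.AtPrime p))
  have hψ : ∀ p : PrimeSpectrum E, ∃ ψ : E →ₐ[k] k, RingHom.ker ψ = p.asIdeal := by
    intro p
    have : p.asIdeal.IsMaximal := IsArtinianRing.isMaximal_of_isPrime p.asIdeal
    let _ : Field (E ⧸ p.asIdeal) := Ideal.Quotient.field p.asIdeal
    have hb : Function.Bijective (Algebra.ofId k (E ⧸ p.asIdeal)) :=
      IsAlgClosed.algebraMap_bijective_of_isIntegral (k := k) (K := E ⧸ p.asIdeal)
    let e := AlgEquiv.ofBijective _ hb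
    refine ⟨e.symm.toAlgHom.comp (Ideal.Quotient.mkₐ k p.asIdeal), ?_⟩
    ext a
    simp [RingHom.mem_ker, Ideal.Quotient.eq_zero_iff_mem]
  choose ψ hψ using hψ
  refine ⟨ψ, hψ, fun e => ?_⟩
  rw [trace_eq_sum_trace_localization e]
  refine Finset.sum_congr rfl fun p _ => ?_
  have hnil : IsNilpotent (algebraMap E (Localization.AtPrime p.asIdeal)
      (e - algebraMap k E (ψ p e))) := by
    have h1 : e - algebraMap k E (ψ p e) ∈ p.asIdeal := by
      rw [← hψ]; simp [RingHom.mem_ker]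
    have h2 : algebraMap E (Localization.AtPrime p.asIdeal) (e - algebraMap k E (ψ p e)) ∈
        IsLocalRing.maximalIdeal (Localization.AtPrime p.asIdeal) :=
      (IsLocalization.AtPrime.to_map_mem_maximal_iff _ p.asIdeal _).2 h1
    have : IsArtinianRing (Localization.AtPrime p.asIdeal) := IsArtinianRing.of_finite k _
    obtain ⟨m, hm⟩ := IsArtinianRing.isNilpotent_jacobson_bot
      (R := Localization.AtPrime p.asIdeal)
    rw [IsLocalRing.jacobson_eq_maximalIdeal _ bot_ne_top] at hm
    exact ⟨m, by
      have := Ideal.pow_mem_pow h2 m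
      rwa [hm] at this⟩
  have hz := Algebra.isNilpotent_trace_of_isNilpotent (R := k) hnil
  rw [isNilpotent_iff_eq_zero, map_sub, map_sub, sub_eq_zero] at hz
  rw [hz, ← IsScalarTower.algebraMap_apply k E, Algebra.trace_algebraMap]

end Trace

lemma trace_tmul {A B : Type*} [CommRing A] [CommRing B] [Algebra A B] [Module.Free A B]
    [Module.Finite A B] (K : Type*) [CommRing K] [Algebra A K] (b : B) :
    Algebra.trace K (K ⊗[A] B) (1 ⊗ₜ[A] b) = algebraMap A K (Algebra.trace A B b) := by
  have : Algebra.lmul K (K ⊗[A] B) (1 ⊗ₜ[A] b) = (Algebra.lmul A B b).baseChange K := by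
    ext z
    change (1 ⊗ₜ[A] b : K ⊗[A] B) * (1 ⊗ₜ[A] z) = 1 ⊗ₜ[A] (b * z)
    rw [Algebra.TensorProduct.tmul_mul_tmul, one_mul]
  rw [Algebra.trace_apply, this, LinearMap.trace_baseChange, Algebra.trace_apply]

lemma trace_quotient_map {A B : Type*} [CommRing A] [CommRing B] [Algebra A B] [Module.Free A B]
    [Module.Finite A B] (I : Ideal A) (b : B) :
    Algebra.trace (A ⧸ I) (B ⧸ I.map (algebraMap A B)) (Ideal.Quotient.mk _ b) =
      Ideal.Quotient.mk I (Algebra.trace A B b) := by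
  rw [← Algebra.trace_eq_of_algEquiv (Algebra.TensorProduct.quotIdealMapEquivQuotTensor B I),
    Algebra.TensorProduct.quotIdealMapEquivQuotTensor_mk, trace_tmul]
  rfl

section Fibre

variable {n : ℕ} {A B : Type} [CommRing A] [Algebra ℂ A] [CommRing B] [Algebra ℂ B] [Algebra A B]

/-- Enumeration of a finite set with multiplicities. -/
lemma exists_enumeration {ι : Type*} [Fintype ι] (m : ι → ℕ) (h : ∑ p, m p = n) :
    ∃ σ : Fin n → ι, ∀ {M : Type} [AddCommMonoid M] (g : ι → M),
      ∑ i, g (σ i) = ∑ p, m p • g p := by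
  have e : Fin n ≃ Σ p, Fin (m p) := (Fintype.equivFinOfCardEq (by simp [h])).symm
  refine ⟨fun i => (e i).1, fun g => ?_⟩
  rw [Fintype.sum_equiv e (fun i => g (e i).1) (fun z => g z.1) fun _ => rfl, Fintype.sum_sigma]
  simp

/-- The dimension of a local ring of the fibre over `y` is the ramification index: both are the
length of the quotient of the local ring of `B` at `q` by the ideal of `y`. -/
lemma finrank_eq_ramificationIdx (y : A →ₐ[ℂ] ℂ) (q : B →ₐ[ℂ] ℂ)
    (hq : ∀ a, q (algebraMap A B a) = y a)
    (p : Ideal (B ⧸ (RingHom.ker y).map (algebraMap A B))) [p.IsPrime]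
    (hp : p.comap (Ideal.Quotient.mk _) = RingHom.ker q)
    [Module.Finite ℂ (Localization.AtPrime p)] :
    Module.finrank ℂ (Localization.AtPrime p) = (RingHom.ker q).ramificationIdx A := by
  let E := B ⧸ (RingHom.ker y).map (algebraMap A B)
  let S := Localization.AtPrime (RingHom.ker q)
  let T := S ⧸ ((RingHom.ker y).map (algebraMap A B)).map (algebraMap B S)
  have hunder : (RingHom.ker q).under A = RingHom.ker y := by
    ext a
    simp [Ideal.under, RingHom.mem_ker, hq]
  have hlies : p.LiesOver (RingHom.ker q) := ⟨hp.symm⟩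
  have hsub : Algebra.algebraMapSubmonoid E (RingHom.ker q).primeCompl = p.primeCompl :=
    Ideal.algebraMapSubmonoid_primeCompl_of_liesOver_surjective p (RingHom.ker q)
      Ideal.Quotient.mk_surjective
  have hloc : IsLocalization p.primeCompl T := by
    rw [← hsub]; infer_instance
  let e : Localization.AtPrime p ≃ₐ[E] T := IsLocalization.algEquiv p.primeCompl _ _
  have : IsScalarTower ℂ E T := IsScalarTower.of_algebraMap_eq fun z => rfl
  let e' := (e.restrictScalars ℂ).toLinearEquiv
  have : Module.Finite ℂ T := Module.Finite.equiv e'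
  have hS : Module.length (IsLocalRing.ResidueField ℂ) (IsLocalRing.ResidueField S) = 1 := by
    have hs : Function.Surjective (algebraMap (IsLocalRing.ResidueField ℂ)
        (IsLocalRing.ResidueField S)) := by
      intro w
      obtain ⟨z, rfl⟩ := IsLocalRing.residue_surjective w
      obtain ⟨⟨b, s⟩, hz⟩ := IsLocalization.surj (RingHom.ker q).primeCompl z
      have hs : q s.1 ≠ 0 := s.2
      refine ⟨IsLocalRing.residue ℂ (q b / q s.1), ?_⟩
      rw [IsLocalRing.ResidueField.algebraMap_residue, ← sub_eq_zero, ← map_sub,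
        IsLocalRing.residue_eq_zero_iff]
      have h1 : algebraMap B S s.1 * (algebraMap ℂ S (q b / q s.1) - z) ∈
          IsLocalRing.maximalIdeal S := by
        rw [mul_sub, mul_comm _ z, hz, IsScalarTower.algebraMap_apply ℂ B S, ← map_mul, ← map_sub,
          IsLocalization.AtPrime.to_map_mem_maximal_iff S (RingHom.ker q), RingHom.mem_ker, map_sub,
          map_mul, AlgHom.commutes]
        change q s.1 * (q b / q s.1) - q b = 0
        rw [mul_div_cancel₀ _ hs, sub_self]
      refine ((IsLocalRing.maximalIdeal.isMaximal S).isPrime.mem_or_mem h1).resolve_left fun h => ?_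
      exact hs ((IsLocalization.AtPrime.to_map_mem_maximal_iff S (RingHom.ker q) _).1 h)
    rw [Module.length_eq_of_surjective (M := IsLocalRing.ResidueField S) hs, Module.length_eq_one]
  have hlies' : (RingHom.ker q).LiesOver (RingHom.ker y) := ⟨hunder.symm⟩
  have h1 := IsLocalRing.length_restrictScalars ℂ S T
  rw [hS, mul_one, Module.length_eq_finrank] at h1
  rw [e'.finrank_eq, Ideal.ramificationIdx_eq (RingHom.ker y)]
  have h2 := congrArg ENat.toNat h1
  rw [ENat.toNat_natCast] at h2
  have h3 : ((RingHom.ker y).map (algebraMap A B)).map (algebraMap B S) =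
      (RingHom.ker y).map (algebraMap A S) := by
    rw [Ideal.map_map, ← IsScalarTower.algebraMap_eq]
  rw [h2]
  change (Module.length S
    (S ⧸ ((RingHom.ker y).map (algebraMap A B)).map (algebraMap B S))).toNat = _
  rw [h3]

/-- At a ramification point of a map of smooth curves the differential vanishes. -/
lemma algebraMap_mem_sq_of_ramificationIdx_ne_one [IsNoetherianRing B] {y : A →ₐ[ℂ] ℂ}
    {q : B →ₐ[ℂ] ℂ} (hq : ∀ a, q (algebraMap A B a) = y a) {u : B}
    (hu₀ : q u = 0) (hu : RingHom.ker q ≤ Ideal.span {u} ⊔ RingHom.ker q ^ 2)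
    (hram : (RingHom.ker q).ramificationIdx A ≠ 1) {t : A} (ht : y t = 0) :
    algebraMap A B t ∈ RingHom.ker q ^ 2 := by
  by_contra hne
  apply hram
  let S := Localization.AtPrime (RingHom.ker q)
  have hmap : IsLocalRing.maximalIdeal S = (RingHom.ker q).map (algebraMap B S) :=
    (Localization.AtPrime.map_eq_maximalIdeal (I := RingHom.ker q)).symm
  have : IsNoetherianRing S := IsLocalization.isNoetherianRing (RingHom.ker q).primeCompl S ‹_›
  have hunder : (RingHom.ker q).under A = RingHom.ker y := by
    ext a
    simp [Ideal.under, RingHom.mem_ker, hq]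
  have hlies : (RingHom.ker q).LiesOver (RingHom.ker y) := ⟨hunder.symm⟩
  have htq : algebraMap A B t ∈ RingHom.ker q := (hq t).trans ht
  have h1 : RingHom.ker q ≤ Ideal.span {algebraMap A B t} ⊔ RingHom.ker q ^ 2 := by
    obtain ⟨_, hd, w, hw, hdw⟩ := Submodule.mem_sup.1 (hu htq)
    obtain ⟨d, rfl⟩ := Ideal.mem_span_singleton'.1 hd
    have hd : d ∉ RingHom.ker q := by
      intro hd
      apply hne
      rw [← hdw]
      refine Ideal.add_mem _ ?_ hw
      rw [pow_two]
      exact Ideal.mul_mem_mul hd hu₀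
    obtain ⟨d', z, hz, hd'⟩ := (ker_isMaximal q).exists_inv hd
    have hu' : u ∈ Ideal.span {algebraMap A B t} ⊔ RingHom.ker q ^ 2 := by
      have : u = d' * algebraMap A B t + (z * u - d' * w) := by
        rw [← hdw]
        linear_combination (-u) * hd'
      rw [this]
      refine Submodule.add_mem_sup (Ideal.mul_mem_left _ _ (Ideal.mem_span_singleton_self _))
        (Ideal.sub_mem _ ?_ (Ideal.mul_mem_left _ _ hw))
      rw [pow_two]
      exact Ideal.mul_mem_mul hz hu₀
    exact hu.trans (sup_le ((Ideal.span_singleton_le_iff_mem _).2 hu') le_sup_right)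
  have h2 : (RingHom.ker y).map (algebraMap A S) = IsLocalRing.maximalIdeal S := by
    refine le_antisymm ?_ ?_
    · rw [hmap, Ideal.map_le_iff_le_comap]
      intro a ha
      rw [Ideal.mem_comap, IsScalarTower.algebraMap_apply A B S]
      exact Ideal.mem_map_of_mem _ ((hq a).trans ha)
    · refine Submodule.le_of_le_smul_of_le_jacobson_bot (I := IsLocalRing.maximalIdeal S)
        (IsNoetherian.noetherian _) (IsLocalRing.maximalIdeal_le_jacobson ⊥) ?_
      have := Ideal.map_mono (f := algebraMap B S) h1
      rw [Ideal.map_sup, Ideal.map_pow, ← hmap, Ideal.map_span, Set.image_singleton,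
        pow_two] at this
      refine this.trans (sup_le_sup_right ?_ _)
      rw [Ideal.span_singleton_le_iff_mem, ← IsScalarTower.algebraMap_apply A B S]
      exact Ideal.mem_map_of_mem _ ht
  rw [Ideal.ramificationIdx_eq (RingHom.ker y)]
  change (Module.length S (S ⧸ (RingHom.ker y).map (algebraMap A S))).toNat = 1
  rw [h2]
  have : IsSimpleModule S (S ⧸ IsLocalRing.maximalIdeal S) :=
    isSimpleModule_iff_isCoatom.2 (IsLocalRing.maximalIdeal.isMaximal S).out
  rw [Module.length_eq_one]
  rfl

variable [IsScalarTower ℂ A B]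

/-- Over an algebraically closed field, the trace of a finite free algebra after base change is a
sum of characters. -/
lemma exists_baseChange_trace_eq_sum {K : Type} [Field K] [IsAlgClosed K] [Algebra ℂ K]
    [Module.Free A B] [Module.Finite A B] (hn : Module.finrank A B = n) (f : A →ₐ[ℂ] K) :
    ∃ ψ : Fin n → (B →ₐ[ℂ] K), (∀ i a, ψ i (algebraMap A B a) = f a) ∧
      IsTraceFibre (Algebra.trace A B) f ψ := by
  classical
  have : Nontrivial A := f.toRingHom.domain_nontrivial
  let _ : Algebra A K := f.toRingHom.toAlgebra
  have : IsScalarTower ℂ A K := IsScalarTower.of_algebraMap_eq fun z => (f.commutes z).symm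
  let E := K ⊗[A] B
  have : IsArtinianRing E := IsArtinianRing.of_finite K E
  let := Fintype.ofFinite (PrimeSpectrum E)
  obtain ⟨ψ, -, hψ⟩ := exists_trace_eq_sum (k := K) (E := E)
  obtain ⟨σ, hσ⟩ := exists_enumeration (n := n)
    (fun p : PrimeSpectrum E => Module.finrank K (Localization.AtPrime p.asIdeal)) 
      ((IsArtinianRing.finrank_eq_sum_primeSpectrum (R := E) K).symm.trans
        (Module.finrank_baseChange.trans hn))
  let j : B →ₐ[A] E := Algebra.TensorProduct.includeRight
  refine ⟨fun i => ((ψ (σ i)).restrictScalars A |>.comp j).restrictScalars ℂ,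
    fun i a => ?_, fun b => ?_⟩
  · change ψ (σ i) (j (algebraMap A B a)) = _
    rw [j.commutes, IsScalarTower.algebraMap_apply A K E, (ψ (σ i)).commutes]
    rfl
  · refine (hσ fun p => ψ p (j b)).trans ((hψ (j b)).symm.trans ?_)
    exact trace_tmul K b

/-- The fibre over a point, with the multiplicities given by ramification indices, is a fibre in the
sense of traces. -/
lemma exists_isTraceFibre_card [Module.Free A B] [Module.Finite A B]
    (hn : Module.finrank A B = n) (y : A →ₐ[ℂ] ℂ) : ∃ x : Fin n → (B →ₐ[ℂ] ℂ),
      (∀ i a, x i (algebraMap A B a) = y a) ∧ IsTraceFibre (Algebra.trace A B) y x ∧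
      ∀ q : B →ₐ[ℂ] ℂ, (∀ a, q (algebraMap A B a) = y a) →
        Nat.card {i // x i = q} = (RingHom.ker q).ramificationIdx A := by
  classical
  have : Nontrivial A := y.toRingHom.domain_nontrivial
  let I := RingHom.ker y
  let E := B ⧸ I.map (algebraMap A B)
  let e₁ : (A ⧸ I) ≃ₐ[ℂ] ℂ := Ideal.quotientKerAlgEquivOfSurjective (f := y)
    fun z => ⟨algebraMap ℂ A z, by simp⟩
  let e₂ : E ≃ₐ[A ⧸ I] (A ⧸ I) ⊗[A] B := Algebra.TensorProduct.quotIdealMapEquivQuotTensor B I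
  have : Module.Finite (A ⧸ I) E := Module.Finite.equiv e₂.symm.toLinearEquiv
  have : Module.Free (A ⧸ I) E := Module.Free.of_equiv e₂.symm.toLinearEquiv
  have : Module.Finite ℂ (A ⧸ I) := Module.Finite.equiv e₁.symm.toLinearEquiv
  have : IsScalarTower ℂ (A ⧸ I) E := IsScalarTower.of_algebraMap_eq fun z => by
    change Ideal.Quotient.mk _ (algebraMap ℂ B z) = Ideal.Quotient.mk _ (algebraMap A B _)
    rw [IsScalarTower.algebraMap_apply ℂ A B]
  have hfin : Module.Finite ℂ E := Module.Finite.trans (A ⧸ I) E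
  have hrank : Module.finrank ℂ E = n := by
    rw [← Module.finrank_mul_finrank ℂ (A ⧸ I) E, e₁.toLinearEquiv.finrank_eq,
      e₂.toLinearEquiv.finrank_eq, Module.finrank_baseChange, hn, Module.finrank_self, one_mul]
  have htr : ∀ b : B, Algebra.trace ℂ E (Ideal.Quotient.mk _ b) = y (Algebra.trace A B b) := by
    intro b
    have hz : ∀ z : A ⧸ I, Algebra.trace ℂ (A ⧸ I) z = e₁ z := by
      intro z
      obtain ⟨c, rfl⟩ := e₁.symm.surjective z
      have : e₁.symm c = algebraMap ℂ (A ⧸ I) c := e₁.symm.commutes c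
      rw [e₁.apply_symm_apply, this, Algebra.trace_algebraMap, e₁.toLinearEquiv.finrank_eq,
        Module.finrank_self, one_smul]
    rw [← Algebra.trace_trace (S := A ⧸ I), trace_quotient_map, hz]
    rfl
  have : IsArtinianRing E := IsArtinianRing.of_finite ℂ E
  let := Fintype.ofFinite (PrimeSpectrum E)
  obtain ⟨ψ, hker, hψ⟩ := exists_trace_eq_sum (k := ℂ) (E := E)
  obtain ⟨σ, hσ⟩ := exists_enumeration (n := n)
    (fun p : PrimeSpectrum E => Module.finrank ℂ (Localization.AtPrime p.asIdeal))
      ((IsArtinianRing.finrank_eq_sum_primeSpectrum (R := E) ℂ).symm.trans hrank)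
  let j : B →ₐ[ℂ] E := Ideal.Quotient.mkₐ ℂ _
  have hj : ∀ a, j (algebraMap A B a) = algebraMap ℂ E (y a) := by
    intro a
    have : j (algebraMap A B (a - algebraMap ℂ A (y a))) = 0 :=
      Ideal.Quotient.eq_zero_iff_mem.2 (Ideal.mem_map_of_mem _ (by simp [I, RingHom.mem_ker]))
    rw [map_sub, map_sub, sub_eq_zero] at this
    rw [this, ← IsScalarTower.algebraMap_apply ℂ A B, j.commutes]
  refine ⟨fun i => (ψ (σ i)).comp j, fun i a => ?_, fun b => ?_, fun q hq => ?_⟩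
  · rw [AlgHom.comp_apply, hj, AlgHom.commutes]
    rfl
  · exact (hσ fun p => ψ p (j b)).trans ((hψ (j b)).symm.trans (htr b))
  · have hq' : I.map (algebraMap A B) ≤ RingHom.ker q :=
      Ideal.map_le_iff_le_comap.2 fun a ha => (hq a).trans ha
    let q' : E →ₐ[ℂ] ℂ := Ideal.Quotient.liftₐ _ q hq'
    have hq'j : q'.comp j = q := AlgHom.ext fun b => rfl
    let p : PrimeSpectrum E := ⟨RingHom.ker q', inferInstance⟩
    have hcard := hσ fun p' => if p' = p then 1 else 0
    rw [Finset.sum_boole, Finset.sum_eq_single p (fun _ _ h => by simp [h]) (by simp),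
      if_pos rfl, smul_eq_mul, mul_one] at hcard
    have hfp : Module.Finite ℂ (Localization.AtPrime p.asIdeal) :=
      Module.Finite.of_surjective (Algebra.algHom ℂ E (Localization.AtPrime p.asIdeal)).toLinearMap
        (IsArtinianRing.localization_surjective p.asIdeal.primeCompl _)
    have h2 := finrank_eq_ramificationIdx y q hq p.asIdeal (by
      ext b
      change q' (j b) = 0 ↔ q b = 0
      rfl)
    rw [← h2, ← hcard, Nat.card_eq_fintype_card, Fintype.card_subtype]
    simp only [Nat.cast_id]
    congr 1
    ext i
    simp only [Finset.mem_filter, Finset.mem_univ, true_and]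
    constructor
    · intro h
      refine PrimeSpectrum.ext ?_
      rw [← hker]
      have : ψ (σ i) = q' := Ideal.Quotient.algHom_ext _ (h.trans hq'j.symm)
      rw [this]
    · intro h
      have : ψ (σ i) = q' := algHom_eq_of_ker_le (by rw [hker, h])
      rw [this, hq'j]

end Fibre

end SymTensor

/-! ### Branches through a point of the fibre product -/

namespace SymTensor

section Lift

/-- A point of a finite flat algebra over an integrally closed domain, whose fraction field is
algebraically closed, lies on a section. -/
lemma exists_section {V K D : Type} [CommRing V] [IsDomain V] [Algebra ℂ V] [Field K]
    [IsAlgClosed K] [Algebra V K] [Module.IsTorsionFree V K]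
    (hV : ∀ z : K, IsIntegral V z → ∃ v, algebraMap V K v = z) [CommRing D] [Algebra V D]
    [Module.Flat V D] [Algebra.IsIntegral V D] {e : V →ₐ[ℂ] ℂ} (χ : D →+* ℂ)
    (hχ : ∀ v, χ (algebraMap V D v) = e v) :
    ∃ φ : D →ₐ[V] V, ∀ d, e (φ d) = χ d := by
  have := RingHom.ker_isPrime χ
  have : (RingHom.ker χ).LiesOver (RingHom.ker e) := ⟨by
    ext v
    simp [Ideal.under, RingHom.mem_ker, hχ]⟩
  -- going down gives a prime `P` over the generic point of `Spec V`, whose closure contains `χ`; it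
  -- is a section, because `D ⧸ P` is an integral extension of `V` inside `K`
  obtain ⟨P, hPle, hP, hPo⟩ := Ideal.exists_ideal_le_liesOver_of_le (S := D) (RingHom.ker χ)
    (p := (⊥ : Ideal V)) (q := RingHom.ker e) bot_le
  have hinj : Function.Injective (algebraMap V (D ⧸ P)) := by
    rw [injective_iff_map_eq_zero]
    intro v hv
    have : v ∈ P.under V := by
      rw [Ideal.under, Ideal.mem_comap, ← Ideal.Quotient.eq_zero_iff_mem]
      exact hv
    rwa [← hPo.over] at this
  have : FaithfulSMul V (D ⧸ P) := (faithfulSMul_iff_algebraMap_injective _ _).2 hinj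
  have : Algebra.IsIntegral V (D ⧸ P) :=
    Algebra.IsIntegral.of_surjective (Ideal.Quotient.mkₐ V P) Ideal.Quotient.mk_surjective
  let j : (D ⧸ P) →ₐ[V] K := IsAlgClosed.lift
  have hjinj : Function.Injective j := by
    rw [injective_iff_map_eq_zero]
    have h0 : RingHom.ker j = ⊥ := by
      refine Ideal.eq_bot_of_comap_eq_bot (R := V) ?_
      rw [eq_bot_iff]
      intro v hv
      rw [Ideal.mem_comap, RingHom.mem_ker, j.commutes] at hv
      exact (FaithfulSMul.algebraMap_eq_zero_iff V K).1 hv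
    intro z hz
    rw [← RingHom.mem_ker, h0] at hz
    exact hz
  have hbij : Function.Bijective (Algebra.ofId V (D ⧸ P)) := by
    refine ⟨hinj, fun z => ?_⟩
    obtain ⟨v, hv⟩ := hV (j z) ((Algebra.IsIntegral.isIntegral z).map j)
    exact ⟨v, hjinj ((j.commutes v).trans hv)⟩
  let ε := AlgEquiv.ofBijective _ hbij
  refine ⟨ε.symm.toAlgHom.comp (Ideal.Quotient.mkₐ V P), fun d => ?_⟩
  obtain ⟨v, hv⟩ := hbij.2 (Ideal.Quotient.mkₐ V P d)
  have h1 : ε.symm (Ideal.Quotient.mkₐ V P d) = v := by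
    rw [AlgEquiv.symm_apply_eq]; exact hv.symm
  have h2 : d - algebraMap V D v ∈ P := by
    rw [← Ideal.Quotient.eq_zero_iff_mem, map_sub, sub_eq_zero]
    exact hv.symm
  have h3 := hPle h2
  rw [RingHom.mem_ker, map_sub, hχ, sub_eq_zero] at h3
  rw [h3]
  exact congrArg e h1

/-- Points of `Spec V` in `Spec B` lift to a finite flat covering `Spec C`, with a given lift of the
special point: the lift is a section of the base change of the covering to `V`. -/
lemma exists_lift_of_flat {V K : Type} [CommRing V] [IsDomain V] [Algebra ℂ V] [Field K]
    [IsAlgClosed K] [Algebra V K] [Module.IsTorsionFree V K]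
    (hV : ∀ z : K, IsIntegral V z → ∃ v, algebraMap V K v = z) {B C : Type} [CommRing B]
    [Algebra ℂ B] [CommRing C] [Algebra ℂ C] {κ : B →ₐ[ℂ] C} (hflat : κ.toRingHom.Flat)
    (hint : κ.toRingHom.IsIntegral) {e : V →ₐ[ℂ] ℂ} {ψ : B →ₐ[ℂ] V} {x : C →ₐ[ℂ] ℂ}
    (h : ∀ b, e (ψ b) = x (κ b)) :
    ∃ φ : C →ₐ[ℂ] V, (∀ b, φ (κ b) = ψ b) ∧ ∀ c, e (φ c) = x c := by
  let _ : Algebra B C := κ.toRingHom.toAlgebra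
  let _ : Algebra B V := ψ.toRingHom.toAlgebra
  let _ : Algebra B ℂ := (x.comp κ).toRingHom.toAlgebra
  have : Module.Flat B C := hflat
  have : Algebra.IsIntegral B C := ⟨hint⟩
  let e' : V →ₐ[B] ℂ := ⟨e.toRingHom, h⟩
  let x' : C →ₐ[B] ℂ := ⟨x.toRingHom, fun b => rfl⟩
  let χ : V ⊗[B] C →ₐ[B] ℂ := Algebra.TensorProduct.productMap e' x'
  obtain ⟨φ, hφ⟩ := exists_section (D := V ⊗[B] C) hV (e := e) χ.toRingHom (fun v => by
    change χ (v ⊗ₜ 1) = e v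
    rw [Algebra.TensorProduct.productMap_apply_tmul, map_one, mul_one]
    rfl)
  have hκ : ∀ b, φ (1 ⊗ₜ κ b) = ψ b := by
    intro b
    have : (1 : V) ⊗ₜ[B] κ b = algebraMap V (V ⊗[B] C) (ψ b) := by
      have h1 : κ b = b • (1 : C) := by rw [Algebra.smul_def, mul_one]; rfl
      have h2 : ψ b = b • (1 : V) := by rw [Algebra.smul_def, mul_one]; rfl
      rw [h1, h2, ← TensorProduct.smul_tmul]
      rfl
    rw [this, φ.commutes]
    rfl
  refine ⟨⟨(φ.toRingHom.comp (Algebra.TensorProduct.includeRight (R := B) (A := V)).toRingHom),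
    fun z => ?_⟩, hκ, fun c => ?_⟩
  · change φ (1 ⊗ₜ algebraMap ℂ C z) = _
    rw [← κ.commutes, hκ, ψ.commutes]
  · change e (φ (1 ⊗ₜ c)) = x c
    rw [hφ]
    change χ (1 ⊗ₜ c) = x c
    rw [Algebra.TensorProduct.productMap_apply_tmul, map_one, one_mul]
    rfl

variable {n : ℕ} {A B C : Type} [CommRing A] [Algebra ℂ A] [CommRing B] [Algebra ℂ B] [Algebra A B]
  [IsScalarTower ℂ A B] [CommRing C] [Algebra ℂ C] {κ : B →ₐ[ℂ] C}

/-- Every point of the fibre product lies on a branch which dominates `Spec A`: over an absolute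
integral closure of the local ring of `Spec A`, the points of the fibre are sections, and the
given divisor on the double cover moves along with them. Therefore a function which does not vanish
on `Spec A` is not nilpotent near any point of the fibre product. -/
lemma mul_pow_ne_zero [Algebra.FiniteType ℂ A] [Module.Free A B] [Module.Finite A B]
    (hn : Module.finrank A B = n) (hflat : κ.toRingHom.Flat) (hint : κ.toRingHom.IsIntegral)
    {χ : FibreRing (n := n) κ (TraceRel (Algebra.trace A B)) →ₐ[ℂ] ℂ} {y : A →ₐ[ℂ] ℂ}
    (hy : χ.comp (fibreLeft κ _) = y) [IsDomain (Localization.AtPrime (RingHom.ker y))] {t : A}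
    (ht : algebraMap A (Localization.AtPrime (RingHom.ker y)) t ≠ 0)
    {s : FibreRing (n := n) κ (TraceRel (Algebra.trace A B))} (hs : χ s ≠ 0) (k : ℕ) :
    s * fibreLeft κ _ t ^ k ≠ 0 := by
  let O := Localization.AtPrime (RingHom.ker y)
  let K := AlgebraicClosure (FractionRing O)
  let V := integralClosure O K
  have hOK : Function.Injective (algebraMap O K) := by
    rw [IsScalarTower.algebraMap_eq O (FractionRing O) K]
    exact (algebraMap (FractionRing O) K).injective.comp (IsFractionRing.injective O _)
  -- the point `y`, as a point of the local ring
  obtain ⟨y', hy'⟩ : ∃ y' : O →ₐ[ℂ] ℂ, ∀ a, y' (algebraMap A O a) = y a := by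
    have hu : ∀ s : (RingHom.ker y).primeCompl, IsUnit (y s) := fun s => isUnit_iff_ne_zero.2 s.2
    refine ⟨⟨IsLocalization.lift (M := (RingHom.ker y).primeCompl) (g := y.toRingHom) hu,
      fun z => ?_⟩, fun a => IsLocalization.lift_eq hu a⟩
    change IsLocalization.lift (M := (RingHom.ker y).primeCompl) (g := y.toRingHom) hu _ = _
    rw [IsScalarTower.algebraMap_apply ℂ A O, IsLocalization.lift_eq]
    exact y.commutes z
  obtain ⟨e, he⟩ := exists_algHom_extend (S := V) y' (by
    intro z hz
    have : z = 0 := hOK (by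
      rw [map_zero]
      exact congrArg Subtype.val (RingHom.mem_ker.1 hz))
    rw [this]
    exact Ideal.zero_mem _)
  let f : A →ₐ[ℂ] K := (IsScalarTower.toAlgHom ℂ O K).comp (IsScalarTower.toAlgHom ℂ A O)
  let f' : A →ₐ[ℂ] V := (IsScalarTower.toAlgHom ℂ O V).comp (IsScalarTower.toAlgHom ℂ A O)
  have hef : ∀ a, e (f' a) = y a := fun a => (he _).trans (hy' a)
  obtain ⟨ψ₀, hψ₀, htr₀⟩ := exists_baseChange_trace_eq_sum hn f
  have hψint : ∀ i b, ψ₀ i b ∈ V := by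
    intro i b
    refine IsIntegral.map_of_comp_eq (algebraMap A O) (ψ₀ i).toRingHom ?_
      (Algebra.IsIntegral.isIntegral (R := A) b)
    exact RingHom.ext fun a => (hψ₀ i a).symm
  let ψ : Fin n → (B →ₐ[ℂ] V) := fun i => (ψ₀ i).codRestrict (V.restrictScalars ℂ) (hψint i)
  have htr : IsTraceFibre (Algebra.trace A B) f' ψ := by
    intro b
    apply Subtype.ext
    have h1 := htr₀ b
    rw [AddSubmonoidClass.coe_finsetSum]
    exact h1
  -- the sections specialize to the points of the fibre
  obtain ⟨x, hx, hxy⟩ := exists_point_eq (traceRel_psum _) χ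
  rw [hy] at hxy
  have hD : Finset.univ.val.map (fun i => (x i).comp κ) =
      Finset.univ.val.map (fun i => e.comp (ψ i)) := by
    refine multiset_eq_of_sum_eq fun b => ?_
    rw [Multiset.map_map, Multiset.map_map]
    refine (hxy b).trans ?_
    rw [← hef, ← htr b, map_sum]
    rfl
  obtain ⟨σ, hσ⟩ := exists_perm_of_map_eq hD
  have hV : ∀ z : K, IsIntegral V z → ∃ v : V, algebraMap V K v = z := fun z hz =>
    ⟨⟨z, isIntegral_trans (A := V) z hz⟩, rfl⟩
  have : Module.IsTorsionFree V K :=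
    Module.isTorsionFree_iff_algebraMap_injective.2 Subtype.val_injective
  choose φ hφκ hφe using fun i => exists_lift_of_flat hV hflat hint (e := e) (ψ := ψ (σ i))
    (x := x i) fun b => DFunLike.congr_fun (hσ i) b
  let δ : FibreRing (n := n) κ (TraceRel (Algebra.trace A B)) →ₐ[ℂ] V :=
    fibreLift κ _ f' ((prodLift φ).comp (TS n C).val) (by
      intro a g hag
      refine (hag.eq_prodLift (fun y => ?_) (α := f') (x := fun i => (φ i).comp κ) ?_).trans
        (prodLift_tmap κ φ (g : TPow n B)).symm
      · obtain ⟨x, -, hx, -⟩ := exists_isTraceFibre_card hn y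
        exact ⟨x, hx⟩
      · intro b
        rw [← htr b, ← Equiv.sum_comp σ fun i => ψ i b]
        exact Finset.sum_congr rfl fun i _ => hφκ i b)
  have hδl : ∀ a, δ (fibreLeft κ _ a) = f' a := fun a => fibreLift_left _ _ _ a
  have hδr : ∀ c, δ (fibreRight κ _ (psum n c)) = ∑ i, φ i c := fun c =>
    (fibreLift_right _ _ _ (psum n c)).trans (prodLift_psum φ c)
  have hδ : e.comp δ = χ := by
    refine fibreAlgHom_ext (fun a => ?_) fun c => ?_
    · rw [AlgHom.comp_apply, hδl, hef, ← hy]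
      rfl
    · rw [AlgHom.comp_apply, hδr, map_sum, hx, prodLift_psum]
      exact Finset.sum_congr rfl fun i _ => hφe i c
  intro h0
  have h1 := congrArg δ h0
  rw [map_mul, map_pow, map_zero, hδl] at h1
  rcases mul_eq_zero.1 h1 with h | h
  · exact hs (by rw [← hδ, AlgHom.comp_apply, h, map_zero])
  · refine pow_ne_zero k (fun h' => ht (hOK ?_)) h
    rw [map_zero]
    exact congrArg Subtype.val h'

end Lift

end SymTensor

/-! ### Regular and singular points in terms of coordinate rings -/

namespace SymTensor

section SmoothPoint

/-- A local parameter at a closed point whose local ring is a discrete valuation ring. -/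
lemma exists_parameter {A : Type} [CommRing A] [Algebra ℂ A] (y : A →ₐ[ℂ] ℂ)
    [IsDomain (Localization.AtPrime (RingHom.ker y))]
    [IsDiscreteValuationRing (Localization.AtPrime (RingHom.ker y))] :
    ∃ t, y t = 0 ∧ RingHom.ker y ≤ Ideal.span {t} ⊔ RingHom.ker y ^ 2 ∧ t ∉ RingHom.ker y ^ 2 ∧
      algebraMap A (Localization.AtPrime (RingHom.ker y)) t ≠ 0 ∧
      ∀ a, y a = 0 → ∃ s, y s ≠ 0 ∧ s * a ∈ Ideal.span {t} := by
  set S := Localization.AtPrime (RingHom.ker y)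
  have hmap : IsLocalRing.maximalIdeal S = (RingHom.ker y).map (algebraMap A S) :=
    (Localization.AtPrime.map_eq_maximalIdeal (I := RingHom.ker y)).symm
  obtain ⟨w, hw⟩ := IsDiscreteValuationRing.exists_irreducible S
  obtain ⟨⟨t, s₀⟩, hts⟩ := IsLocalization.surj (RingHom.ker y).primeCompl w
  have hu : IsUnit (algebraMap A S s₀) := IsLocalization.map_units S s₀
  have hmax : IsLocalRing.maximalIdeal S = Ideal.span {algebraMap A S t} := by
    rw [hw.maximalIdeal_eq, ← hts, Ideal.span_singleton_mul_right_unit hu]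
  have ht0 : algebraMap A S t ≠ 0 := by
    rw [← hts]
    exact mul_ne_zero hw.ne_zero hu.ne_zero
  have ht : algebraMap A S t ∈ IsLocalRing.maximalIdeal S := by
    rw [hmax]; exact Ideal.mem_span_singleton_self _
  have hyt : y t = 0 := (IsLocalization.AtPrime.to_map_mem_maximal_iff S (RingHom.ker y) t).1 ht
  have key : ∀ a, y a = 0 → ∃ s, y s ≠ 0 ∧ s * a ∈ Ideal.span {t} := by
    intro a ha
    have h1 : algebraMap A S a ∈ IsLocalRing.maximalIdeal S :=
      (IsLocalization.AtPrime.to_map_mem_maximal_iff S (RingHom.ker y) a).2 ha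
    rw [hmax] at h1
    obtain ⟨c, hc⟩ := Ideal.mem_span_singleton'.1 h1
    obtain ⟨⟨d, s⟩, hd⟩ := IsLocalization.surj (RingHom.ker y).primeCompl c
    have h2 : algebraMap A S (s * a) = algebraMap A S (d * t) := by
      rw [map_mul, map_mul, ← hd, ← hc]; ring
    obtain ⟨s', hs'⟩ := (IsLocalization.eq_iff_exists (RingHom.ker y).primeCompl S).1 h2
    refine ⟨s' * s, ?_, Ideal.mem_span_singleton'.2 ⟨s' * d, ?_⟩⟩
    · rw [map_mul]
      exact mul_ne_zero s'.2 s.2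
    · rw [mul_assoc, mul_assoc, hs']
  refine ⟨t, hyt, fun a ha => ?_, fun h => ?_, ht0, key⟩
  · obtain ⟨s, hs, hsa⟩ := key a ha
    obtain ⟨d, z, hz, hd⟩ := (ker_isMaximal y).exists_inv hs
    have : a = d * (s * a) + z * a := by linear_combination (-a) * hd
    rw [this, pow_two]
    exact Submodule.add_mem_sup (Ideal.mul_mem_left _ _ hsa) (Ideal.mul_mem_mul hz ha)
  · have h1 := Ideal.mem_map_of_mem (algebraMap A S) h
    rw [Ideal.map_pow, ← hmap, hmax, Ideal.span_singleton_pow] at h1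
    obtain ⟨c, hc⟩ := Ideal.mem_span_singleton'.1 h1
    have h2 : c * algebraMap A S t = 1 := by
      refine mul_right_cancel₀ ht0 ?_
      rw [one_mul, mul_assoc, ← pow_two, hc]
    exact (IsLocalRing.maximalIdeal.isMaximal S).ne_top
      ((Ideal.eq_top_iff_one _).2 (by rw [← h2]; exact Ideal.mul_mem_left _ _ ht))

end SmoothPoint

section LocalRing

variable {n : ℕ} {A B C : Type} [CommRing A] [Algebra ℂ A] [CommRing B] [Algebra ℂ B] [Algebra A B]
  [CommRing C] [Algebra ℂ C] {κ : B →ₐ[ℂ] C}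
  {χ : FibreRing (n := n) κ (TraceRel (Algebra.trace A B)) →ₐ[ℂ] ℂ} {x : Fin n → (C →ₐ[ℂ] ℂ)}

/-- At a divisor which contains both preimages of two points, the fibre product is singular. -/
lemma not_isRegularLocalRing_of_pairs [Algebra.FiniteType ℂ A] [Algebra.FiniteType ℂ C]
    (hκ : IsDoubleCover κ) (hét : κ.toRingHom.FormallyEtale)
    (hχ : ∀ t, χ (fibreRight κ _ t) = prodLift x (t : TPow n C)) {y : A →ₐ[ℂ] ℂ}
    (hy : χ.comp (fibreLeft κ _) = y)
    (hA : ∃ _ : IsDomain (Localization.AtPrime (RingHom.ker y)),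
      IsDiscreteValuationRing (Localization.AtPrime (RingHom.ker y)))
    (hB : ∀ q : B →ₐ[ℂ] ℂ, ∃ _ : IsDomain (Localization.AtPrime (RingHom.ker q)),
      IsDiscreteValuationRing (Localization.AtPrime (RingHom.ker q))) {i j i' j' : Fin n}
    (h₁ : x i ≠ x j) (h₁' : (x i).comp κ = (x j).comp κ) (h₂ : x i' ≠ x j')
    (h₂' : (x i').comp κ = (x j').comp κ) (hne : (x i).comp κ ≠ (x i').comp κ) :
    ¬ IsRegularLocalRing (Localization.AtPrime (RingHom.ker χ)) := by
  obtain ⟨_, _⟩ := hA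
  obtain ⟨t, ht, -, -, -, hts⟩ := exists_parameter y
  obtain ⟨_, _⟩ := hB ((x i).comp κ)
  obtain ⟨u, hu, -, hu₂, -⟩ := exists_parameter ((x i).comp κ)
  obtain ⟨_, _⟩ := hB ((x i').comp κ)
  obtain ⟨v, hv, -, hv₂, -⟩ := exists_parameter ((x i').comp κ)
  have hl : ∀ a, χ (fibreLeft κ _ a) = y a := fun a => by rw [← hy]; rfl
  refine not_isRegularLocalRing_of_two_pairs hét hχ h₁ h₁' h₂ h₂' hne hu hu₂ hv hv₂
    (height_ker_le_one hκ (t := t) ((hl t).trans ht) fun a ha => ?_)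
  obtain ⟨s, hs, hsa⟩ := hts a ((hl a).symm.trans ha)
  exact ⟨s, by rwa [hl], hsa⟩

variable [IsScalarTower ℂ A B]

/-- At a divisor which contains both preimages of at most one point, the local ring of the
fibre product is a principal ideal domain. -/
lemma isDomain_and_isPrincipalIdealRing_of_subsingleton_pairs [Algebra.FiniteType ℂ A]
    [Module.Free A B] [Module.Finite A B] [IsNoetherianRing B] [Algebra.FiniteType ℂ C]
    (hn : Module.finrank A B = n) (hκ : IsDoubleCover κ)
    (hflat : κ.toRingHom.Flat) (hint : κ.toRingHom.IsIntegral)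
    (hχ : ∀ t, χ (fibreRight κ _ t) = prodLift x (t : TPow n C)) {y : A →ₐ[ℂ] ℂ}
    (hy : χ.comp (fibreLeft κ _) = y)
    (hA : ∃ _ : IsDomain (Localization.AtPrime (RingHom.ker y)),
      IsDiscreteValuationRing (Localization.AtPrime (RingHom.ker y)))
    (hB : ∀ q : B →ₐ[ℂ] ℂ, ∃ _ : IsDomain (Localization.AtPrime (RingHom.ker q)),
      IsDiscreteValuationRing (Localization.AtPrime (RingHom.ker q)))
    (hram : ∀ q : B →ₐ[ℂ] ℂ, (∀ a, q (algebraMap A B a) = y a) →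
      (RingHom.ker q).ramificationIdx A ≤ 2)
    (hpair : ∀ i j i' j', x i ≠ x j → (x i).comp κ = (x j).comp κ → x i' ≠ x j' →
      (x i').comp κ = (x j').comp κ → (x i).comp κ = (x i').comp κ) :
    IsDomain (Localization.AtPrime (RingHom.ker χ)) ∧
      IsPrincipalIdealRing (Localization.AtPrime (RingHom.ker χ)) := by
  classical
  have : IsNoetherianRing (FibreRing (n := n) κ (TraceRel (Algebra.trace A B))) :=
    Algebra.FiniteType.isNoetherianRing ℂ _
  obtain ⟨_, _⟩ := hA
  obtain ⟨t, ht, htspan, -, ht0, -⟩ := exists_parameter y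
  have hχt : χ (fibreLeft κ _ t) = 0 := by rw [← ht, ← hy]; rfl
  have hnil := fun s (hs : χ s ≠ 0) k => mul_pow_ne_zero hn hflat hint hy ht0 hs k
  by_cases hsplit : ∃ i j, x i ≠ x j ∧ (x i).comp κ = (x j).comp κ
  · obtain ⟨i₁, i₂, h₁₂, hκ₁₂⟩ := hsplit
    -- the points of the divisor lie over the fibre, with the right multiplicities
    obtain ⟨z, hzy, hz, hcard⟩ := exists_isTraceFibre_card hn y
    have hfib : IsTraceFibre (Algebra.trace A B) y fun i => (x i).comp κ := by
      intro b
      have := hχ (tsMap κ (psum n b))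
      rw [← fibreLeft_eq (traceRel_psum _ b), tsMap_psum, prodLift_psum] at this
      rw [← hy]
      exact this.symm
    have hD : Finset.univ.val.map (fun i => (x i).comp κ) = Finset.univ.val.map z := by
      refine multiset_eq_of_sum_eq fun b => ?_
      rw [Multiset.map_map, Multiset.map_map]
      exact (hfib b).trans (hz b).symm
    obtain ⟨σ, hσ⟩ := exists_perm_of_map_eq hD
    set q := (x i₂).comp κ with hq
    have hqy : ∀ a, q (algebraMap A B a) = y a := fun a => by
      rw [hq, ← hσ]; exact hzy _ a
    have hcardq : Nat.card {i // (x i).comp κ = q} = (RingHom.ker q).ramificationIdx A := by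
      rw [← hcard q hqy]
      exact Nat.card_congr (σ.subtypeEquiv fun i => by rw [hσ])
    have hi₁₂ : i₁ ≠ i₂ := fun h => h₁₂ (by rw [h])
    have hle := hram q hqy
    rw [← hcardq, Nat.card_eq_fintype_card, Fintype.card_subtype] at hle
    have hpairset : ∀ i, (x i).comp κ = q → i = i₁ ∨ i = i₂ := by
      intro i hi
      by_contra! hne
      have h3 : ({i, i₁, i₂} : Finset (Fin n)).card = 3 :=
        Finset.card_eq_three.2 ⟨i, i₁, i₂, hne.1, hne.2, hi₁₂, rfl⟩
      have h4 : ({i, i₁, i₂} : Finset (Fin n)) ⊆ Finset.univ.filter fun i => (x i).comp κ = q := by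
        intro j hj
        simp only [Finset.mem_insert, Finset.mem_singleton] at hj
        simp only [Finset.mem_filter, Finset.mem_univ, true_and]
        rcases hj with rfl | rfl | rfl
        exacts [hi, hκ₁₂, rfl]
      have := Finset.card_le_card h4
      omega
    obtain ⟨_, _⟩ := hB q
    obtain ⟨u, hu₀, hu, -⟩ := exists_parameter q
    have hram1 : (RingHom.ker q).ramificationIdx A ≠ 1 := by
      intro h1
      rw [← hcardq, Nat.card_eq_fintype_card, Fintype.card_eq_one_iff] at h1
      obtain ⟨j, hj⟩ := h1
      have e1 := hj ⟨i₁, hκ₁₂⟩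
      have e2 := hj ⟨i₂, rfl⟩
      exact hi₁₂ (congrArg Subtype.val (e1.trans e2.symm))
    obtain ⟨g, hg₀, hg⟩ := exists_ker_le_span_of_pair (ρ := IsScalarTower.toAlgHom ℂ A B) hκ
      (traceRel_psum (Algebra.trace A B)) (fun a b => by
        change Algebra.trace A B (algebraMap A B a * b) = _
        rw [← Algebra.smul_def, map_smul, smul_eq_mul]) hχ h₁₂ hκ₁₂
      (fun i h₁ h₂ h => (hpairset i h).elim h₁ h₂)
      (fun i j h₁ h₂ hij => by
        by_contra hne
        have := hpair i j i₂ i₁ hne hij h₁₂.symm hκ₁₂.symm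
        exact (hpairset i this).elim h₁ h₂)
      (fun t ht => algebraMap_mem_sq_of_ramificationIdx_ne_one hqy hu₀ hu hram1 (by
        rw [← hy]; exact ht)) hu₀ hu
    exact localization_isDomain_and_isPrincipalIdealRing hg₀ hg hχt hnil
  · push Not at hsplit
    have h1 := ker_le_of_injOn hκ (traceRel_psum (Algebra.trace A B)) hχ fun i j h => by
      by_contra hne
      exact hsplit i j hne h
    refine localization_isDomain_and_isPrincipalIdealRing hχt ?_ hχt hnil
    refine h1.trans (sup_le ?_ le_sup_right)
    rw [hy]
    have h2 := Ideal.map_mono (f := fibreLeft κ (TraceRel (n := n) (Algebra.trace A B))) htspan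
    refine h2.trans ?_
    rw [Ideal.map_sup, Ideal.map_span, Set.image_singleton, Ideal.map_pow]
    refine sup_le_sup_left (Ideal.pow_right_mono ?_ 2) _
    rw [Ideal.map_le_iff_le_comap]
    intro a ha
    rw [Ideal.mem_comap, RingHom.mem_ker]
    rw [← hy] at ha
    exact ha

end LocalRing

end SymTensor

/-! ### Smooth algebras of relative dimension one -/

namespace SymTensor

section Smooth

variable {S : Type} [CommRing S] [Algebra ℂ S]

/-- A smooth algebra of relative dimension one is étale over a polynomial ring in one variable; a
translate of the variable is then a nonzerodivisor which generates the maximal ideal of the local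
ring. -/
lemma isDiscreteValuationRing_of_isStandardSmooth
    (hS : Algebra.IsStandardSmoothOfRelativeDimension 1 ℂ S) (q : S →ₐ[ℂ] ℂ) :
    ∃ _ : IsDomain (Localization.AtPrime (RingHom.ker q)),
      IsDiscreteValuationRing (Localization.AtPrime (RingHom.ker q)) := by
  obtain ⟨g, hg⟩ :=
    Algebra.IsStandardSmoothOfRelativeDimension.exists_etale_mvPolynomial (n := 1) ℂ S
  have hfp : Algebra.FiniteType ℂ S :=
    have := Algebra.IsStandardSmoothOfRelativeDimension.isStandardSmooth (R := ℂ) (S := S) 1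
    inferInstance
  have : IsNoetherianRing S := Algebra.FiniteType.isNoetherianRing ℂ S
  let : Algebra (MvPolynomial (Fin 1) ℂ) S := g.toRingHom.toAlgebra
  have hal : ∀ p, algebraMap (MvPolynomial (Fin 1) ℂ) S p = g p := fun _ => rfl
  have : IsScalarTower ℂ (MvPolynomial (Fin 1) ℂ) S :=
    IsScalarTower.of_algebraMap_eq fun r => (g.commutes r).symm
  have het : Algebra.Etale (MvPolynomial (Fin 1) ℂ) S := hg
  set a : ℂ := q (g (MvPolynomial.X 0))
  set p : MvPolynomial (Fin 1) ℂ := MvPolynomial.X 0 - MvPolynomial.C a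
  have hp : p ≠ 0 := by
    intro h
    have := congrArg (MvPolynomial.eval fun _ => a + 1) h
    simp [p] at this
  set t : S := g p
  have ht : t = g (MvPolynomial.X 0) - algebraMap ℂ S a := by
    change g p = _
    rw [map_sub]
    exact congrArg _ (g.commutes a)
  have hqt : q t = 0 := by rw [ht, map_sub, q.commutes]; exact sub_self _
  have hnzd : t ∈ nonZeroDivisors S := by
    have : Module.Flat (MvPolynomial (Fin 1) ℂ) S := inferInstance
    have h := (Module.Flat.isSMulRegular_of_nonZeroDivisors (M := S)
      (mem_nonZeroDivisors_of_ne_zero hp))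
    refine mem_nonZeroDivisors_iff_right.2 fun x hx => h ?_
    change p • x = p • (0 : S)
    rw [smul_zero, Algebra.smul_def, hal, mul_comm]
    exact hx
  have hn : ∀ s, q s ≠ 0 → ∀ k : ℕ, s * t ^ k ≠ 0 := by
    intro s hs k h
    have := (mem_nonZeroDivisors_iff_right.1 (pow_mem hnzd k)) s h
    exact hs (by rw [this, map_zero])
  have hm : RingHom.ker q ≤ Ideal.span {t} ⊔ RingHom.ker q ^ 2 := by
    intro s hs
    set J := Ideal.span {t} ⊔ RingHom.ker q ^ 2
    -- Both `s ↦ s` and `s ↦ q s` lift the quotient map modulo `ker q`, so they agree modulo `J`.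
    let φ₁ : S →ₐ[MvPolynomial (Fin 1) ℂ] S ⧸ J := IsScalarTower.toAlgHom _ S (S ⧸ J)
    let φ₀ : S →ₐ[ℂ] S ⧸ J := (Algebra.ofId ℂ (S ⧸ J)).comp q
    have hcomm : ∀ r : MvPolynomial (Fin 1) ℂ, φ₀ (g r) = Ideal.Quotient.mk J (g r) := by
      intro r
      have : φ₀.comp g = (IsScalarTower.toAlgHom ℂ S (S ⧸ J)).comp g := by
        refine MvPolynomial.algHom_ext fun i => ?_
        obtain rfl := Subsingleton.elim i 0
        have h1 : Ideal.Quotient.mk J t = 0 :=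
          Ideal.Quotient.eq_zero_iff_mem.2 (Ideal.mem_sup_left (Ideal.mem_span_singleton_self t))
        rw [ht, map_sub, sub_eq_zero] at h1
        exact h1.symm
      exact DFunLike.congr_fun this r
    let φ₂ : S →ₐ[MvPolynomial (Fin 1) ℂ] S ⧸ J :=
      { φ₀.toRingHom with commutes' := hcomm }
    have heq : φ₁ = φ₂ := by
      refine Algebra.FormallyUnramified.comp_injective
        ((RingHom.ker q).map (Ideal.Quotient.mk J)) ?_ ?_
      · rw [← Ideal.map_pow, Ideal.map_eq_bot_iff_le_ker, Ideal.mk_ker]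
        exact le_sup_right
      · refine AlgHom.ext fun x => ?_
        refine (Ideal.Quotient.eq (I := (RingHom.ker q).map (Ideal.Quotient.mk J))).2 ?_
        have : φ₁ x - φ₂ x = Ideal.Quotient.mk J (x - algebraMap ℂ S (q x)) := by
          rw [map_sub]; rfl
        change φ₁ x - φ₂ x ∈ _
        rw [this]
        refine Ideal.mem_map_of_mem _ ?_
        rw [RingHom.mem_ker, map_sub, AlgHom.commutes]
        exact sub_self _
    have h2 := DFunLike.congr_fun heq s
    have h3 : φ₂ s = 0 := by
      change (Algebra.ofId ℂ (S ⧸ J)) (q s) = 0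
      rw [RingHom.mem_ker.1 hs, map_zero]
    rw [h3] at h2
    exact Ideal.Quotient.eq_zero_iff_mem.1 h2
  obtain ⟨h1, h2⟩ := localization_isDomain_and_isPrincipalIdealRing hqt hm hqt hn
  refine ⟨h1, { principal := h2.principal, not_a_field' := fun hbot => ?_ }⟩
  have : algebraMap S (Localization.AtPrime (RingHom.ker q)) t ∈
      IsLocalRing.maximalIdeal (Localization.AtPrime (RingHom.ker q)) := by
    rw [← Localization.AtPrime.map_eq_maximalIdeal]
    exact Ideal.mem_map_of_mem _ hqt
  rw [hbot, Ideal.mem_bot, IsLocalization.map_eq_zero_iff (RingHom.ker q).primeCompl] at this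
  obtain ⟨⟨s, hs⟩, h⟩ := this
  exact hn s hs 1 (by rwa [pow_one])

end Smooth

end SymTensor

/-! ### Complex points and local rings of curves -/

namespace CurveLift

open SymTensor

section Points

variable {X : Scheme.{0}} {s : X ⟶ Spec (.of ℂ)} {U : X.Opens}

lemma eq_specMap_appLE_fromSpec (hU : IsAffineOpen U) (f : Spec (.of ℂ) ⟶ X) (h : ⊤ ≤ f ⁻¹ᵁ U) :
    f = Spec.map (f.appLE U ⊤ h ≫ (Scheme.ΓSpecIso (.of ℂ)).hom) ≫ hU.fromSpec := by
  have h1 := hU.SpecMap_appLE_fromSpec f (isAffineOpen_top (Spec (.of ℂ))) h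
  rw [Spec.map_comp, Category.assoc, h1, IsAffineOpen.fromSpec_top]
  have h3 : Spec.map (Scheme.ΓSpecIso (.of ℂ)).hom ≫ (Spec (.of ℂ)).isoSpec.inv = 𝟙 _ := by
    rw [Iso.comp_inv_eq, Category.id_comp, Scheme.isoSpec_Spec_hom]
  rw [reassoc_of% h3]

lemma CPoint.eq_specMap_fromSpec (hU : IsAffineOpen U) (p : CPoint s) (h : p.pt ∈ U) :
    p.1 = Spec.map (CommRingCat.ofHom (p.eval U h).toRingHom) ≫ hU.fromSpec :=
  eq_specMap_appLE_fromSpec hU p.1 (p.le_preimage h)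

lemma CPoint.eq_of_eval_eq (hU : IsAffineOpen U) {p p' : CPoint s} (h : p.pt ∈ U) (h' : p'.pt ∈ U)
    (he : p.eval U h = p'.eval U h') : p = p' := by
  refine Subtype.ext ?_
  rw [p.eq_specMap_fromSpec hU h, p'.eq_specMap_fromSpec hU h', he]

lemma CPoint.pt_eq_fromSpec (hU : IsAffineOpen U) (p : CPoint s) (h : p.pt ∈ U) :
    p.pt = hU.fromSpec (Spec.map (CommRingCat.ofHom (p.eval U h).toRingHom)
      (IsLocalRing.closedPoint ℂ)) := by
  have := congrArg (fun f : Spec (.of ℂ) ⟶ X => f (IsLocalRing.closedPoint ℂ))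
    (p.eq_specMap_fromSpec hU h)
  exact this

lemma specMap_closedPoint_asIdeal {R : Type} [CommRing R] [Algebra ℂ R] (χ : R →ₐ[ℂ] ℂ) :
    (Spec.map (CommRingCat.ofHom χ.toRingHom) (IsLocalRing.closedPoint ℂ)).asIdeal =
      RingHom.ker χ := by
  change (IsLocalRing.maximalIdeal ℂ).comap χ.toRingHom = _
  rw [IsLocalRing.maximalIdeal_eq_bot]
  rfl

lemma CPoint.primeIdealOf_asIdeal (hU : IsAffineOpen U) (p : CPoint s) (h : p.pt ∈ U) :
    (hU.primeIdealOf ⟨p.pt, h⟩).asIdeal = RingHom.ker (p.eval U h) := by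
  rw [← specMap_closedPoint_asIdeal]
  congr 1
  refine hU.fromSpec.isOpenEmbedding.injective ?_
  rw [hU.fromSpec_primeIdealOf]
  exact p.pt_eq_fromSpec hU h

lemma CPoint.isLocalization_stalk (hU : IsAffineOpen U) (p : CPoint s) (h : p.pt ∈ U) :
    letI : Algebra (Sec s U) (X.presheaf.stalk p.pt) := (X.presheaf.germ U p.pt h).hom.toAlgebra
    IsLocalization.AtPrime (X.presheaf.stalk p.pt) (RingHom.ker (p.eval U h)) := by
  have h1 := hU.isLocalization_stalk ⟨p.pt, h⟩
  simp only [p.primeIdealOf_asIdeal hU h] at h1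
  exact h1

lemma fromSpec_comp_eq (hU : IsAffineOpen U) :
    hU.fromSpec ≫ s = Spec.map ((Scheme.ΓSpecIso (.of ℂ)).inv ≫
      s.appLE ⊤ U (le_preimage_top s U)) := by
  have h1 := IsAffineOpen.SpecMap_appLE_fromSpec s (isAffineOpen_top (Spec (.of ℂ))) hU
    (le_preimage_top s U)
  rw [← h1, IsAffineOpen.fromSpec_top, Spec.map_comp]
  congr 1
  rw [← cancel_epi (Spec (.of ℂ)).isoSpec.hom, Iso.hom_inv_id, Scheme.isoSpec_Spec_hom,
    ← Spec.map_comp, Iso.inv_hom_id, Spec.map_id]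

lemma specMap_fromSpec_comp (hU : IsAffineOpen U) (g : Γ(X, U) ⟶ .of ℂ)
    (hg : ((Scheme.ΓSpecIso (.of ℂ)).inv ≫ s.appLE ⊤ U (le_preimage_top s U)) ≫ g = 𝟙 _) :
    (Spec.map g ≫ hU.fromSpec) ≫ s = 𝟙 _ := by
  rw [Category.assoc, fromSpec_comp_eq, ← Spec.map_comp, hg, Spec.map_id]

/-- The complex points of an affine open subset are the homomorphisms from its ring of functions
to the complex numbers. -/
lemma exists_cpoint_eval_eq (hU : IsAffineOpen U) (χ : Sec s U →ₐ[ℂ] ℂ) :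
    ∃ (p : CPoint s) (h : p.pt ∈ U), p.eval U h = χ := by
  let g : Γ(X, U) ⟶ .of ℂ := CommRingCat.ofHom (R := Γ(X, U)) χ.toRingHom
  let p : CPoint s := ⟨Spec.map g ≫ hU.fromSpec, specMap_fromSpec_comp hU g
    (CommRingCat.hom_ext (RingHom.ext fun r => χ.commutes r))⟩
  have hp : p.pt ∈ U := by
    have : p.pt ∈ Set.range hU.fromSpec := ⟨Spec.map g (IsLocalRing.closedPoint ℂ), rfl⟩
    rwa [hU.range_fromSpec] at this
  refine ⟨p, hp, ?_⟩
  have h1 : Spec.map g ≫ hU.fromSpec =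
    Spec.map (p.1.appLE U ⊤ (p.le_preimage hp) ≫ (Scheme.ΓSpecIso (.of ℂ)).hom) ≫ hU.fromSpec :=
      p.eq_specMap_fromSpec hU hp
  rw [cancel_mono] at h1
  have h2 := Spec.map_injective h1
  refine AlgHom.ext fun a => ?_
  exact (congrArg (fun g => (CommRingCat.Hom.hom g) a) h2).symm

lemma exists_isDiscreteValuationRing_of_ringEquiv {R R' : Type} [CommRing R] [CommRing R']
    (e : R ≃+* R') (h : ∃ _ : IsDomain R, IsDiscreteValuationRing R) :
    ∃ _ : IsDomain R', IsDiscreteValuationRing R' := by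
  obtain ⟨h1, h2⟩ := h
  have : IsDomain R' := e.symm.toMulEquiv.isDomain _
  exact ⟨this, IsDiscreteValuationRing.RingEquivClass.isDiscreteValuationRing e⟩

/-- The local rings of a smooth curve are discrete valuation rings. -/
lemma isDiscreteValuationRing_of_smooth (hs : SmoothOfRelativeDimension 1 s) (hU : IsAffineOpen U)
    (χ : Sec s U →ₐ[ℂ] ℂ) :
    ∃ _ : IsDomain (Localization.AtPrime (RingHom.ker χ)),
      IsDiscreteValuationRing (Localization.AtPrime (RingHom.ker χ)) := by
  obtain ⟨p, hp, rfl⟩ := exists_cpoint_eval_eq hU χ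
  obtain ⟨W, hW, V, hV, hx, e, hsm⟩ := hs.exists_isStandardSmoothOfRelativeDimension p.pt
  have hWtop : W = ⊤ := by
    refine top_le_iff.1 fun z _ => ?_
    rw [Subsingleton.elim (α := PrimeSpectrum ℂ) z (s p.pt)]
    exact e hx
  subst hWtop
  have hst : Algebra.IsStandardSmoothOfRelativeDimension 1 ℂ (Sec s V) := by
    rw [← RingHom.isStandardSmoothOfRelativeDimension_algebraMap]
    have h1 := (RingHom.IsStandardSmoothOfRelativeDimension.equiv
      (Scheme.ΓSpecIso (.of ℂ)).symm.commRingCatIsoToRingEquiv)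
    exact hsm.comp h1
  have h1 := isDiscreteValuationRing_of_isStandardSmooth hst (p.eval V hx)
  have h2 : Localization.AtPrime (RingHom.ker (p.eval V hx)) ≃+* X.presheaf.stalk p.pt :=
    let : Algebra (Sec s V) (X.presheaf.stalk p.pt) := (X.presheaf.germ V p.pt hx).hom.toAlgebra
    have := p.isLocalization_stalk hV hx
    (IsLocalization.algEquiv (RingHom.ker (p.eval V hx)).primeCompl _ _).toRingEquiv
  have h3 : X.presheaf.stalk p.pt ≃+* Localization.AtPrime (RingHom.ker (p.eval U hp)) :=
    let : Algebra (Sec s U) (X.presheaf.stalk p.pt) := (X.presheaf.germ U p.pt hp).hom.toAlgebra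
    have := p.isLocalization_stalk hU hp
    (IsLocalization.algEquiv (RingHom.ker (p.eval U hp)).primeCompl _ _).toRingEquiv
  exact exists_isDiscreteValuationRing_of_ringEquiv (h2.trans h3) h1

lemma length_quotient_of_ringEquiv {R R' : Type} [CommRing R] [CommRing R'] (e : R ≃+* R')
    (I : Ideal R) : Module.length R (R ⧸ I) = Module.length R' (R' ⧸ I.map (e : R →+* R')) := by
  rw [Module.length_quotient, Module.length_quotient]
  have : I.map (e : R →+* R') = (Ideal.relIsoOfBijective (e : R →+* R') e.bijective).symm I := rfl
  rw [this, Order.coheight_orderIso]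

lemma finiteType_sec [LocallyOfFiniteType s] (hU : IsAffineOpen U) :
    Algebra.FiniteType ℂ (Sec s U) := by
  rw [← RingHom.finiteType_algebraMap]
  have h1 := LocallyOfFiniteType.finiteType_appLE s (isAffineOpen_top (Spec (.of ℂ))) hU
    (le_preimage_top s U)
  exact h1.comp (RingHom.FiniteType.of_surjective _
    (Scheme.ΓSpecIso (.of ℂ)).symm.commRingCatIsoToRingEquiv.surjective)

end Points

section Ramification

variable {X Y : Scheme.{0}} {ρ : X ⟶ Y} {s : Y ⟶ Spec (.of ℂ)} {V : Y.Opens}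

/-- The multiplicity of a point in the fibre of `ρ` is the ramification index of its maximal ideal
in the ring of functions on an affine neighbourhood. -/
lemma ramMult_eq_ramificationIdx (hV : IsAffineOpen V) (hU : IsAffineOpen (ρ ⁻¹ᵁ V))
    (p : CPoint (ρ ≫ s)) (hp : p.pt ∈ ρ ⁻¹ᵁ V) :
    letI := (secPull s ρ V (ρ ⁻¹ᵁ V) le_rfl).toRingHom.toAlgebra
    ramMult ρ p.pt = (RingHom.ker (p.eval _ hp)).ramificationIdx (Sec s V) := by
  let algAB : Algebra (Sec s V) (Sec (ρ ≫ s) (ρ ⁻¹ᵁ V)) :=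
    (secPull s ρ V (ρ ⁻¹ᵁ V) le_rfl).toRingHom.toAlgebra
  let q := RingHom.ker (p.eval _ hp)
  let m := RingHom.ker ((p.map ρ).eval V hp)
  have hunder : q.under (Sec s V) = m := by
    have h := CPoint.eval_secPull ρ p le_rfl hp hp
    ext a
    change p.eval _ hp (secPull s ρ V (ρ ⁻¹ᵁ V) le_rfl a) = 0 ↔ (p.map ρ).eval V hp a = 0
    rw [← h]
    rfl
  have hlies : q.LiesOver m := ⟨hunder.symm⟩
  let algY : Algebra (Sec s V) (Y.presheaf.stalk (ρ p.pt)) :=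
    (Y.presheaf.germ V (ρ p.pt) hp).hom.toAlgebra
  let algX : Algebra (Sec (ρ ≫ s) (ρ ⁻¹ᵁ V)) (X.presheaf.stalk p.pt) :=
    (X.presheaf.germ (ρ ⁻¹ᵁ V) p.pt hp).hom.toAlgebra
  have hlY : IsLocalization.AtPrime (Y.presheaf.stalk (ρ p.pt)) m :=
    (p.map ρ).isLocalization_stalk hV hp
  have hlX : IsLocalization.AtPrime (X.presheaf.stalk p.pt) q := p.isLocalization_stalk hU hp
  have hmax : IsLocalRing.maximalIdeal (Y.presheaf.stalk (ρ p.pt)) =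
      m.map (algebraMap (Sec s V) (Y.presheaf.stalk (ρ p.pt))) :=
    (IsLocalization.AtPrime.map_eq_maximalIdeal m _).symm
  let e : Localization.AtPrime q ≃ₐ[Sec (ρ ≫ s) (ρ ⁻¹ᵁ V)] X.presheaf.stalk p.pt :=
    IsLocalization.algEquiv q.primeCompl _ _
  have hcomm : ((ρ.stalkMap p.pt).hom).comp (algebraMap (Sec s V) (Y.presheaf.stalk (ρ p.pt))) =
      (algebraMap (Sec (ρ ≫ s) (ρ ⁻¹ᵁ V)) (X.presheaf.stalk p.pt)).comp
        (algebraMap (Sec s V) (Sec (ρ ≫ s) (ρ ⁻¹ᵁ V))) := by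
    refine RingHom.ext fun a => ?_
    have := ρ.germ_stalkMap_apply V p.pt hp a
    rw [Scheme.Hom.app_eq_appLE] at this
    exact this
  have hecomm : ((e.toRingEquiv : Localization.AtPrime q ≃+* _) : _ →+* _).comp
      (algebraMap (Sec (ρ ≫ s) (ρ ⁻¹ᵁ V)) (Localization.AtPrime q)) =
      algebraMap (Sec (ρ ≫ s) (ρ ⁻¹ᵁ V)) (X.presheaf.stalk p.pt) :=
    RingHom.ext fun a => e.commutes a
  change _ = q.ramificationIdx (Sec s V)
  rw [Ideal.ramificationIdx_eq m, ramMult,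
    length_quotient_of_ringEquiv e.toRingEquiv, Ideal.map_map, hmax, Ideal.map_map, hcomm,
    ← hecomm, RingHom.comp_assoc, ← IsScalarTower.algebraMap_eq]

end Ramification

end CurveLift

/-! ### Freeness and rank of finite flat morphisms -/

namespace SymTensor

/-- A finitely presented flat algebra is free over a neighbourhood of any given prime. -/
lemma exists_free_of_isLocalization_away {A B : Type} [CommRing A] [CommRing B] [Algebra A B]
    [Module.FinitePresentation A B] [Module.Flat A B] (p : Ideal A) [p.IsPrime] :
    ∃ g ∉ p, ∀ (A' B' : Type) [CommRing A'] [CommRing B'] [Algebra A A'] [Algebra B B']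
      [Algebra A' B'] [Algebra A B'] [IsScalarTower A A' B'] [IsScalarTower A B B']
      [IsLocalization.Away g A'] [IsLocalization.Away (algebraMap A B g) B'],
      Module.Free A' B' := by
  have : Module.Free (Localization.AtPrime p) (LocalizedModule p.primeCompl B) :=
    Module.free_of_flat_of_isLocalRing
  obtain ⟨g, hg, hfree, -⟩ := Module.FinitePresentation.exists_free_localizedModule_powers
    p.primeCompl (LocalizedModule.mkLinearMap p.primeCompl B) (Localization.AtPrime p)
  refine ⟨g, hg, ?_⟩
  intro A' B' _ _ _ _ _ _ _ _ _ hB'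
  let e : Localization.Away g ≃ₐ[A] A' := IsLocalization.algEquiv (.powers g) _ _
  let : Module (Localization.Away g) B' := Module.compHom B' e.toRingEquiv.toRingHom
  have : IsScalarTower A (Localization.Away g) B' := by
    refine ⟨fun a l x => ?_⟩
    change e (a • l) • x = a • (e l • x)
    rw [map_smul, smul_assoc]
  have hM : IsLocalization (Algebra.algebraMapSubmonoid B (Submonoid.powers g)) B' := by
    rw [Algebra.algebraMapSubmonoid_powers]
    exact hB'
  let f : B →ₗ[A] B' := (IsScalarTower.toAlgHom A B B').toLinearMap
  have hf : IsLocalizedModule (Submonoid.powers g) f :=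
    (isLocalizedModule_iff_isLocalization).2 hM
  let i := (IsLocalizedModule.iso (Submonoid.powers g) f).extendScalarsOfIsLocalization
    (Submonoid.powers g) (Localization.Away g)
  let b := (Module.Free.chooseBasis (Localization.Away g) (LocalizedModule.Away g B)).map i
  exact .of_basis (b.mapCoeffs e.toRingEquiv fun c x => rfl)

end SymTensor

namespace CurveLift

open SymTensor

section Rank

variable {X Y : Scheme.{0}} (f : X ⟶ Y) {V : Y.Opens}

lemma isPullback_fromSpec (hV : IsAffineOpen V) (hU : IsAffineOpen (f ⁻¹ᵁ V)) :
    IsPullback hU.fromSpec (Spec.map (f.appLE V (f ⁻¹ᵁ V) le_rfl)) f hV.fromSpec := by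
  refine (IsOpenImmersion.isPullback _ _ _ _ ?_ ?_).flip
  · exact (IsAffineOpen.SpecMap_appLE_fromSpec f hV hU le_rfl).symm
  · rw [hU.opensRange_fromSpec, hV.opensRange_fromSpec]

lemma finrank_appLE [IsFinite f] [Flat f] (hV : IsAffineOpen V) (y : PrimeSpectrum Γ(Y, V)) :
    (f.appLE V (f ⁻¹ᵁ V) le_rfl).hom.finrank y = f.finrank (hV.fromSpec y) := by
  have hU := hV.preimage f
  have h1 : (f.appLE V (f ⁻¹ᵁ V) le_rfl).hom.Finite := by
    rw [← Scheme.Hom.app_eq_appLE]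
    exact f.finite_app V hV
  have h2 := f.flat_appLE hV hU le_rfl
  rw [← Scheme.Hom.finrank_of_isPullback _ _ _ _ (isPullback_fromSpec f hV hU) y,
    Scheme.Hom.finrank_SpecMap_eq_finrank h1 h2]

end Rank

end CurveLift

/-! ### Étale algebras of rank two -/

namespace SymTensor

/-- A finite étale algebra of rank two is a double cover: its fibre over a complex point is a finite
étale algebra over the complex numbers, hence a product of two copies of them. -/
lemma isDoubleCover_of_formallyEtale {B C : Type} [CommRing B] [CommRing C] [Algebra ℂ B]
    [Algebra ℂ C] [Algebra B C] [IsScalarTower ℂ B C] [Module.Finite B C] [Module.Flat B C]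
    [Algebra.FormallyEtale B C] (hrank : ∀ p : PrimeSpectrum B, Module.rankAtStalk C p = 2) :
    IsDoubleCover (IsScalarTower.toAlgHom ℂ B C) := by
  classical
  intro p
  let : Algebra B ℂ := p.toRingHom.toAlgebra
  have hal : ∀ b, algebraMap B ℂ b = p b := fun _ => rfl
  let F := ℂ ⊗[B] C
  let z₀ : PrimeSpectrum ℂ := ⊥
  have hdim : Module.finrank ℂ F = 2 := by
    have h1 := Module.rankAtStalk_baseChange (R := B) (M := C) (S := ℂ) z₀
    rw [hrank, Module.rankAtStalk_eq_finrank_of_free] at h1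
    exact h1
  let e : F ≃ₐ[ℂ] (PrimeSpectrum F → ℂ) := Algebra.FormallyEtale.equivPiOfIsSepClosed ℂ F
  have : IsArtinianRing F := IsArtinianRing.of_finite ℂ F
  have : Fintype (PrimeSpectrum F) := Fintype.ofFinite _
  have hcard : Fintype.card (PrimeSpectrum F) = 2 := by
    rw [← hdim, e.toLinearEquiv.finrank_eq, Module.finrank_fintype_fun_eq_card]
  obtain ⟨P, Q, hPQ, huniv⟩ := Finset.card_eq_two.1 (Finset.card_univ.trans hcard)
  let ι : C →+* F := (Algebra.TensorProduct.includeRight : C →ₐ[B] F).toRingHom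
  have hι : ∀ c, ι c = (1 : ℂ) ⊗ₜ[B] c := fun _ => rfl
  have hιB : ∀ b, ι (algebraMap B C b) = algebraMap ℂ F (p b) := fun b =>
    (Algebra.TensorProduct.includeRight : C →ₐ[B] F).commutes b
  let ev : PrimeSpectrum F → (C →ₐ[ℂ] ℂ) := fun M =>
    { (Pi.evalRingHom (fun _ : PrimeSpectrum F => ℂ) M).comp ((e : F →+* _).comp ι) with
      commutes' := fun z => by
        change e (ι (algebraMap ℂ C z)) M = z
        rw [IsScalarTower.algebraMap_apply ℂ B C, hιB, AlgHom.commutes, AlgEquiv.commutes]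
        rfl }
  have hev : ∀ M c, ev M c = e (ι c) M := fun _ _ => rfl
  have hevκ : ∀ M, (ev M).comp (IsScalarTower.toAlgHom ℂ B C) = p := fun M =>
    AlgHom.ext fun b => by
      change e (ι (algebraMap B C b)) M = p b
      rw [hιB, AlgEquiv.commutes]
      rfl
  have hsurj : Function.Surjective ι := by
    intro x
    induction x using TensorProduct.induction_on with
    | zero => exact ⟨0, map_zero _⟩
    | tmul z c =>
      refine ⟨algebraMap ℂ C z * c, ?_⟩
      rw [hι, IsScalarTower.algebraMap_apply ℂ B C, ← Algebra.smul_def, ← TensorProduct.smul_tmul,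
        Algebra.smul_def, hal, AlgHom.commutes, mul_one]
      rfl
    | add x y hx hy =>
      obtain ⟨a, rfl⟩ := hx
      obtain ⟨b, rfl⟩ := hy
      exact ⟨a + b, map_add _ _ _⟩
  have hker : ∀ c, ι c = 0 → c ∈ (RingHom.ker p).map (IsScalarTower.toAlgHom ℂ B C) := by
    intro c hc
    let J := (RingHom.ker p).map (IsScalarTower.toAlgHom ℂ B C)
    let φ : ℂ →ₐ[B] C ⧸ J :=
      { algebraMap ℂ (C ⧸ J) with
        commutes' := fun b => by
          change Ideal.Quotient.mk J (algebraMap ℂ C (p b)) =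
            Ideal.Quotient.mk J (algebraMap B C b)
          rw [Ideal.Quotient.eq, IsScalarTower.algebraMap_apply ℂ B C, ← map_sub]
          refine Ideal.mem_map_of_mem (IsScalarTower.toAlgHom ℂ B C) ?_
          rw [RingHom.mem_ker, map_sub, AlgHom.commutes]
          exact sub_self _ }
    let ψ : F →ₐ[B] C ⧸ J := Algebra.TensorProduct.lift φ (IsScalarTower.toAlgHom B C (C ⧸ J))
      fun _ _ => Commute.all _ _
    have h1 : ψ (ι c) = Ideal.Quotient.mk J c := by
      rw [hι, Algebra.TensorProduct.lift_tmul, map_one, one_mul]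
      rfl
    rw [hc, map_zero] at h1
    exact Ideal.Quotient.eq_zero_iff_mem.1 h1.symm
  have hinf : RingHom.ker (ev P) ⊓ RingHom.ker (ev Q) ≤
      (RingHom.ker p).map (IsScalarTower.toAlgHom ℂ B C) := by
    rintro c ⟨hc, hc'⟩
    refine hker c (e.injective ?_)
    rw [map_zero]
    funext M
    have : M ∈ ({P, Q} : Finset _) := huniv ▸ Finset.mem_univ M
    rcases Finset.mem_insert.1 this with rfl | h
    · exact hc
    · obtain rfl := Finset.mem_singleton.1 h
      exact hc'
  refine ⟨ev P, ev Q, ?_, ?_, hinf⟩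
  · intro h
    obtain ⟨c, hc⟩ := hsurj (e.symm (Pi.single P 1))
    have h1 := DFunLike.congr_fun h c
    rw [hev, hev, hc, AlgEquiv.apply_symm_apply, Pi.single_eq_same, Pi.single_eq_of_ne hPQ.symm]
      at h1
    exact one_ne_zero h1
  · intro r
    constructor
    · intro hr
      have h1 : (RingHom.ker p).map (IsScalarTower.toAlgHom ℂ B C) ≤ RingHom.ker r := by
        rw [Ideal.map_le_iff_le_comap]
        intro b hb
        have := DFunLike.congr_fun hr b
        exact this.trans hb
      have := RingHom.ker_isPrime r
      rcases (Ideal.IsPrime.inf_le ‹_›).1 (hinf.trans h1) with h | h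
      · exact Or.inl (algHom_eq_of_ker_le h).symm
      · exact Or.inr (algHom_eq_of_ker_le h).symm
    · rintro (rfl | rfl) <;> exact hevκ _

end SymTensor

/-! ### Affine open subsets over which the covering is free -/

namespace CurveLift

open SymTensor

section Pull

variable {X Y : Scheme.{0}} (f : X ⟶ Y) (s : Y ⟶ Spec (.of ℂ)) {V : Y.Opens}

/-- Pullback of functions to the full preimage. -/
abbrev secPre (V : Y.Opens) : Sec s V →ₐ[ℂ] Sec (f ≫ s) (f ⁻¹ᵁ V) := secPull s f V (f ⁻¹ᵁ V) le_rfl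

lemma finite_secPre [IsFinite f] (hV : IsAffineOpen V) : (secPre f s V).toRingHom.Finite := by
  have := f.finite_app V hV
  rw [Scheme.Hom.app_eq_appLE] at this
  exact this

lemma flat_secPre [Flat f] [IsAffineHom f] (hV : IsAffineOpen V) :
    (secPre f s V).toRingHom.Flat :=
  f.flat_appLE hV (hV.preimage f) le_rfl

lemma formallyEtale_secPre [Etale f] [IsAffineHom f] (hV : IsAffineOpen V) :
    (secPre f s V).toRingHom.FormallyEtale :=
  (f.etale_appLE hV (hV.preimage f) le_rfl).formallyEtale

lemma finrank_secPre [IsFinite f] [Flat f] (hV : IsAffineOpen V) {d : ℕ}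
    (hd : ∀ y, f.finrank y = d) (y : PrimeSpectrum (Sec s V)) :
    (secPre f s V).toRingHom.finrank y = d :=
  (finrank_appLE f hV y).trans (hd _)

lemma isDoubleCover_secPre [IsFinite f] [Etale f] (hV : IsAffineOpen V)
    (hd : ∀ y, f.finrank y = 2) : IsDoubleCover (secPre f s V) := by
  let : Algebra (Sec s V) (Sec (f ≫ s) (f ⁻¹ᵁ V)) := (secPre f s V).toRingHom.toAlgebra
  have : IsScalarTower ℂ (Sec s V) (Sec (f ≫ s) (f ⁻¹ᵁ V)) :=
    IsScalarTower.of_algebraMap_eq fun r => ((secPre f s V).commutes r).symm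
  have : Module.Finite (Sec s V) (Sec (f ≫ s) (f ⁻¹ᵁ V)) := finite_secPre f s hV
  have : Module.Flat (Sec s V) (Sec (f ≫ s) (f ⁻¹ᵁ V)) := flat_secPre f s hV
  have : Algebra.FormallyEtale (Sec s V) (Sec (f ≫ s) (f ⁻¹ᵁ V)) := formallyEtale_secPre f s hV
  exact isDoubleCover_of_formallyEtale (B := Sec s V) (C := Sec (f ≫ s) (f ⁻¹ᵁ V))
    (finrank_secPre f s hV hd)

/-- The affine open subsets over which the functions on the preimage form a free module of rank
`n`. -/
structure IsFreeChart (n : ℕ) (V : Y.Opens) : Prop where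
  isAffineOpen : IsAffineOpen V
  free : letI := (secPre f s V).toRingHom.toAlgebra
    Module.Free (Sec s V) (Sec (f ≫ s) (f ⁻¹ᵁ V))
  finrank_eq : letI := (secPre f s V).toRingHom.toAlgebra
    Module.finrank (Sec s V) (Sec (f ≫ s) (f ⁻¹ᵁ V)) = n

lemma mem_basicOpen_iff_notMem_primeIdealOf (hV : IsAffineOpen V) (y : V) (g : Γ(Y, V)) :
    y.1 ∈ Y.basicOpen g ↔ g ∉ (hV.primeIdealOf y).asIdeal := by
  have h1 : hV.primeIdealOf y ∈ hV.fromSpec ⁻¹ᵁ Y.basicOpen g ↔ y.1 ∈ Y.basicOpen g := by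
    change hV.fromSpec (hV.primeIdealOf y) ∈ Y.basicOpen g ↔ _
    rw [hV.fromSpec_primeIdealOf]
  rw [← h1, hV.fromSpec_preimage_basicOpen]
  rfl

/-- A finite flat morphism of constant rank is free over a basic open neighbourhood of each point of
an affine open subset. -/
lemma exists_isFreeChart [IsFinite f] [Flat f] [LocallyOfFiniteType s] {n : ℕ}
    (hn : ∀ y, f.finrank y = n) (hV : IsAffineOpen V) {y : Y} (hy : y ∈ V) :
    ∃ g : Sec s V, y ∈ Y.basicOpen (U := V) g ∧ IsFreeChart f s n (Y.basicOpen (U := V) g) := by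
  let : Algebra (Sec s V) (Sec (f ≫ s) (f ⁻¹ᵁ V)) := (secPre f s V).toRingHom.toAlgebra
  have : IsScalarTower ℂ (Sec s V) (Sec (f ≫ s) (f ⁻¹ᵁ V)) :=
    IsScalarTower.of_algebraMap_eq fun r => ((secPre f s V).commutes r).symm
  have : Module.Finite (Sec s V) (Sec (f ≫ s) (f ⁻¹ᵁ V)) := finite_secPre f s hV
  have : Module.Flat (Sec s V) (Sec (f ≫ s) (f ⁻¹ᵁ V)) := flat_secPre f s hV
  have : Algebra.FiniteType ℂ (Sec s V) := finiteType_sec hV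
  have : IsNoetherianRing (Sec s V) := Algebra.FiniteType.isNoetherianRing ℂ _
  have : Module.FinitePresentation (Sec s V) (Sec (f ≫ s) (f ⁻¹ᵁ V)) :=
    Module.finitePresentation_of_finite _ _
  let P : Ideal (Sec s V) := (hV.primeIdealOf ⟨y, hy⟩).asIdeal
  have hP : P.IsPrime := (hV.primeIdealOf ⟨y, hy⟩).isPrime
  obtain ⟨g, hg, H⟩ := exists_free_of_isLocalization_away (A := Sec s V)
    (B := Sec (f ≫ s) (f ⁻¹ᵁ V)) P
  have hyg : y ∈ Y.basicOpen (U := V) g :=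
    (mem_basicOpen_iff_notMem_primeIdealOf hV ⟨y, hy⟩ g).2 hg
  let W : Y.Opens := Y.basicOpen (U := V) g
  have hW : W ≤ V := Y.basicOpen_le g
  have hWa : IsAffineOpen W := hV.basicOpen g
  have hfW : f ⁻¹ᵁ W ≤ f ⁻¹ᵁ V := f.preimage_mono hW
  refine ⟨g, hyg, ?_⟩
  let : Algebra (Sec s W) (Sec (f ≫ s) (f ⁻¹ᵁ W)) := (secPre f s W).toRingHom.toAlgebra
  let : Algebra (Sec s V) (Sec s W) := (secRes s hW).toRingHom.toAlgebra
  let : Algebra (Sec (f ≫ s) (f ⁻¹ᵁ V)) (Sec (f ≫ s) (f ⁻¹ᵁ W)) :=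
    (secRes (f ≫ s) hfW).toRingHom.toAlgebra
  let : Algebra (Sec s V) (Sec (f ≫ s) (f ⁻¹ᵁ W)) :=
    ((secPre f s W).comp (secRes s hW)).toRingHom.toAlgebra
  have : IsScalarTower (Sec s V) (Sec s W) (Sec (f ≫ s) (f ⁻¹ᵁ W)) :=
    IsScalarTower.of_algebraMap_eq fun _ => rfl
  have : IsScalarTower (Sec s V) (Sec (f ≫ s) (f ⁻¹ᵁ V)) (Sec (f ≫ s) (f ⁻¹ᵁ W)) :=
    IsScalarTower.of_algebraMap_eq fun a =>
      (DFunLike.congr_fun (secRes_secPull s f le_rfl le_rfl hW hfW) a).symm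
  have : IsLocalization.Away g (Sec s W) := isLocalization_secRes s hV g hW rfl
  have : IsLocalization.Away (algebraMap (Sec s V) (Sec (f ≫ s) (f ⁻¹ᵁ V)) g)
      (Sec (f ≫ s) (f ⁻¹ᵁ W)) :=
    isLocalization_secRes (f ≫ s) (hV.preimage f) (secPre f s V g) hfW (preimage_basicOpen_eq s f g)
  have hfree : Module.Free (Sec s W) (Sec (f ≫ s) (f ⁻¹ᵁ W)) := H _ _
  have hfin : Module.Finite (Sec s W) (Sec (f ≫ s) (f ⁻¹ᵁ W)) := finite_secPre f s hWa
  refine ⟨hWa, hfree, ?_⟩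
  have h1 := finrank_secPre f s hWa hn (hWa.primeIdealOf ⟨y, hyg⟩)
  have h2 : (secPre f s W).toRingHom.finrank =
    Module.rankAtStalk (R := Sec s W) (Sec (f ≫ s) (f ⁻¹ᵁ W)) :=
      RingHom.finrank_algebraMap (R := Sec s W) (S := Sec (f ≫ s) (f ⁻¹ᵁ W))
  rw [h2, Module.rankAtStalk_eq_finrank_of_free] at h1
  exact h1

end Pull

end CurveLift

/-! ### Fibre divisors and traces -/

namespace CurveLift

open SymTensor

lemma CPoint.eval_congr {X : Scheme.{0}} {s : X ⟶ Spec (.of ℂ)} {U : X.Opens} {p p' : CPoint s}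
    (hp : p.pt ∈ U) (hp' : p'.pt ∈ U) (h : p = p') : p.eval U hp = p'.eval U hp' := by
  subst h
  rfl

lemma coe_ofFn_eq_map {n : ℕ} {α : Type*} (x : Fin n → α) :
    Multiset.ofList (List.ofFn x) = Finset.univ.val.map x := (Fin.univ_val_map x).symm

lemma coe_ofFn_eq_iff {n : ℕ} {α : Type*} {x x' : Fin n → α} :
    Multiset.ofList (List.ofFn x) = Multiset.ofList (List.ofFn x') ↔
      ∃ σ : Equiv.Perm (Fin n), ∀ i, x' (σ i) = x i := by
  rw [coe_ofFn_eq_map, coe_ofFn_eq_map]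
  refine ⟨exists_perm_of_map_eq, ?_⟩
  rintro ⟨σ, h⟩
  have : x = x' ∘ σ := funext fun i => (h i).symm
  rw [this, ← Multiset.map_map]
  congr 1
  have := Finset.map_univ_equiv σ
  conv_rhs => rw [← this]
  rfl

lemma count_coe_ofFn {α : Type*} [DecidableEq α] {n : ℕ} (x : Fin n → α) (a : α) :
    (Multiset.ofList (List.ofFn x)).count a = Nat.card {i // x i = a} := by
  rw [coe_ofFn_eq_map, Multiset.count_map, Nat.card_eq_fintype_card, Fintype.card_subtype]
  simp only [eq_comm (a := a)]
  rfl

/-- Two fibres of the same point are equal up to the order. -/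
lemma exists_perm_of_isTraceFibre {n : ℕ} {A B : Type} [CommRing A] [Algebra ℂ A] [CommRing B]
    [Algebra ℂ B] {tr : B → A} {y : A →ₐ[ℂ] ℂ} {x x' : Fin n → (B →ₐ[ℂ] ℂ)}
    (h : IsTraceFibre tr y x) (h' : IsTraceFibre tr y x') :
    ∃ σ : Equiv.Perm (Fin n), ∀ i, x' (σ i) = x i := by
  refine exists_perm_of_map_eq (multiset_eq_of_sum_eq fun b => ?_)
  rw [Multiset.map_map, Multiset.map_map]
  exact (h b).trans (h' b).symm

section Trace

variable {X Y : Scheme.{0}} (ρ : X ⟶ Y) (s : Y ⟶ Spec (.of ℂ)) {n : ℕ} {V : Y.Opens}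

/-- The trace of functions on the preimage of `V`. -/
noncomputable def secTrace (V : Y.Opens) : Sec (ρ ≫ s) (ρ ⁻¹ᵁ V) → Sec s V :=
  letI := (secPre ρ s V).toRingHom.toAlgebra
  Algebra.trace (Sec s V) (Sec (ρ ≫ s) (ρ ⁻¹ᵁ V))

variable {ρ s}

lemma map_eq_of_eval_comp (hV : IsAffineOpen V) {y : CPoint s} (hy : y.pt ∈ V)
    {p : CPoint (ρ ≫ s)} (hp : p.pt ∈ ρ ⁻¹ᵁ V)
    (h : (p.eval _ hp).comp (secPre ρ s V) = y.eval V hy) : p.map ρ = y :=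
  CPoint.eq_of_eval_eq hV hp hy (by rw [← h, secPre, CPoint.eval_secPull ρ p le_rfl hp hp])

lemma eval_comp_of_map_eq {y : CPoint s} (hy : y.pt ∈ V)
    {p : CPoint (ρ ≫ s)} (hp : p.pt ∈ ρ ⁻¹ᵁ V) (h : p.map ρ = y) :
    (p.eval _ hp).comp (secPre ρ s V) = y.eval V hy := by
  subst h
  exact CPoint.eval_secPull ρ p le_rfl hp hy

lemma mem_preimage_of_map_eq {y : CPoint s} (hy : y.pt ∈ V) {p : CPoint (ρ ≫ s)}
    (h : p.map ρ = y) : p.pt ∈ ρ ⁻¹ᵁ V := by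
  subst h
  exact hy

/-- The fibre divisor consists of `n` points, and the values of a function at these points add up to
the trace. -/
lemma exists_isFibreDivisor [IsFinite ρ] (hV : IsFreeChart ρ s n V) (y : CPoint s)
    (hy : y.pt ∈ V) : ∃ (q : Fin n → CPoint (ρ ≫ s)) (hq : ∀ i, (q i).pt ∈ ρ ⁻¹ᵁ V),
      IsFibreDivisor ρ s y (Multiset.ofList (List.ofFn q)) ∧
      IsTraceFibre (secTrace ρ s V) (y.eval V hy) fun i => (q i).eval _ (hq i) := by
  classical
  let : Algebra (Sec s V) (Sec (ρ ≫ s) (ρ ⁻¹ᵁ V)) := (secPre ρ s V).toRingHom.toAlgebra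
  have : IsScalarTower ℂ (Sec s V) (Sec (ρ ≫ s) (ρ ⁻¹ᵁ V)) :=
    IsScalarTower.of_algebraMap_eq fun r => ((secPre ρ s V).commutes r).symm
  have : Module.Finite (Sec s V) (Sec (ρ ≫ s) (ρ ⁻¹ᵁ V)) := finite_secPre ρ s hV.isAffineOpen
  have : Module.Free (Sec s V) (Sec (ρ ≫ s) (ρ ⁻¹ᵁ V)) := hV.free
  obtain ⟨x, hxy, htr, hcard⟩ := exists_isTraceFibre_card hV.finrank_eq (y.eval V hy)
  have hU : IsAffineOpen (ρ ⁻¹ᵁ V) := hV.isAffineOpen.preimage ρ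
  choose q hq hqx using fun i => exists_cpoint_eval_eq hU (x i)
  have hqy : ∀ i, (q i).map ρ = y := fun i =>
    map_eq_of_eval_comp hV.isAffineOpen hy (hq i) (AlgHom.ext fun a => by
      rw [hqx]; exact hxy i a)
  refine ⟨q, hq, fun p => ?_, ?_⟩
  · have h0 := count_coe_ofFn q p
    split_ifs with hp
    · have hpV := mem_preimage_of_map_eq hy hp
      have h1 := hcard (p.eval _ hpV) fun a => DFunLike.congr_fun (eval_comp_of_map_eq hy hpV hp) a
      have h2 : ramMult ρ p.pt = (RingHom.ker (p.eval _ hpV)).ramificationIdx (Sec s V) :=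
        ramMult_eq_ramificationIdx hV.isAffineOpen hU p hpV
      rw [h2, ← h1]
      convert h0 using 1
      refine Nat.card_congr (Equiv.subtypeEquivRight fun i => ?_)
      rw [← hqx]
      exact ⟨fun h => CPoint.eq_of_eval_eq hU _ _ h, fun h => CPoint.eval_congr _ _ h⟩
    · have : IsEmpty {i // q i = p} := ⟨fun ⟨i, hi⟩ => hp (hi ▸ hqy i)⟩
      rw [Nat.card_of_isEmpty] at h0
      convert h0
  · intro b
    simp only [hqx]
    exact htr b

lemma isFibreDivisor_eq {y : CPoint s} {D D' : Multiset (CPoint (ρ ≫ s))}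
    (h : IsFibreDivisor ρ s y D) (h' : IsFibreDivisor ρ s y D') : D = D' := by
  classical
  exact Multiset.ext.2 fun p => (h p).trans (h' p).symm

/-- A divisor is the fibre over `y`, with multiplicities, if and only if the sum of the values of
any function at its points is the value at `y` of the trace. -/
lemma isFibreDivisor_iff_isTraceFibre [IsFinite ρ] (hV : IsFreeChart ρ s n V) {y : CPoint s}
    (hy : y.pt ∈ V) {x : Fin n → CPoint (ρ ≫ s)} (hx : ∀ i, (x i).pt ∈ ρ ⁻¹ᵁ V) :
    IsFibreDivisor ρ s y (Multiset.ofList (List.ofFn x)) ↔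
      IsTraceFibre (secTrace ρ s V) (y.eval V hy) fun i => (x i).eval _ (hx i) := by
  obtain ⟨q, hq, hqD, hqt⟩ := exists_isFibreDivisor hV y hy
  constructor
  · intro h b
    obtain ⟨σ, hσ⟩ := coe_ofFn_eq_iff.1 (isFibreDivisor_eq h hqD)
    have e : ∀ i, (x i).eval _ (hx i) b = (q (σ i)).eval _ (hq (σ i)) b := fun i =>
      DFunLike.congr_fun (CPoint.eval_congr (hx i) (hq (σ i)) (hσ i).symm) b
    refine Eq.trans ?_ (hqt b)
    rw [Finset.sum_congr rfl fun i _ => e i]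
    exact Equiv.sum_comp σ fun i => (q i).eval _ (hq i) b
  · intro h
    obtain ⟨σ, hσ⟩ := exists_perm_of_isTraceFibre h hqt
    have : Multiset.ofList (List.ofFn x) = Multiset.ofList (List.ofFn q) :=
      coe_ofFn_eq_iff.2 ⟨σ, fun i =>
        CPoint.eq_of_eval_eq (hV.isAffineOpen.preimage ρ) _ _ (hσ i)⟩
    rwa [this]

/-- The relations which define the fibre product, in terms of the trace. -/
lemma isPullbackFunction_eq_traceRel [IsFinite ρ] (hV : IsFreeChart ρ s n V) :
    IsPullbackFunction (n := n) ρ s V = TraceRel (secTrace ρ s V) := by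
  funext a f
  refine propext ⟨fun h => ?_, fun h => ?_⟩
  · intro y x hyx
    obtain ⟨y, hy, rfl⟩ := exists_cpoint_eval_eq hV.isAffineOpen y
    choose q hq hqx using fun i => exists_cpoint_eval_eq (hV.isAffineOpen.preimage ρ) (x i)
    obtain rfl : (fun i => (q i).eval _ (hq i)) = x := funext hqx
    exact h y hy q hq ((isFibreDivisor_iff_isTraceFibre hV hy hq).2 hyx)
  · intro y hy x hx hD
    exact h _ _ ((isFibreDivisor_iff_isTraceFibre hV hy hx).1 hD)

end Trace

end CurveLift

/-! ### Complex points of the charts -/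

namespace CurveLift

open SymTensor

section ChartPoint

variable {Xt X Y : Scheme.{0}} (κ : Xt ⟶ X) (ρ : X ⟶ Y) (s : Y ⟶ Spec (.of ℂ)) {n : ℕ}

/-- The point `χ` of the part of the fibre product over `V` is the pair of the point `y` and the
divisor `x₁ + ⋯ + xₙ`. -/
structure IsChartPoint (V : Y.Opens) (χ : liftRing κ ρ s n V →ₐ[ℂ] ℂ) (y : CPoint s)
    (x : Fin n → CPoint (κ ≫ ρ ≫ s)) : Prop where
  mem : y.pt ∈ V
  mem_preimage : ∀ i, (x i).pt ∈ κ ⁻¹ᵁ ρ ⁻¹ᵁ V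
  left : ∀ a, χ (liftLeft κ ρ s n V a) = y.eval V mem a
  right : ∀ t, χ (liftRight κ ρ s n V t) =
    prodLift (fun i => (x i).eval _ (mem_preimage i)) (t : TPow n _)

variable {κ ρ s} {V : Y.Opens}

lemma eval_comp_secPre {p : CPoint (κ ≫ ρ ≫ s)} (hp : p.pt ∈ κ ⁻¹ᵁ ρ ⁻¹ᵁ V) :
    (p.eval _ hp).comp (secPre κ (ρ ≫ s) (ρ ⁻¹ᵁ V)) = (p.map κ).eval (ρ ⁻¹ᵁ V) hp :=
  CPoint.eval_secPull κ p le_rfl hp hp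

lemma exists_isChartPoint [IsAffineHom κ] [IsFinite ρ] (hV : IsFreeChart ρ s n V)
    (χ : liftRing κ ρ s n V →ₐ[ℂ] ℂ) : ∃ y x, IsChartPoint κ ρ s V χ y x ∧
      IsFibreDivisor ρ s y (Multiset.ofList (List.ofFn fun i => (x i).map κ)) := by
  have hR : ∀ b, IsPullbackFunction (n := n) ρ s V (secTrace ρ s V b) (psum n b) := fun b => by
    rw [isPullbackFunction_eq_traceRel hV]
    exact traceRel_psum _ b
  obtain ⟨x', hx', htr⟩ := exists_point_eq hR χ
  obtain ⟨y, hy, hyχ⟩ := exists_cpoint_eval_eq hV.isAffineOpen (χ.comp (liftLeft κ ρ s n V))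
  choose x hx hxx using fun i =>
    exists_cpoint_eval_eq ((hV.isAffineOpen.preimage ρ).preimage κ) (x' i)
  obtain rfl : (fun i => (x i).eval _ (hx i)) = x' := funext hxx
  refine ⟨y, x, ⟨hy, hx, fun a => ?_, hx'⟩, ?_⟩
  · rw [hyχ]; rfl
  · rw [isFibreDivisor_iff_isTraceFibre hV hy (x := fun i => (x i).map κ) hx, hyχ]
    intro b
    rw [← htr b]
    refine Finset.sum_congr rfl fun i _ => ?_
    exact (DFunLike.congr_fun (eval_comp_secPre (hx i)) b).symm

/-- Every divisor which lifts the fibre over `y` gives a point. -/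
lemma exists_algHom_isChartPoint {y : CPoint s} (hy : y.pt ∈ V) {x : Fin n → CPoint (κ ≫ ρ ≫ s)}
    (h : IsFibreDivisor ρ s y (Multiset.ofList (List.ofFn fun i => (x i).map κ))) :
    ∃ χ : liftRing κ ρ s n V →ₐ[ℂ] ℂ, IsChartPoint κ ρ s V χ y x := by
  have hx : ∀ i, (x i).pt ∈ κ ⁻¹ᵁ ρ ⁻¹ᵁ V := fun i =>
    mem_preimage_of_map_eq hy (h.map_eq i)
  refine ⟨fibreLift _ _ (y.eval V hy) (evalSym fun i => (x i).eval _ (hx i)) ?_, hy, hx, ?_, ?_⟩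
  · intro a f hf
    rw [hf y hy (fun i => (x i).map κ) hx h, evalSym_apply, coe_tsMap, prodLift_tmap]
    congr 2
    funext i
    exact (eval_comp_secPre (hx i)).symm
  · exact fun a => fibreLift_left _ _ _ a
  · exact fun t => fibreLift_right _ _ _ t

variable {χ : liftRing κ ρ s n V →ₐ[ℂ] ℂ} {y : CPoint s} {x : Fin n → CPoint (κ ≫ ρ ≫ s)}

/-- A point over `y` is regular if its divisor contains the two points of the fibre of the double
cover over at most one point. -/
lemma IsChartPoint.isDomain_and_isPrincipalIdealRing [IsFinite κ] [Etale κ] [IsFinite ρ]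
    (hY : SmoothOfRelativeDimension 1 s) (hX : SmoothOfRelativeDimension 1 (ρ ≫ s))
    (hκ : ∀ x, κ.finrank x = 2) (hV : IsFreeChart ρ s n V) (h : IsChartPoint κ ρ s V χ y x)
    (hram : ∀ p : CPoint (ρ ≫ s), p.map ρ = y → ramMult ρ p.pt ≤ 2)
    (hpair : ∀ i j i' j', x i ≠ x j → (x i).map κ = (x j).map κ → x i' ≠ x j' →
      (x i').map κ = (x j').map κ → (x i).map κ = (x i').map κ) :
    IsDomain (Localization.AtPrime (RingHom.ker χ)) ∧
      IsPrincipalIdealRing (Localization.AtPrime (RingHom.ker χ)) := by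
  have hVa := hV.isAffineOpen
  have hU := hVa.preimage ρ
  let : Algebra (Sec s V) (Sec (ρ ≫ s) (ρ ⁻¹ᵁ V)) := (secPre ρ s V).toRingHom.toAlgebra
  have : IsScalarTower ℂ (Sec s V) (Sec (ρ ≫ s) (ρ ⁻¹ᵁ V)) :=
    IsScalarTower.of_algebraMap_eq fun r => ((secPre ρ s V).commutes r).symm
  have : Smooth s := SmoothOfRelativeDimension.smooth 1 s
  have : Algebra.FiniteType ℂ (Sec s V) := finiteType_sec hVa
  have : Algebra.FiniteType ℂ (Sec (κ ≫ ρ ≫ s) (κ ⁻¹ᵁ ρ ⁻¹ᵁ V)) := finiteType_sec (hU.preimage κ)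
  have : Algebra.FiniteType ℂ (Sec (ρ ≫ s) (ρ ⁻¹ᵁ V)) := finiteType_sec hU
  have : IsNoetherianRing (Sec (ρ ≫ s) (ρ ⁻¹ᵁ V)) := Algebra.FiniteType.isNoetherianRing ℂ _
  have : Module.Finite (Sec s V) (Sec (ρ ≫ s) (ρ ⁻¹ᵁ V)) := finite_secPre ρ s hVa
  have : Module.Free (Sec s V) (Sec (ρ ≫ s) (ρ ⁻¹ᵁ V)) := hV.free
  have hmap : ∀ i j, ((x i).eval _ (h.mem_preimage i)).comp (secPre κ (ρ ≫ s) (ρ ⁻¹ᵁ V)) =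
      ((x j).eval _ (h.mem_preimage j)).comp (secPre κ (ρ ≫ s) (ρ ⁻¹ᵁ V)) ↔
      (x i).map κ = (x j).map κ := fun i j => by
    rw [eval_comp_secPre, eval_comp_secPre]
    exact ⟨CPoint.eq_of_eval_eq hU _ _, CPoint.eval_congr _ _⟩
  -- the relation is a variable, so that it can be replaced by the equal relation `TraceRel`
  have key : ∀ (Rel : Sec s V → TS n (Sec (ρ ≫ s) (ρ ⁻¹ᵁ V)) → Prop)
      (χ : FibreRing (secPre κ (ρ ≫ s) (ρ ⁻¹ᵁ V)) Rel →ₐ[ℂ] ℂ),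
      Rel = TraceRel (Algebra.trace (Sec s V) (Sec (ρ ≫ s) (ρ ⁻¹ᵁ V))) →
      (∀ t, χ (fibreRight _ Rel t) =
        prodLift (fun i => (x i).eval _ (h.mem_preimage i)) (t : TPow n _)) →
      χ.comp (fibreLeft _ Rel) = y.eval V h.mem →
      IsDomain (Localization.AtPrime (RingHom.ker χ)) ∧
        IsPrincipalIdealRing (Localization.AtPrime (RingHom.ker χ)) := by
    rintro _ χ rfl hχ hy
    refine isDomain_and_isPrincipalIdealRing_of_subsingleton_pairs hV.finrank_eq
      (isDoubleCover_secPre κ (ρ ≫ s) hU hκ) (flat_secPre κ (ρ ≫ s) hU)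
      (finite_secPre κ (ρ ≫ s) hU).to_isIntegral hχ hy
      (isDiscreteValuationRing_of_smooth hY hVa _)
      (isDiscreteValuationRing_of_smooth hX hU) ?_ ?_
    · intro q hq
      obtain ⟨p, hp, rfl⟩ := exists_cpoint_eval_eq hU q
      have hpy : p.map ρ = y := map_eq_of_eval_comp hVa h.mem hp (AlgHom.ext hq)
      exact (ramMult_eq_ramificationIdx hVa hU p hp).ge.trans (hram p hpy)
    · intro i j i' j' h₁ h₁' h₂ h₂'
      rw [hmap] at h₁' h₂' ⊢
      exact hpair i j i' j' (fun e => h₁ (CPoint.eval_congr _ _ e)) h₁'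
        (fun e => h₂ (CPoint.eval_congr _ _ e)) h₂'
  exact key _ χ (isPullbackFunction_eq_traceRel hV) h.right (AlgHom.ext h.left)

/-- A point is singular if its divisor contains the fibres of the double cover over two distinct
points. -/
lemma IsChartPoint.not_isRegularLocalRing [IsFinite κ] [Etale κ] [IsFinite ρ]
    (hY : SmoothOfRelativeDimension 1 s) (hX : SmoothOfRelativeDimension 1 (ρ ≫ s))
    (hκ : ∀ x, κ.finrank x = 2) (hV : IsFreeChart ρ s n V) (h : IsChartPoint κ ρ s V χ y x)
    {i j i' j' : Fin n} (h₁ : x i ≠ x j) (h₁' : (x i).map κ = (x j).map κ) (h₂ : x i' ≠ x j')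
    (h₂' : (x i').map κ = (x j').map κ) (hne : (x i).map κ ≠ (x i').map κ) :
    ¬ IsRegularLocalRing (Localization.AtPrime (RingHom.ker χ)) := by
  have hVa := hV.isAffineOpen
  have hU := hVa.preimage ρ
  let : Algebra (Sec s V) (Sec (ρ ≫ s) (ρ ⁻¹ᵁ V)) := (secPre ρ s V).toRingHom.toAlgebra
  have : IsScalarTower ℂ (Sec s V) (Sec (ρ ≫ s) (ρ ⁻¹ᵁ V)) :=
    IsScalarTower.of_algebraMap_eq fun r => ((secPre ρ s V).commutes r).symm
  have : Smooth s := SmoothOfRelativeDimension.smooth 1 s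
  have : Algebra.FiniteType ℂ (Sec s V) := finiteType_sec hVa
  have : Algebra.FiniteType ℂ (Sec (κ ≫ ρ ≫ s) (κ ⁻¹ᵁ ρ ⁻¹ᵁ V)) := finiteType_sec (hU.preimage κ)
  have hinj : ∀ i j, (x i).eval _ (h.mem_preimage i) = (x j).eval _ (h.mem_preimage j) →
      x i = x j := fun i j => CPoint.eq_of_eval_eq (hU.preimage κ) _ _
  have hmap : ∀ i j, ((x i).eval _ (h.mem_preimage i)).comp (secPre κ (ρ ≫ s) (ρ ⁻¹ᵁ V)) =
      ((x j).eval _ (h.mem_preimage j)).comp (secPre κ (ρ ≫ s) (ρ ⁻¹ᵁ V)) ↔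
      (x i).map κ = (x j).map κ := fun i j => by
    rw [eval_comp_secPre, eval_comp_secPre]
    exact ⟨CPoint.eq_of_eval_eq hU _ _, CPoint.eval_congr _ _⟩
  -- the relation is a variable, so that it can be replaced by the equal relation `TraceRel`
  have key : ∀ (Rel : Sec s V → TS n (Sec (ρ ≫ s) (ρ ⁻¹ᵁ V)) → Prop)
      (χ : FibreRing (secPre κ (ρ ≫ s) (ρ ⁻¹ᵁ V)) Rel →ₐ[ℂ] ℂ),
      Rel = TraceRel (Algebra.trace (Sec s V) (Sec (ρ ≫ s) (ρ ⁻¹ᵁ V))) →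
      (∀ t, χ (fibreRight _ Rel t) =
        prodLift (fun i => (x i).eval _ (h.mem_preimage i)) (t : TPow n _)) →
      χ.comp (fibreLeft _ Rel) = y.eval V h.mem →
      ¬ IsRegularLocalRing (Localization.AtPrime (RingHom.ker χ)) := by
    rintro _ χ rfl hχ hy
    exact not_isRegularLocalRing_of_pairs (isDoubleCover_secPre κ (ρ ≫ s) hU hκ)
      (formallyEtale_secPre κ (ρ ≫ s) hU) hχ hy (isDiscreteValuationRing_of_smooth hY hVa _)
      (isDiscreteValuationRing_of_smooth hX hU) (fun e => h₁ (hinj _ _ e)) ((hmap _ _).2 h₁')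
      (fun e => h₂ (hinj _ _ e)) ((hmap _ _).2 h₂') fun e => hne ((hmap _ _).1 e)
  exact key _ χ (isPullbackFunction_eq_traceRel hV) h.right (AlgHom.ext h.left)

lemma finite_setOf_isChartPoint [IsFinite κ] [Etale κ] [IsFinite ρ]
    (hκ : ∀ x, κ.finrank x = 2) (hV : IsFreeChart ρ s n V) (y : CPoint s) :
    {χ : liftRing κ ρ s n V →ₐ[ℂ] ℂ | ∃ x, IsChartPoint κ ρ s V χ y x}.Finite := by
  by_cases hy : y.pt ∈ V
  · have key : ∀ Rel : Sec s V → TS n (Sec (ρ ≫ s) (ρ ⁻¹ᵁ V)) → Prop,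
        Rel = TraceRel (secTrace ρ s V) →
        {χ : FibreRing (secPre κ (ρ ≫ s) (ρ ⁻¹ᵁ V)) Rel →ₐ[ℂ] ℂ |
          χ.comp (fibreLeft _ Rel) = y.eval V hy}.Finite := by
      rintro _ rfl
      exact finite_setOf_comp_left_eq
        (isDoubleCover_secPre κ (ρ ≫ s) (hV.isAffineOpen.preimage ρ) hκ) (y.eval V hy)
    refine (key _ (isPullbackFunction_eq_traceRel hV)).subset ?_
    rintro χ ⟨x, hx⟩
    exact AlgHom.ext hx.left
  · refine Set.Finite.subset Set.finite_empty ?_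
    rintro χ ⟨x, hx⟩
    exact hy hx.mem

end ChartPoint

end CurveLift

/-! ### Charts of the fibre product and their local rings -/

namespace CurveLift

open SymTensor

section Chart

lemma isIso_stalkMap_of_isOpenImmersion {X Y : Scheme.{0}} (f : X ⟶ Y) [IsOpenImmersion f] (x : X) :
    IsIso (f.stalkMap x) := inferInstance

lemma nonempty_localization_ringEquiv_stalk {R : Type} [CommRing R] (P : PrimeSpectrum R) :
    Nonempty (Localization.AtPrime P.asIdeal ≃+* (Spec (.of R)).presheaf.stalk P) :=
  let : Algebra R ((Spec (.of R)).presheaf.stalk P) := StructureSheaf.stalkAlgebra R P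
  have : IsLocalization.AtPrime ((Spec (.of R)).presheaf.stalk P) P.asIdeal :=
    StructureSheaf.IsLocalization.to_stalk R P
  ⟨(IsLocalization.algEquiv P.asIdeal.primeCompl _ _).toRingEquiv⟩

lemma functor_map_comp_cover_f {S : Scheme.{0}} {𝒰 : S.OpenCover} [Category 𝒰.I₀]
    [𝒰.LocallyDirected] (d : 𝒰.RelativeGluingData) [Small.{0} 𝒰.I₀] [Quiver.IsThin 𝒰.I₀]
    {i j : 𝒰.I₀} (h : i ⟶ j) : d.functor.map h ≫ d.cover.f j = d.cover.f i :=
  Limits.colimit.w d.functor h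

variable {Xt X Y : Scheme.{0}} (κ : Xt ⟶ X) (ρ : X ⟶ Y) (s : Y ⟶ Spec (.of ℂ)) (n : ℕ)
  [NeZero n] [IsAffineHom κ] [IsAffineHom ρ]

instance (V : Y.AffineZariskiSite) : IsOpenImmersion (liftCurveChart κ ρ s n V) := by
  exact (Scheme.AffineZariskiSite.relativeGluingData
    (coequifibered_liftDiagramMap κ ρ s n)).cover.map_prop V

/-- Compatibility of the charts with restriction. -/
lemma specMap_liftRes_comp_liftCurveChart {V W : Y.AffineZariskiSite} (h : W ≤ V) :
    Spec.map (CommRingCat.ofHom (liftRes κ ρ s n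
      (Scheme.AffineZariskiSite.toOpens_mono h)).toRingHom) ≫ liftCurveChart κ ρ s n V =
      liftCurveChart κ ρ s n W :=
  functor_map_comp_cover_f (Scheme.AffineZariskiSite.relativeGluingData
    (coequifibered_liftDiagramMap κ ρ s n)) (homOfLE h)

/-- The local rings of the fibre product are those of its charts. -/
lemma isRegularLocalRing_stalk_iff (V : Y.AffineZariskiSite)
    (P : PrimeSpectrum (liftRing κ ρ s n V.1)) :
    IsRegularLocalRing ((liftCurve κ ρ s n).presheaf.stalk (liftCurveChart κ ρ s n V P)) ↔
      IsRegularLocalRing (Localization.AtPrime P.asIdeal) := by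
  let P' : Spec (.of (liftRing κ ρ s n V.1)) := P
  have h := isIso_stalkMap_of_isOpenImmersion (liftCurveChart κ ρ s n V) P'
  let e₁ := (asIso ((liftCurveChart κ ρ s n V).stalkMap P')).commRingCatIsoToRingEquiv
  obtain ⟨e₂⟩ := nonempty_localization_ringEquiv_stalk P
  exact ⟨fun _ => IsRegularLocalRing.of_ringEquiv (e₁.trans e₂.symm),
    fun _ => IsRegularLocalRing.of_ringEquiv (e₁.trans e₂.symm).symm⟩

lemma exists_liftCurveChart_eq (c : liftCurve κ ρ s n) :
    ∃ (V : Y.AffineZariskiSite) (P : PrimeSpectrum (liftRing κ ρ s n V.1)),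
      liftCurveChart κ ρ s n V P = c := by
  let d := Scheme.AffineZariskiSite.relativeGluingData (coequifibered_liftDiagramMap κ ρ s n)
  obtain ⟨P, hP⟩ := d.cover.covers c
  exact ⟨_, P, hP⟩

variable {κ ρ s n}

/-- A point of a chart at which `g` does not vanish lies on the chart over the basic open set of
`g`. -/
lemma mem_range_liftRes {V : Y.AffineZariskiSite} (g : Sec s V.1)
    {P : PrimeSpectrum (liftRing κ ρ s n V.1)} (hP : liftLeft κ ρ s n V.1 g ∉ P.asIdeal) :
    ∃ Q : PrimeSpectrum (liftRing κ ρ s n (V.basicOpen g).1),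
      liftCurveChart κ ρ s n (V.basicOpen g) Q = liftCurveChart κ ρ s n V P := by
  have hle : V.basicOpen g ≤ V := V.basicOpen_le g
  let := (liftRes κ ρ s n (Scheme.AffineZariskiSite.toOpens_mono hle)).toRingHom.toAlgebra
  have hloc : IsLocalization.Away (liftLeft κ ρ s n V.1 g)
      (liftRing κ ρ s n (V.basicOpen g).1) :=
    isLocalization_liftRes κ ρ s n V.2 g (Scheme.AffineZariskiSite.toOpens_mono hle) rfl
  have hr := PrimeSpectrum.localization_away_comap_range (liftRing κ ρ s n (V.basicOpen g).1)
    (liftLeft κ ρ s n V.1 g)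
  obtain ⟨Q, hQ⟩ : P ∈ Set.range (PrimeSpectrum.comap (algebraMap (liftRing κ ρ s n V.1)
      (liftRing κ ρ s n (V.basicOpen g).1))) := by
    rw [hr]
    exact hP
  refine ⟨Q, ?_⟩
  rw [← specMap_liftRes_comp_liftCurveChart κ ρ s n hle, ← hQ]
  rfl

end Chart

end CurveLift

/-! ### Points of the fibre product given by divisors -/

namespace CurveLift

open SymTensor

section PointOf

variable {Xt X Y : Scheme.{0}} {κ : Xt ⟶ X} {ρ : X ⟶ Y} {s : Y ⟶ Spec (.of ℂ)} {n : ℕ}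
  {V : Y.Opens} {χ χ' : liftRing κ ρ s n V →ₐ[ℂ] ℂ} {y : CPoint s}
  {x x' : Fin n → CPoint (κ ≫ ρ ≫ s)}

/-- A point of a chart is determined by its divisor. -/
lemma IsChartPoint.eq_of_coe_ofFn_eq (h : IsChartPoint κ ρ s V χ y x)
    (h' : IsChartPoint κ ρ s V χ' y x')
    (hx : Multiset.ofList (List.ofFn x) = Multiset.ofList (List.ofFn x')) : χ = χ' := by
  obtain ⟨σ, hσ⟩ := coe_ofFn_eq_iff.1 hx
  refine fibreAlgHom_ext (fun a => (h.left a).trans (h'.left a).symm) fun c => ?_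
  refine (h.right _).trans (Eq.trans ?_ (h'.right _).symm)
  rw [prodLift_psum, prodLift_psum]
  refine Eq.trans (Finset.sum_congr rfl fun i _ => ?_)
    (Equiv.sum_comp σ fun i => (x' i).eval _ (h'.mem_preimage i) c)
  exact DFunLike.congr_fun (CPoint.eval_congr (h.mem_preimage i) (h'.mem_preimage (σ i))
    (hσ i).symm) c

/-- The divisor of a point of a chart is determined by the point, since characters are independent.
-/
lemma IsChartPoint.coe_ofFn_eq [IsAffineHom κ] [IsAffineHom ρ] (hV : IsAffineOpen V)
    (h : IsChartPoint κ ρ s V χ y x) (h' : IsChartPoint κ ρ s V χ y x') :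
    Multiset.ofList (List.ofFn x) = Multiset.ofList (List.ofFn x') := by
  have h1 : ∃ σ : Equiv.Perm (Fin n), ∀ i, (x' (σ i)).eval _ (h'.mem_preimage (σ i)) =
      (x i).eval _ (h.mem_preimage i) := by
    refine exists_perm_of_map_eq (x := fun i => (x i).eval _ (h.mem_preimage i))
      (x' := fun i => (x' i).eval _ (h'.mem_preimage i)) (multiset_eq_of_sum_eq fun c => ?_)
    rw [Multiset.map_map, Multiset.map_map]
    have e := (h.right (psum n c)).symm.trans (h'.right (psum n c))
    rw [prodLift_psum, prodLift_psum] at e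
    exact e
  obtain ⟨σ, hσ⟩ := h1
  exact coe_ofFn_eq_iff.2 ⟨σ, fun i =>
    CPoint.eq_of_eval_eq ((hV.preimage ρ).preimage κ) _ _ (hσ i)⟩

lemma IsChartPoint.comp_liftRes {V W : Y.Opens} (h : W ≤ V) {χ : liftRing κ ρ s n W →ₐ[ℂ] ℂ}
    (hχ : IsChartPoint κ ρ s W χ y x) :
    IsChartPoint κ ρ s V (χ.comp (liftRes κ ρ s n h)) y x := by
  refine ⟨h hχ.mem, fun i => h (hχ.mem_preimage i), fun a => ?_, fun t => ?_⟩
  · refine (congrArg χ (liftRes_left κ ρ s n h a)).trans ?_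
    rw [hχ.left, ← CPoint.eval_secRes y h hχ.mem]
    rfl
  · refine (congrArg χ (liftRes_right κ ρ s n h t)).trans ?_
    rw [hχ.right, coe_tsMap, prodLift_tmap]
    simp only [CPoint.eval_secRes]

variable [NeZero n] [IsAffineHom κ] [IsAffineHom ρ]

/-- The point of the fibre product given by a complex point of a chart. -/
noncomputable def chartPoint (V : Y.AffineZariskiSite) (χ : liftRing κ ρ s n V.1 →ₐ[ℂ] ℂ) :
    liftCurve κ ρ s n :=
  liftCurveChart κ ρ s n V (Spec.map (CommRingCat.ofHom χ.toRingHom) (IsLocalRing.closedPoint ℂ))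

lemma isPointOf_iff {c : liftCurve κ ρ s n} {D : Multiset (CPoint (κ ≫ ρ ≫ s))} :
    IsPointOf κ ρ s n c y D ↔ ∃ V χ x, D = Multiset.ofList (List.ofFn x) ∧
      IsChartPoint κ ρ s V.1 χ y x ∧ c = chartPoint V χ :=
  ⟨fun ⟨V, hy, x, hx, χ, hD, hl, hr, hc⟩ => ⟨V, χ, x, hD, ⟨hy, hx, hl, hr⟩, hc⟩,
    fun ⟨V, χ, x, hD, ⟨hy, hx, hl, hr⟩, hc⟩ => ⟨V, hy, x, hx, χ, hD, hl, hr, hc⟩⟩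

lemma chartPoint_eq_of_asIdeal_eq {V : Y.AffineZariskiSite} {χ : liftRing κ ρ s n V.1 →ₐ[ℂ] ℂ}
    {P : PrimeSpectrum (liftRing κ ρ s n V.1)} (h : P.asIdeal = RingHom.ker χ) :
    chartPoint V χ = liftCurveChart κ ρ s n V P := by
  have : P = Spec.map (CommRingCat.ofHom χ.toRingHom) (IsLocalRing.closedPoint ℂ) :=
    PrimeSpectrum.ext (h.trans (specMap_closedPoint_asIdeal χ).symm)
  rw [this]
  rfl

lemma chartPoint_injective (V : Y.AffineZariskiSite) :
    Function.Injective (chartPoint (κ := κ) (ρ := ρ) (s := s) (n := n) V) := by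
  intro χ χ' h
  have h1 := (liftCurveChart κ ρ s n V).isOpenEmbedding.injective h
  have h2 := congrArg PrimeSpectrum.asIdeal h1
  exact algHom_eq_of_ker_le
    ((specMap_closedPoint_asIdeal χ).symm.trans (h2.trans (specMap_closedPoint_asIdeal χ'))).le

lemma chartPoint_comp_liftRes {V W : Y.AffineZariskiSite} (h : W ≤ V)
    (χ : liftRing κ ρ s n W.1 →ₐ[ℂ] ℂ) :
    chartPoint V (χ.comp (liftRes κ ρ s n (Scheme.AffineZariskiSite.toOpens_mono h))) =
      chartPoint W χ := by
  rw [chartPoint, chartPoint, ← specMap_liftRes_comp_liftCurveChart κ ρ s n h]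
  have : Spec.map (CommRingCat.ofHom
      (χ.comp (liftRes κ ρ s n (Scheme.AffineZariskiSite.toOpens_mono h))).toRingHom) =
      Spec.map (CommRingCat.ofHom χ.toRingHom) ≫ Spec.map (CommRingCat.ofHom
        (liftRes κ ρ s n (Scheme.AffineZariskiSite.toOpens_mono h)).toRingHom) := by
    rw [← Spec.map_comp]
    rfl
  rw [this]
  rfl

/-- Two points of the fibre product, possibly on different charts, which are given by the same
pair `(y, D)` are equal. -/
lemma IsChartPoint.chartPoint_eq {V V' : Y.AffineZariskiSite}
    {χ : liftRing κ ρ s n V.1 →ₐ[ℂ] ℂ} {χ' : liftRing κ ρ s n V'.1 →ₐ[ℂ] ℂ}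
    (hD : IsFibreDivisor ρ s y (Multiset.ofList (List.ofFn fun i => (x i).map κ)))
    (h : IsChartPoint κ ρ s V.1 χ y x) (h' : IsChartPoint κ ρ s V'.1 χ' y x')
    (hx : Multiset.ofList (List.ofFn x) = Multiset.ofList (List.ofFn x')) :
    chartPoint V χ = chartPoint V' χ' := by
  obtain ⟨f, g, hfg, hyf⟩ := exists_basicOpen_le_affine_inter V.2 V'.2 y.pt ⟨h.mem, h'.mem⟩
  have hW : V.basicOpen f = V'.basicOpen g := Subtype.ext hfg
  have hle : V.basicOpen f ≤ V := V.basicOpen_le f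
  have hle' : V.basicOpen f ≤ V' := hW ▸ V'.basicOpen_le g
  obtain ⟨χ₁, h₁⟩ := exists_algHom_isChartPoint (V := (V.basicOpen f).1) hyf hD
  rw [h.eq_of_coe_ofFn_eq (h₁.comp_liftRes (Scheme.AffineZariskiSite.toOpens_mono hle)) rfl,
    h'.eq_of_coe_ofFn_eq (h₁.comp_liftRes (Scheme.AffineZariskiSite.toOpens_mono hle')) hx.symm,
    chartPoint_comp_liftRes hle χ₁, chartPoint_comp_liftRes hle' χ₁]

/-- A divisor on the double cover which maps to the fibre over `y` defines exactly one point of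
the fibre product. -/
lemma existsUnique_isPointOf
    (hD : IsFibreDivisor ρ s y (Multiset.ofList (List.ofFn fun i => (x i).map κ))) :
    ∃! c, IsPointOf κ ρ s n c y (Multiset.ofList (List.ofFn x)) := by
  obtain ⟨_, ⟨W, hW, rfl⟩, hyW, -⟩ := Y.isBasis_affineOpens.exists_subset_of_mem_open
    (Set.mem_univ y.pt) isOpen_univ
  let V : Y.AffineZariskiSite := ⟨W, hW⟩
  obtain ⟨χ, hχ⟩ := exists_algHom_isChartPoint (κ := κ) (V := V.1) hyW hD
  refine ⟨chartPoint V χ, isPointOf_iff.2 ⟨V, χ, x, rfl, hχ, rfl⟩, fun c hc => ?_⟩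
  obtain ⟨V', χ', x', hx, hχ', rfl⟩ := isPointOf_iff.1 hc
  exact (hχ.chartPoint_eq hD hχ' hx).symm

/-- The point given by a divisor lies on each chart over a neighbourhood of `y`. -/
lemma IsPointOf.exists_isChartPoint {c : liftCurve κ ρ s n}
    (hc : IsPointOf κ ρ s n c y (Multiset.ofList (List.ofFn x)))
    (hD : IsFibreDivisor ρ s y (Multiset.ofList (List.ofFn fun i => (x i).map κ)))
    {V : Y.AffineZariskiSite} (hy : y.pt ∈ V.1) :
    ∃ χ, IsChartPoint κ ρ s V.1 χ y x ∧ chartPoint V χ = c := by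
  obtain ⟨χ, hχ⟩ := exists_algHom_isChartPoint (κ := κ) (V := V.1) hy hD
  exact ⟨χ, hχ, (existsUnique_isPointOf hD).unique (isPointOf_iff.2 ⟨V, χ, x, rfl, hχ, rfl⟩) hc⟩

/-- The divisor of a point of the fibre product is determined by the point. -/
lemma IsPointOf.coe_ofFn_eq {c : liftCurve κ ρ s n}
    (hc : IsPointOf κ ρ s n c y (Multiset.ofList (List.ofFn x)))
    (hc' : IsPointOf κ ρ s n c y (Multiset.ofList (List.ofFn x')))
    (hD : IsFibreDivisor ρ s y (Multiset.ofList (List.ofFn fun i => (x i).map κ)))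
    (hD' : IsFibreDivisor ρ s y (Multiset.ofList (List.ofFn fun i => (x' i).map κ))) :
    Multiset.ofList (List.ofFn x) = Multiset.ofList (List.ofFn x') := by
  obtain ⟨_, ⟨W, hW, rfl⟩, hyW, -⟩ := Y.isBasis_affineOpens.exists_subset_of_mem_open
    (Set.mem_univ y.pt) isOpen_univ
  obtain ⟨χ, hχ, rfl⟩ := hc.exists_isChartPoint hD (V := ⟨W, hW⟩) hyW
  obtain ⟨χ', hχ', h⟩ := hc'.exists_isChartPoint hD' (V := ⟨W, hW⟩) hyW
  obtain rfl := chartPoint_injective _ h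
  exact hχ.coe_ofFn_eq hW hχ'

end PointOf

/-- Each point of the fibre product lies on a chart over an open subset of `Y` over which `ρ` is
free. -/
lemma exists_isFreeChart_liftCurveChart_eq {Xt X Y : Scheme.{0}} {κ : Xt ⟶ X} {ρ : X ⟶ Y}
    {s : Y ⟶ Spec (.of ℂ)} {n : ℕ} [NeZero n] [IsAffineHom κ] [IsFinite ρ] [Flat ρ]
    [LocallyOfFiniteType s] (hρ : ∀ y, ρ.finrank y = n) (c : liftCurve κ ρ s n) :
    ∃ (V : Y.AffineZariskiSite) (P : PrimeSpectrum (liftRing κ ρ s n V.1)),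
      IsFreeChart ρ s n V.1 ∧ liftCurveChart κ ρ s n V P = c := by
  obtain ⟨V, P, rfl⟩ := exists_liftCurveChart_eq κ ρ s n c
  have hV : IsAffineOpen V.1 := V.2
  let p : Spec Γ(Y, V.1) := PrimeSpectrum.comap (liftLeft κ ρ s n V.1).toRingHom P
  have hp : hV.fromSpec p ∈ V.1 := by
    have : hV.fromSpec p ∈ Set.range hV.fromSpec := ⟨p, rfl⟩
    rwa [hV.range_fromSpec] at this
  obtain ⟨g, hg, hfree⟩ := exists_isFreeChart ρ s hρ hV hp
  have hgp : g ∉ p.asIdeal := by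
    have h1 : p ∈ hV.fromSpec ⁻¹ᵁ Y.basicOpen (U := V.1) g := hg
    have h2 := hV.fromSpec_preimage_basicOpen (f := g)
    have h3 : p ∈ PrimeSpectrum.basicOpen (R := Γ(Y, V.1)) g := h2 ▸ h1
    exact h3
  obtain ⟨Q, hQ⟩ := mem_range_liftRes (κ := κ) (ρ := ρ) (n := n) g (P := P) hgp
  exact ⟨V.basicOpen g, Q, hfree, hQ⟩

end CurveLift

/-! ### Counting double lifts -/

namespace CurveLift

open SymTensor

/-- A sum of `k` distinct points has `2 ^ k` lifts along a two-to-one map. -/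
lemma ncard_setOf_map_eq_val {α β : Type*} {m : α → β}
    (hm : ∀ b, {a | m a = b}.ncard = 2) (S : Finset β) :
    {E : Multiset α | E.map m = S.val}.ncard = 2 ^ S.card := by
  classical
  induction S using Finset.induction_on with
  | empty => simp
  | insert b S hb ih =>
    have himage : {E : Multiset α | E.map m = (insert b S).val} =
        (fun c : α × Multiset α => c.1 ::ₘ c.2) ''
          ({a | m a = b} ×ˢ {E : Multiset α | E.map m = S.val}) := by
      ext E
      change E.map m = _ ↔ _
      rw [Finset.insert_val_of_notMem hb]
      constructor
      · intro h
        obtain ⟨a, ha, hab, hE⟩ := (Multiset.map_eq_cons m E S.val b).2 h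
        exact ⟨(a, E.erase a), ⟨hab, hE⟩, Multiset.cons_erase ha⟩
      · rintro ⟨⟨a, E⟩, ⟨rfl, hE⟩, rfl⟩
        exact (Multiset.map_cons m a E).trans (congrArg _ hE)
    have hinj : Set.InjOn (fun c : α × Multiset α => c.1 ::ₘ c.2)
        ({a | m a = b} ×ˢ {E : Multiset α | E.map m = S.val}) := by
      rintro ⟨a, E⟩ ⟨rfl, hE⟩ ⟨a', E'⟩ ⟨ha', hE'⟩ h
      have haa' : a = a' := by
        have : a ∈ a' ::ₘ E' := by
          rw [← show a ::ₘ E = a' ::ₘ E' from h]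
          exact Multiset.mem_cons_self a E
        refine (Multiset.mem_cons.1 this).resolve_right fun h' => hb ?_
        have h'' := Multiset.mem_map_of_mem m h'
        rwa [show E'.map m = S.val from hE'] at h''
      subst haa'
      exact congrArg (Prod.mk a) ((Multiset.cons_inj_right a).1 h)
    rw [himage, hinj.ncard_image, Set.ncard_prod, hm, ih,
      Finset.card_insert_of_notMem hb, pow_succ']

section DoubleLift

variable {Xt X Y : Scheme.{0}} {κ : Xt ⟶ X} {ρ : X ⟶ Y} {s : Y ⟶ Spec (.of ℂ)}
  {y : CPoint s} {p₁ p₂ : CPoint (ρ ≫ s)}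

lemma exists_map_eq_pair [IsFinite κ] [Etale κ] (hκ : ∀ x, κ.finrank x = 2)
    (p : CPoint (ρ ≫ s)) :
    ∃ q q' : CPoint (κ ≫ ρ ≫ s), q ≠ q' ∧ {r : CPoint (κ ≫ ρ ≫ s) | r.map κ = p} = {q, q'} := by
  obtain ⟨_, ⟨U, hU, rfl⟩, hp, -⟩ := X.isBasis_affineOpens.exists_subset_of_mem_open
    (Set.mem_univ p.pt) isOpen_univ
  obtain ⟨q, q', hne, h, -⟩ := isDoubleCover_secPre κ (ρ ≫ s) hU hκ (p.eval U hp)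
  obtain ⟨q, hq, rfl⟩ := exists_cpoint_eval_eq (hU.preimage κ) q
  obtain ⟨q', hq', rfl⟩ := exists_cpoint_eval_eq (hU.preimage κ) q'
  refine ⟨q, q', fun e => hne (CPoint.eval_congr _ _ e), ?_⟩
  ext r
  constructor
  · intro hr
    have hrU := mem_preimage_of_map_eq hp hr
    exact ((h (r.eval _ hrU)).1 (eval_comp_of_map_eq hp hrU hr)).imp
      (CPoint.eq_of_eval_eq (hU.preimage κ) _ _) (CPoint.eq_of_eval_eq (hU.preimage κ) _ _)
  · rintro (rfl | rfl)
    · exact map_eq_of_eval_comp hU hp hq ((h _).2 (Or.inl rfl))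
    · exact map_eq_of_eval_comp hU hp hq' ((h _).2 (Or.inr rfl))

/-- The fibre divisor over `y` is `2 p₁ + 2 p₂` and the sum of the other points, which are distinct.
-/
lemma HasTwoRamificationPoints.exists_finset (hy : HasTwoRamificationPoints ρ s y p₁ p₂)
    {F : Multiset (CPoint (ρ ≫ s))} (hF : IsFibreDivisor ρ s y F) :
    ∃ S : Finset (CPoint (ρ ≫ s)), (∀ p, p ∈ S ↔ p.map ρ = y ∧ p ≠ p₁ ∧ p ≠ p₂) ∧
      F = {p₁, p₁, p₂, p₂} + S.val := by
  classical
  have h₁ : F.count p₁ = 2 := by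
    have := hF p₁
    rw [if_pos hy.map_left, hy.ramMult_left] at this
    convert this
  have h₂ : F.count p₂ = 2 := by
    have := hF p₂
    rw [if_pos hy.map_right, hy.ramMult_right] at this
    convert this
  have h₃ : ∀ p : CPoint (ρ ≫ s), p ≠ p₁ → p ≠ p₂ → F.count p = if p.map ρ = y then 1 else 0 := by
    intro p hp₁ hp₂
    have := hF p
    split_ifs with h
    · rw [if_pos h, hy.ramMult_other p h hp₁ hp₂] at this
      convert this
    · rw [if_neg h] at this
      convert this
  have hS : ∀ p, p ∈ F.toFinset.filter (fun p => p ≠ p₁ ∧ p ≠ p₂) ↔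
      p.map ρ = y ∧ p ≠ p₁ ∧ p ≠ p₂ := by
    intro p
    rw [Finset.mem_filter, Multiset.mem_toFinset]
    refine and_congr_left fun ⟨hp₁, hp₂⟩ => ?_
    rw [← Multiset.count_pos, h₃ p hp₁ hp₂]
    split_ifs with h <;> simp [h]
  refine ⟨_, hS, Multiset.ext.2 fun p => ?_⟩
  rw [Multiset.count_add, Multiset.count_eq_of_nodup (Finset.nodup _)]
  simp only [Multiset.insert_eq_cons, Multiset.count_cons, Multiset.count_singleton, Finset.mem_val,
    hS]
  by_cases hp₁ : p = p₁
  · subst hp₁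
    simp [h₁, hy.ne]
  · by_cases hp₂ : p = p₂
    · subst hp₂
      simp [h₂, hp₁]
    · simp [h₃ p hp₁ hp₂, hp₁, hp₂]

variable {S : Finset (CPoint (ρ ≫ s))} {D : Multiset (CPoint (κ ≫ ρ ≫ s))}

/-- A double lift is the sum of a fixed divisor and of a lift of the reduced part of the fibre
divisor. -/
lemma isDoubleLift_iff (hS : ∀ p, p ∈ S ↔ p.map ρ = y ∧ p ≠ p₁ ∧ p ≠ p₂)
    {x₁ x₁' x₂ x₂' : CPoint (κ ≫ ρ ≫ s)} (h₁ : x₁ ≠ x₁')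
    (h₁' : {q : CPoint (κ ≫ ρ ≫ s) | q.map κ = p₁} = {x₁, x₁'}) (h₂ : x₂ ≠ x₂')
    (h₂' : {q : CPoint (κ ≫ ρ ≫ s) | q.map κ = p₂} = {x₂, x₂'}) :
    IsDoubleLift κ ρ s y p₁ p₂ D ↔
      ∃ E : Multiset (CPoint (κ ≫ ρ ≫ s)), E.map (CPoint.map κ) = S.val ∧
        {x₁, x₁', x₂, x₂'} + E = D := by
  constructor
  · rintro ⟨z₁, z₁', z₂, z₂', E, -, hz₁, -, hz₂, hnd, hE, rfl⟩
    refine ⟨E, ?_, ?_⟩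
    · rw [Multiset.Nodup.ext hnd S.nodup]
      exact fun p => (hE p).trans (hS p).symm
    · have pair : ∀ a b c d : CPoint (κ ≫ ρ ≫ s), ({a, b} : Set (CPoint (κ ≫ ρ ≫ s))) = {c, d} →
          ({a, b} : Multiset (CPoint (κ ≫ ρ ≫ s))) = {c, d} := by
        intro a b c d h
        rcases Set.pair_eq_pair_iff.1 h with ⟨rfl, rfl⟩ | ⟨rfl, rfl⟩
        · rfl
        · exact Multiset.pair_comm _ _
      have e₁ := pair _ _ _ _ (h₁'.symm.trans hz₁)
      have e₂ := pair _ _ _ _ (h₂'.symm.trans hz₂)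
      congr 1
      exact congrArg₂ (· + ·) e₁ e₂
  · rintro ⟨E, hE, rfl⟩
    exact ⟨x₁, x₁', x₂, x₂', E, h₁, h₁', h₂, h₂', hE ▸ S.nodup, fun p => by
      rw [hE]; exact hS p, rfl⟩

lemma IsDoubleLift.map_eq (hS : ∀ p, p ∈ S ↔ p.map ρ = y ∧ p ≠ p₁ ∧ p ≠ p₂)
    (h : IsDoubleLift κ ρ s y p₁ p₂ D) : D.map (CPoint.map κ) = {p₁, p₁, p₂, p₂} + S.val := by
  obtain ⟨z₁, z₁', z₂, z₂', E, -, hz₁, -, hz₂, hnd, hE, rfl⟩ := h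
  have hE' : E.map (CPoint.map κ) = S.val := by
    rw [Multiset.Nodup.ext hnd S.nodup]
    exact fun p => (hE p).trans (hS p).symm
  have e₁ : z₁.map κ = p₁ := (Set.ext_iff.1 hz₁ z₁).2 (Or.inl rfl)
  have e₁' : z₁'.map κ = p₁ := (Set.ext_iff.1 hz₁ z₁').2 (Or.inr rfl)
  have e₂ : z₂.map κ = p₂ := (Set.ext_iff.1 hz₂ z₂).2 (Or.inl rfl)
  have e₂' : z₂'.map κ = p₂ := (Set.ext_iff.1 hz₂ z₂').2 (Or.inr rfl)
  rw [Multiset.map_add, hE']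
  simp [e₁, e₁', e₂, e₂']

lemma ncard_setOf_isDoubleLift [IsFinite κ] [Etale κ] (hκ : ∀ x, κ.finrank x = 2)
    (hS : ∀ p, p ∈ S ↔ p.map ρ = y ∧ p ≠ p₁ ∧ p ≠ p₂) :
    {D | IsDoubleLift κ ρ s y p₁ p₂ D}.ncard = 2 ^ S.card := by
  classical
  obtain ⟨x₁, x₁', h₁, h₁'⟩ := exists_map_eq_pair (κ := κ) hκ p₁
  obtain ⟨x₂, x₂', h₂, h₂'⟩ := exists_map_eq_pair (κ := κ) hκ p₂
  have : {D | IsDoubleLift κ ρ s y p₁ p₂ D} =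
      (({x₁, x₁', x₂, x₂'} : Multiset (CPoint (κ ≫ ρ ≫ s))) + ·) ''
        {E | E.map (CPoint.map κ) = S.val} :=
    Set.ext fun D => isDoubleLift_iff hS h₁ h₁' h₂ h₂'
  rw [this, Set.ncard_image_of_injective _ (add_right_injective _), ncard_setOf_map_eq_val]
  intro p
  obtain ⟨q, q', hne, h⟩ := exists_map_eq_pair (κ := κ) hκ p
  rw [h, Set.ncard_pair hne]

/-- If a lift of the fibre over `y` contains two distinct points over each of two points of `X`,
then these points are the ramification points. -/
lemma isDoubleLift_of_pairs [IsFinite κ] [Etale κ] (hκ : ∀ x, κ.finrank x = 2)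
    (hS : ∀ p, p ∈ S ↔ p.map ρ = y ∧ p ≠ p₁ ∧ p ≠ p₂)
    (hD : D.map (CPoint.map κ) = {p₁, p₁, p₂, p₂} + S.val) {a b a' b' : CPoint (κ ≫ ρ ≫ s)}
    (ha : a ∈ D) (hb : b ∈ D) (ha' : a' ∈ D) (hb' : b' ∈ D) (hab : a ≠ b)
    (hmab : a.map κ = b.map κ) (hab' : a' ≠ b') (hmab' : a'.map κ = b'.map κ)
    (hne : a.map κ ≠ a'.map κ) : IsDoubleLift κ ρ s y p₁ p₂ D := by
  classical
  have hram : ∀ {a b : CPoint (κ ≫ ρ ≫ s)}, a ∈ D → b ∈ D → a ≠ b → a.map κ = b.map κ →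
      a.map κ = p₁ ∨ a.map κ = p₂ := by
    intro a b ha hb hab hm
    have hle : ({a, b} : Multiset (CPoint (κ ≫ ρ ≫ s))) ≤ D := by
      refine (Multiset.le_iff_subset ?_).2 ?_
      · simpa using hab
      · intro z hz
        rcases (by simpa using hz : z = a ∨ z = b) with rfl | rfl <;> assumption
    have hc : 2 ≤ (D.map (CPoint.map κ)).count (a.map κ) := by
      refine le_trans ?_ (Multiset.count_le_of_le _ (Multiset.map_le_map hle))
      simp [← hm]
    by_contra! h
    rw [hD, Multiset.count_add, Multiset.count_eq_of_nodup S.nodup] at hc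
    simp only [Multiset.insert_eq_cons, Multiset.count_cons, Multiset.count_singleton, h.1, h.2,
      if_false] at hc
    split_ifs at hc <;> omega
  wlog h₁ : a.map κ = p₁ generalizing a b a' b'
  · have h₂ := (hram ha hb hab hmab).resolve_left h₁
    have h₁' := (hram ha' hb' hab' hmab').resolve_right fun h => hne (h₂.trans h.symm)
    exact this ha' hb' ha hb hab' hmab' hab hmab hne.symm h₁'
  have h₂ := (hram ha' hb' hab' hmab').resolve_left fun h => hne (h₁.trans h.symm)
  have fib : ∀ {p : CPoint (ρ ≫ s)} {a b : CPoint (κ ≫ ρ ≫ s)}, a ≠ b → a.map κ = p →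
      b.map κ = p → {q : CPoint (κ ≫ ρ ≫ s) | q.map κ = p} = {a, b} := by
    intro p a b hab ha hb
    obtain ⟨q, q', hne, h⟩ := exists_map_eq_pair (κ := κ) hκ p
    have hsub : ({a, b} : Set (CPoint (κ ≫ ρ ≫ s))) ⊆ {q, q'} := by
      rw [← h]
      rintro _ (rfl | rfl) <;> assumption
    rw [h]
    refine (Set.eq_of_subset_of_ncard_le hsub ?_ (Set.toFinite _)).symm
    rw [Set.ncard_pair hne, Set.ncard_pair hab]
  have hle : ({a, b, a', b'} : Multiset (CPoint (κ ≫ ρ ≫ s))) ≤ D := by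
    refine (Multiset.le_iff_subset ?_).2 ?_
    · have e₁ : a ≠ a' := fun e => hne (e ▸ rfl)
      have e₂ : a ≠ b' := fun e => hne (hmab' ▸ e ▸ rfl)
      have e₃ : b ≠ a' := fun e => hne (hmab.trans (e ▸ rfl))
      have e₄ : b ≠ b' := fun e => hne (hmab.trans (hmab' ▸ e ▸ rfl))
      simp [hab, hab', e₁, e₂, e₃, e₄]
    · intro z hz
      rcases (by simpa using hz : z = a ∨ z = b ∨ z = a' ∨ z = b') with
        rfl | rfl | rfl | rfl <;> assumption
  have hb₁ := hmab.symm.trans h₁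
  have hb₂ := hmab'.symm.trans h₂
  refine (isDoubleLift_iff hS hab (fib hab h₁ hb₁) hab' (fib hab' h₂ hb₂)).2
    ⟨D - {a, b, a', b'}, ?_, add_tsub_cancel_of_le hle⟩
  rw [← add_tsub_cancel_of_le hle, Multiset.map_add] at hD
  have e : Multiset.map (CPoint.map κ) {a, b, a', b'} = {p₁, p₁, p₂, p₂} := by
    simp [h₁, h₂, hb₁, hb₂]
  rw [e] at hD
  exact add_left_cancel hD

end DoubleLift

end CurveLift

/-! ### The singular points -/

namespace CurveLift

open SymTensor

section Singular

variable {Xt X Y : Scheme.{0}} {κ : Xt ⟶ X} {ρ : X ⟶ Y} {s : Y ⟶ Spec (.of ℂ)} {n : ℕ}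
  {y : CPoint s}

lemma IsSimplyRamifiedOver.ramMult_le (h : IsSimplyRamifiedOver ρ s y) (p : CPoint (ρ ≫ s))
    (hp : p.map ρ = y) : ramMult ρ p.pt ≤ 2 := by
  rcases h.1 p hp with h | h <;> omega

lemma HasTwoRamificationPoints.ramMult_le {p₁ p₂ : CPoint (ρ ≫ s)}
    (h : HasTwoRamificationPoints ρ s y p₁ p₂) (p : CPoint (ρ ≫ s))
    (hp : p.map ρ = y) : ramMult ρ p.pt ≤ 2 := by
  by_cases h₁ : p = p₁
  · exact h₁ ▸ h.ramMult_left.le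
  by_cases h₂ : p = p₂
  · exact h₂ ▸ h.ramMult_right.le
  rw [h.ramMult_other p hp h₁ h₂]
  omega

/-- Distinct indices with the same point in a fibre make this point a ramification point. -/
lemma IsFibreDivisor.ramMult_ne_one {q : Fin n → CPoint (ρ ≫ s)}
    (h : IsFibreDivisor ρ s y (Multiset.ofList (List.ofFn q))) {i j : Fin n} (hij : i ≠ j)
    (hq : q i = q j) : ramMult ρ (q i).pt ≠ 1 := by
  classical
  have h0 := h (q i)
  rw [if_pos (h.map_eq i)] at h0
  rw [← h0]
  intro h1
  have h2 := (count_coe_ofFn q (q i)).symm.trans (by convert h1)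
  rw [Nat.card_eq_one_iff_unique] at h2
  obtain ⟨hs, -⟩ := h2
  exact hij (congrArg Subtype.val (hs.elim ⟨i, rfl⟩ ⟨j, hq.symm⟩))

lemma isDoubleLift_coe_ofFn_of_pairs [IsFinite κ] [Etale κ] (hκ : ∀ x, κ.finrank x = 2)
    {p₁ p₂ : CPoint (ρ ≫ s)} (hy : HasTwoRamificationPoints ρ s y p₁ p₂)
    {x : Fin n → CPoint (κ ≫ ρ ≫ s)}
    (hD : IsFibreDivisor ρ s y (Multiset.ofList (List.ofFn fun i => (x i).map κ)))
    {i j i' j' : Fin n} (h₁ : x i ≠ x j) (h₁' : (x i).map κ = (x j).map κ) (h₂ : x i' ≠ x j')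
    (h₂' : (x i').map κ = (x j').map κ) (hne : (x i).map κ ≠ (x i').map κ) :
    IsDoubleLift κ ρ s y p₁ p₂ (Multiset.ofList (List.ofFn x)) := by
  obtain ⟨S, hS, hF⟩ := hy.exists_finset hD
  have mem : ∀ i, x i ∈ Multiset.ofList (List.ofFn x) := fun i => by
    rw [coe_ofFn_eq_map]
    exact Multiset.mem_map_of_mem x (Finset.mem_univ_val i)
  refine isDoubleLift_of_pairs hκ hS ?_ (mem i) (mem j) (mem i') (mem j') h₁ h₁' h₂ h₂' hne
  rw [← hF, coe_ofFn_eq_map, coe_ofFn_eq_map, Multiset.map_map]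
  rfl

/-- A double lift is a divisor `x₁ + ⋯ + xₙ` which maps to the fibre over `y` and contains two
distinct points over each of the two ramification points. -/
lemma IsDoubleLift.exists_eq_coe_ofFn {p₁ p₂ : CPoint (ρ ≫ s)}
    (hy : HasTwoRamificationPoints ρ s y p₁ p₂) {q : Fin n → CPoint (ρ ≫ s)}
    (hq : IsFibreDivisor ρ s y (Multiset.ofList (List.ofFn q)))
    {D : Multiset (CPoint (κ ≫ ρ ≫ s))} (h : IsDoubleLift κ ρ s y p₁ p₂ D) :
    ∃ x : Fin n → CPoint (κ ≫ ρ ≫ s), D = Multiset.ofList (List.ofFn x) ∧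
      IsFibreDivisor ρ s y (Multiset.ofList (List.ofFn fun i => (x i).map κ)) ∧
      ∃ i j i' j', x i ≠ x j ∧ (x i).map κ = (x j).map κ ∧ x i' ≠ x j' ∧
        (x i').map κ = (x j').map κ ∧ (x i).map κ ≠ (x i').map κ := by
  obtain ⟨S, hS, hF⟩ := hy.exists_finset hq
  have hmap := (h.map_eq hS).trans hF.symm
  have hcard : Multiset.card D = n := by
    rw [← Multiset.card_map (CPoint.map κ), hmap, Multiset.coe_card, List.length_ofFn]
  obtain ⟨l, rfl⟩ := Quot.exists_rep D
  obtain rfl : l.length = n := hcard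
  have hl : Multiset.ofList (List.ofFn l.get) = Multiset.ofList l := by
    rw [List.ofFn_get]
  have hD : IsFibreDivisor ρ s y (Multiset.ofList (List.ofFn fun i => (l.get i).map κ)) := by
    have : Multiset.ofList (List.ofFn fun i => (l.get i).map κ) =
        (Multiset.ofList l).map (CPoint.map κ) := by
      rw [← hl, coe_ofFn_eq_map, coe_ofFn_eq_map, Multiset.map_map]
      rfl
    rw [this]
    exact (show (Multiset.ofList l).map (CPoint.map κ) = _ from hmap) ▸ hq
  refine ⟨l.get, hl.symm, hD, ?_⟩
  obtain ⟨z₁, z₁', z₂, z₂', E, h₁, hz₁, h₂, hz₂, -, -, hDE⟩ := h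
  have mem : ∀ z ∈ ({z₁, z₁', z₂, z₂'} : Multiset (CPoint (κ ≫ ρ ≫ s))), ∃ i, l.get i = z := by
    intro z hz
    refine List.mem_iff_get.1 ?_
    have : z ∈ ({z₁, z₁', z₂, z₂'} : Multiset (CPoint (κ ≫ ρ ≫ s))) + E :=
      Multiset.mem_add.2 (Or.inl hz)
    rw [← hDE] at this
    exact this
  obtain ⟨i, hi⟩ := mem z₁ (by simp)
  obtain ⟨j, hj⟩ := mem z₁' (by simp)
  obtain ⟨i', hi'⟩ := mem z₂ (by simp)
  obtain ⟨j', hj'⟩ := mem z₂' (by simp)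
  have e₁ : z₁.map κ = p₁ := (Set.ext_iff.1 hz₁ z₁).2 (Or.inl rfl)
  have e₁' : z₁'.map κ = p₁ := (Set.ext_iff.1 hz₁ z₁').2 (Or.inr rfl)
  have e₂ : z₂.map κ = p₂ := (Set.ext_iff.1 hz₂ z₂).2 (Or.inl rfl)
  have e₂' : z₂'.map κ = p₂ := (Set.ext_iff.1 hz₂ z₂').2 (Or.inr rfl)
  refine ⟨i, j, i', j', ?_⟩
  rw [hi, hj, hi', hj', e₁, e₁', e₂, e₂']
  exact ⟨h₁, rfl, h₂, rfl, hy.ne⟩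

lemma finiteType_liftRing [IsAffineHom κ] [IsAffineHom ρ] [LocallyOfFiniteType κ]
    [LocallyOfFiniteType ρ] [LocallyOfFiniteType s] {V : Y.Opens} (hV : IsAffineOpen V) :
    Algebra.FiniteType ℂ (liftRing κ ρ s n V) := by
  have : Algebra.FiniteType ℂ (Sec s V) := finiteType_sec hV
  have : Algebra.FiniteType ℂ (Sec (κ ≫ ρ ≫ s) (κ ⁻¹ᵁ ρ ⁻¹ᵁ V)) :=
    finiteType_sec ((hV.preimage ρ).preimage κ)
  infer_instance

lemma exists_isFreeChart_of_cpoint [IsFinite ρ] [Flat ρ] [LocallyOfFiniteType s]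
    (hρ : ∀ y, ρ.finrank y = n) (y : CPoint s) :
    ∃ V : Y.AffineZariskiSite, y.pt ∈ V.1 ∧ IsFreeChart ρ s n V.1 := by
  obtain ⟨_, ⟨W, hW, rfl⟩, hyW, -⟩ := Y.isBasis_affineOpens.exists_subset_of_mem_open
    (Set.mem_univ y.pt) isOpen_univ
  obtain ⟨g, hg, h⟩ := exists_isFreeChart ρ s hρ hW hyW
  exact ⟨⟨_, h.isAffineOpen⟩, hg, h⟩

lemma isRegularLocalRing_stalk_chartPoint_iff [NeZero n] [IsAffineHom κ] [IsAffineHom ρ]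
    (V : Y.AffineZariskiSite)
    (χ : liftRing κ ρ s n V.1 →ₐ[ℂ] ℂ) :
    IsRegularLocalRing ((liftCurve κ ρ s n).presheaf.stalk (chartPoint V χ)) ↔
      IsRegularLocalRing (Localization.AtPrime (RingHom.ker χ)) := by
  let P : PrimeSpectrum (liftRing κ ρ s n V.1) := ⟨RingHom.ker χ, inferInstance⟩
  rw [chartPoint_eq_of_asIdeal_eq (P := P) rfl]
  exact isRegularLocalRing_stalk_iff κ ρ s n V P

/-- Over a point with at most one ramification point the fibre product is regular. -/
lemma IsChartPoint.isDomain_and_isPrincipalIdealRing_of_isSimplyRamifiedOver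
    [IsFinite κ] [Etale κ] [IsFinite ρ] (hY : SmoothOfRelativeDimension 1 s)
    (hX : SmoothOfRelativeDimension 1 (ρ ≫ s))
    (hκ : ∀ x, κ.finrank x = 2) (hy : IsSimplyRamifiedOver ρ s y) {V : Y.Opens}
    (hV : IsFreeChart ρ s n V) {χ : liftRing κ ρ s n V →ₐ[ℂ] ℂ}
    {x : Fin n → CPoint (κ ≫ ρ ≫ s)} (h : IsChartPoint κ ρ s V χ y x)
    (hD : IsFibreDivisor ρ s y (Multiset.ofList (List.ofFn fun i => (x i).map κ))) :
    IsDomain (Localization.AtPrime (RingHom.ker χ)) ∧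
      IsPrincipalIdealRing (Localization.AtPrime (RingHom.ker χ)) :=
  h.isDomain_and_isPrincipalIdealRing hY hX hκ hV hy.ramMult_le
    fun i _ i' _ h₁ h₁' h₂ h₂' => hy.2 _ _ (hD.map_eq i) (hD.map_eq i')
      (hD.ramMult_ne_one (fun e => h₁ (congrArg x e)) h₁')
      (hD.ramMult_ne_one (fun e => h₂ (congrArg x e)) h₂')

variable [NeZero n] [IsFinite κ] [Etale κ] [IsFinite ρ] [Flat ρ] {p₁ p₂ : CPoint (ρ ≫ s)}

lemma mem_singularPoints_of_isDoubleLift (hY : SmoothOfRelativeDimension 1 s)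
    (hX : SmoothOfRelativeDimension 1 (ρ ≫ s)) (hρ : ∀ y, ρ.finrank y = n)
    (hκ : ∀ x, κ.finrank x = 2) (hy : HasTwoRamificationPoints ρ s y p₁ p₂)
    {D : Multiset (CPoint (κ ≫ ρ ≫ s))} (hD : IsDoubleLift κ ρ s y p₁ p₂ D)
    {c : liftCurve κ ρ s n} (hc : IsPointOf κ ρ s n c y D) :
    c ∈ singularPoints (liftCurve κ ρ s n) := by
  have : Smooth s := SmoothOfRelativeDimension.smooth 1 s
  obtain ⟨V, hyV, hV⟩ := exists_isFreeChart_of_cpoint hρ y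
  obtain ⟨q, -, hq, -⟩ := exists_isFibreDivisor hV y hyV
  obtain ⟨x, rfl, hx, i, j, i', j', h₁, h₁', h₂, h₂', hne⟩ := hD.exists_eq_coe_ofFn hy hq
  obtain ⟨χ, hχ, rfl⟩ := hc.exists_isChartPoint hx hyV
  intro h
  exact hχ.not_isRegularLocalRing hY hX hκ hV h₁ h₁' h₂ h₂' hne
    ((isRegularLocalRing_stalk_chartPoint_iff V χ).1 h)

/-- A closed singular point is not over `y' ≠ y`, and its divisor contains two pairs. A point which
is not closed is a generization of a closed point over some `y' ≠ y`, as there are finitely many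
points over `y`, so it is regular. -/
lemma exists_isDoubleLift_of_mem_singularPoints (hY : SmoothOfRelativeDimension 1 s)
    (hX : SmoothOfRelativeDimension 1 (ρ ≫ s)) (hρ : ∀ y, ρ.finrank y = n)
    (hκ : ∀ x, κ.finrank x = 2) (hy : HasTwoRamificationPoints ρ s y p₁ p₂)
    (hsimple : ∀ y', y' ≠ y → IsSimplyRamifiedOver ρ s y') {c : liftCurve κ ρ s n}
    (hc : c ∈ singularPoints (liftCurve κ ρ s n)) :
    ∃ D, IsDoubleLift κ ρ s y p₁ p₂ D ∧ IsPointOf κ ρ s n c y D := by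
  have : Smooth s := SmoothOfRelativeDimension.smooth 1 s
  obtain ⟨V, P, hV, rfl⟩ := exists_isFreeChart_liftCurveChart_eq hρ c
  have hc' : ¬ IsRegularLocalRing (Localization.AtPrime P.asIdeal) :=
    fun h => hc ((isRegularLocalRing_stalk_iff κ ρ s n V P).2 h)
  have := finiteType_liftRing (κ := κ) (ρ := ρ) (s := s) (n := n) hV.isAffineOpen
  by_cases hP : P.asIdeal.IsMaximal
  · obtain ⟨χ, hχ⟩ := exists_ker_eq_of_isMaximal P.asIdeal
    rw [← chartPoint_eq_of_asIdeal_eq hχ.symm] at hc ⊢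
    replace hc' := fun h => hc ((isRegularLocalRing_stalk_chartPoint_iff V χ).2 h)
    obtain ⟨y', x, hx, hD⟩ := exists_isChartPoint hV χ
    obtain rfl : y' = y := by
      by_contra hne
      exact hc' (isRegularLocalRing_of_le le_rfl
        (hx.isDomain_and_isPrincipalIdealRing_of_isSimplyRamifiedOver hY hX hκ (hsimple y' hne)
          hV hD))
    refine ⟨_, ?_, isPointOf_iff.2 ⟨V, χ, x, rfl, hx, rfl⟩⟩
    by_contra hnot
    refine hc' (isRegularLocalRing_of_le le_rfl
      (hx.isDomain_and_isPrincipalIdealRing hY hX hκ hV hy.ramMult_le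
        fun i j i' j' h₁ h₁' h₂ h₂' => ?_))
    by_contra hne
    exact hnot (isDoubleLift_coe_ofFn_of_pairs hκ hy hD h₁ h₁' h₂ h₂' hne)
  · obtain ⟨χ, hχ, hle⟩ := exists_notMem_of_not_isMaximal hP (finite_setOf_isChartPoint hκ hV y)
    obtain ⟨y', x, hx, hD⟩ := exists_isChartPoint hV χ
    have hne : y' ≠ y := fun e => hχ ⟨x, e ▸ hx⟩
    exact (hc' (isRegularLocalRing_of_le hle
      (hx.isDomain_and_isPrincipalIdealRing_of_isSimplyRamifiedOver hY hX hκ (hsimple y' hne)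
        hV hD))).elim

end Singular

end CurveLift

theorem mainTheorem8 {Xt X Y : AlgebraicGeometry.Scheme.{0}} (κ : Xt ⟶ X) (ρ : X ⟶ Y)
    (s : Y ⟶ AlgebraicGeometry.Spec (.of ℂ)) (n : ℕ) [NeZero n]
    (hY : CurveLift.IsSmoothProjectiveCurve s) (hX : CurveLift.IsSmoothProjectiveCurve (ρ ≫ s))
    [AlgebraicGeometry.IsFinite ρ] [AlgebraicGeometry.Flat ρ] (hρ : ∀ y, ρ.finrank y = n)
    [AlgebraicGeometry.IsFinite κ] [AlgebraicGeometry.Etale κ] (hκ : ∀ x, κ.finrank x = 2)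
    (y : CurveLift.CPoint s) (p₁ p₂ : CurveLift.CPoint (ρ ≫ s))
    (hy : CurveLift.HasTwoRamificationPoints ρ s y p₁ p₂)
    (hsimple : ∀ y', y' ≠ y → CurveLift.IsSimplyRamifiedOver ρ s y') :
    (CurveLift.singularPoints (CurveLift.liftCurve κ ρ s n)).ncard = 2 ^ (n - 4) ∧
    CurveLift.singularPoints (CurveLift.liftCurve κ ρ s n) =
      {c | ∃ D, CurveLift.IsDoubleLift κ ρ s y p₁ p₂ D ∧ CurveLift.IsPointOf κ ρ s n c y D} ∧
    ∀ D, CurveLift.IsDoubleLift κ ρ s y p₁ p₂ D → ∃! c, CurveLift.IsPointOf κ ρ s n c y D := by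
  have hYs := hY.smooth
  have hXs := hX.smooth
  have : AlgebraicGeometry.Smooth s := AlgebraicGeometry.SmoothOfRelativeDimension.smooth 1 s
  obtain ⟨V, hyV, hV⟩ := CurveLift.exists_isFreeChart_of_cpoint hρ y
  obtain ⟨q, -, hq, -⟩ := CurveLift.exists_isFibreDivisor hV y hyV
  have hunique : ∀ D, CurveLift.IsDoubleLift κ ρ s y p₁ p₂ D →
      ∃! c, CurveLift.IsPointOf κ ρ s n c y D := by
    intro D hD
    obtain ⟨x, rfl, hx, -⟩ := hD.exists_eq_coe_ofFn hy hq
    exact CurveLift.existsUnique_isPointOf hx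
  have hsing : CurveLift.singularPoints (CurveLift.liftCurve κ ρ s n) =
      {c | ∃ D, CurveLift.IsDoubleLift κ ρ s y p₁ p₂ D ∧ CurveLift.IsPointOf κ ρ s n c y D} :=
    Set.ext fun c =>
      ⟨CurveLift.exists_isDoubleLift_of_mem_singularPoints hYs hXs hρ hκ hy hsimple,
        fun ⟨D, hD, hc⟩ => CurveLift.mem_singularPoints_of_isDoubleLift hYs hXs hρ hκ hy hD hc⟩
  refine ⟨?_, hsing, hunique⟩
  -- the fibre divisor has degree `n`, so there are `n - 4` points other than `p₁` and `p₂`, and the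
  -- double lifts are in bijection with the singular points
  obtain ⟨S, hS, hF⟩ := hy.exists_finset hq
  have hcard : S.card = n - 4 := by
    have h := congrArg Multiset.card hF
    rw [Multiset.coe_card, List.length_ofFn, Multiset.card_add] at h
    have h4 : Multiset.card ({p₁, p₁, p₂, p₂} : Multiset (CurveLift.CPoint (ρ ≫ s))) = 4 := rfl
    rw [h4] at h
    change Multiset.card S.val = _
    omega
  rw [← hcard, ← CurveLift.ncard_setOf_isDoubleLift hκ hS, hsing]
  symm
  refine Set.ncard_congr (fun D hD => (hunique D hD).choose)
    (fun D hD => ⟨D, hD, (hunique D hD).choose_spec.1⟩) ?_ ?_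
  · intro D D' hD hD' h
    have h₁ := (hunique D hD).choose_spec.1
    have h₂ := (hunique D' hD').choose_spec.1
    simp only at h₁ h₂ h
    rw [h] at h₁
    obtain ⟨x, rfl, hx, -⟩ := CurveLift.IsDoubleLift.exists_eq_coe_ofFn hy hq hD
    obtain ⟨x', rfl, hx', -⟩ := CurveLift.IsDoubleLift.exists_eq_coe_ofFn hy hq hD'
    exact h₁.coe_ofFn_eq h₂ hx hx'
  · rintro c ⟨D, hD, hc⟩
    exact ⟨D, hD, (hunique D hD).unique (hunique D hD).choose_spec.1 hc⟩
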